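/- Let $K$ be a field and $a_0,u\in K$. Let $Pa(n)=Pa_{a_0,u}(n)$ be the partition algebra with genus evaluation $a_g=a_0u^g$ and handle relation $\text{handle}=u$ (so there is $\ell=1$ handle eigenvalue; $u=1$ is the classical partition algebra): its basis is the set of partition diagrams, i.e. set partitions of $n$ bottom and $n$ top points, and the product of $d$ and $e$ is $a_0^{f}u^{h}$ times the diagram obtained by stacking $d$ on top of $e$, where $f$ is the number of floating components and $h$ the total number of handles (independent cycles) created. Let $pPa(n)$, $Mo(n)$, $TL(n)$, $pRo(n)\subset Pa(n)$ be the spans of the planar diagrams with, respectively, arbitrary blocks; blocks of size at most $2$; blocks of size exactly $2$; blocks with at most one bottom and at most one top point. A simple module has apex $s$ if all diagrams with fewer than $s$ through strands (blocks meeting bottom and top) annihilate it, but not all diagrams with exactly $s$ through strands do. Whenever the algebra is semisimple, let $\Delta^n_k$ denote its simple module with label $k$. For $pRo$, $Mo$, $TL$ the label is the apex, and the admissible labels are $0\le k\le n$, for $TL$ with $k\equiv n \pmod 2$; for $pPa$ the label is the highest weight $k=2s$, where $s$ is the apex, $0\le s\le n$. These modules exist for all admissible labels. There are constants $C_{pRo},C_{TL},C_{Mo},C_{pPa}\in\mathbb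 R_{>0}$, independent of $n$, $k$, $K$, $a_0$, $u$, such that for every $R>0$, uniformly in all $n\ge 1$, all $K,a_0,u$ for which the respective algebra is semisimple, and all admissible $k$ with $|k-n/2|\le R\sqrt n$ in the case of $pRo$ and with $k\le R\sqrt n$ in the other three cases, \begin{align*} \dim \Delta^n_{k}|_{pRo}&=\big(C_{pRo}+o(1)\big)\,n^{-1/2}\,2^{n}\,\exp\!\big(-\tfrac{2(k-n/2)^2}{n}\big),\\ \dim \Delta^n_{k}|_{TL}&=\big(C_{TL}+O(n^{-1/2})\big)\,n^{-3/2}\,2^{n}\,(k+1)\,\exp\!\big(-\tfrac{k^{2}}{2n}\big),\\ \dim \Delta^n_{k}|_{Mo}&=\big(C_{Mo}+O(n^{-1/2})\big)\,n^{-3/2}\,3^{n}\,(k+1)\,\exp\!\big(-\tfrac{3k^{2}}{4n}\big),\\ \dim \Delta^n_{k}|_{pPa}&=\big(C_{pPa}+O(n^{-1/2})\big)\,n^{-3/2}\,4^{n}\,(k+1)\,\exp\!\big(-\tfrac{k^{2}}{4n}\big), \end{align*} where $o(1)$ (as $n\to\infty$) and the $O$-constants depend only on $R$. -/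

import Mathlib

universe v w

/-- A partition diagram on `n` strands: a set partition, written as an equivalence relation, of
`n` bottom points `Sum.inl i` and `n` top points `Sum.inr i`. -/
abbrev PartDiag (n : ℕ) : Type := Setoid (Fin n ⊕ Fin n)

namespace PartDiag

/-- The two lower layers of the three layers bottom, middle, top. -/
def lower {n : ℕ} : Fin n ⊕ Fin n → Fin n ⊕ (Fin n ⊕ Fin n) :=
  Sum.elim Sum.inl (fun i => Sum.inr (Sum.inl i))

/-- The two upper layers of the three layers bottom, middle, top. -/
def upper {n : ℕ} : Fin n ⊕ Fin n → Fin n ⊕ (Fin n ⊕ Fin n) := Sum.inr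

/-- The bottom and the top layer of the three layers bottom, middle, top. -/
def outer {n : ℕ} : Fin n ⊕ Fin n → Fin n ⊕ (Fin n ⊕ Fin n) :=
  Sum.elim Sum.inl (fun i => Sum.inr (Sum.inr i))

/-- The connected components of the picture obtained by stacking `d` on top of `e`. -/
def stack {n : ℕ} (d e : PartDiag n) : Setoid (Fin n ⊕ (Fin n ⊕ Fin n)) :=
  Setoid.map d upper ⊔ Setoid.map e lower

/-- The diagram obtained by stacking `d` on top of `e` and forgetting the middle layer. -/
def comp {n : ℕ} (d e : PartDiag n) : PartDiag n := Setoid.comap outer (stack d e)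

/-- The identity diagram. -/
def one (n : ℕ) : PartDiag n := Setoid.ker (Sum.elim id id : Fin n ⊕ Fin n → Fin n)

/-- The number of blocks. -/
noncomputable def numBlocks {n : ℕ} (d : PartDiag n) : ℕ := Nat.card (Quotient d)

/-- The number of floating components that appear when `d` is stacked on top of `e`. -/
noncomputable def floating {n : ℕ} (d e : PartDiag n) : ℕ :=
  Nat.card {q : Quotient (stack d e) // ∀ x, Quotient.mk (stack d e) (outer x) ≠ q}

/-- The total number of handles (on floating and on non-floating components) that appear when `d`
is stacked on top of `e`. The blocks of `d` and `e` are surfaces of genus zero, represented by their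
spines (trees), and they are glued along the `n` middle points, so this is the first Betti number
`#components - χ` of the resulting graph, where `χ = #blocks of d + #blocks of e - n`.
The subtraction never truncates, see `numBlocks_add_le`. -/
noncomputable def handles {n : ℕ} (d e : PartDiag n) : ℕ :=
  Nat.card (Quotient (stack d e)) + n - (numBlocks d + numBlocks e)

/-- The number of through strands: blocks with a bottom point and a top point. -/
noncomputable def through {n : ℕ} (d : PartDiag n) : ℕ :=
  Nat.card {q : Quotient d // (∃ i, Quotient.mk d (Sum.inl i) = q) ∧
    ∃ i, Quotient.mk d (Sum.inr i) = q}

/-- The points in their cyclic order on the boundary of the rectangle: the bottom points from left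
to right, then the top points from right to left. -/
def pos {n : ℕ} : Fin n ⊕ Fin n → ℕ :=
  Sum.elim (fun i => (i : ℕ)) (fun i => 2 * n - 1 - (i : ℕ))

/-- A diagram is planar if no two of its blocks cross. -/
def Planar {n : ℕ} (d : PartDiag n) : Prop :=
  ∀ w x y z, pos w < pos x → pos x < pos y → pos y < pos z → d w y → d x z → d w x

/-- Planar partition diagrams. -/
def IsPPa {n : ℕ} (d : PartDiag n) : Prop := Planar d

/-- Motzkin diagrams: planar, all blocks of size `1` or `2`. -/
def IsMo {n : ℕ} (d : PartDiag n) : Prop := Planar d ∧ ∀ x, {y | d x y}.ncard ≤ 2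

/-- Temperley-Lieb diagrams: planar, all blocks of size `2`. -/
def IsTL {n : ℕ} (d : PartDiag n) : Prop := Planar d ∧ ∀ x, {y | d x y}.ncard = 2

/-- Planar rook diagrams: planar, every block has at most one bottom and at most one top point. -/
def IsPRo {n : ℕ} (d : PartDiag n) : Prop :=
  Planar d ∧ (∀ i j, d (Sum.inl i) (Sum.inl j) → i = j) ∧
    ∀ i j, d (Sum.inr i) (Sum.inr j) → i = j

theorem stack_le_ker {n : ℕ} {α : Type*} (d e : PartDiag n) (b m t : Fin n → α) :
    stack d e ≤ Setoid.ker (Sum.elim b (Sum.elim m t)) ↔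
      d ≤ Setoid.ker (Sum.elim m t) ∧ e ≤ Setoid.ker (Sum.elim b m) := by
  have key : ∀ (r : PartDiag n) (f : Fin n ⊕ Fin n → Fin n ⊕ (Fin n ⊕ Fin n))
      (s : Setoid (Fin n ⊕ (Fin n ⊕ Fin n))), Setoid.map r f ≤ s ↔ r ≤ Setoid.comap f s := by
    intro r f s
    constructor
    · intro h x y hxy
      exact h (Relation.EqvGen.rel _ _ ⟨x, y, hxy, rfl, rfl⟩)
    · intro h
      refine Setoid.eqvGen_le ?_
      rintro _ _ ⟨x, y, hxy, rfl, rfl⟩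
      exact h hxy
  unfold stack
  rw [sup_le_iff, key, key]
  have e2 : (Sum.elim b (Sum.elim m t)) ∘ lower = Sum.elim b m := by
    ext x; rcases x with x | x <;> rfl
  have h1 : Setoid.comap upper (Setoid.ker (Sum.elim b (Sum.elim m t)))
      = Setoid.ker (Sum.elim m t) := rfl
  have h2 : Setoid.comap lower (Setoid.ker (Sum.elim b (Sum.elim m t)))
      = Setoid.ker (Sum.elim b m) := by
    rw [← e2]; rfl
  rw [h1, h2]

theorem numBlocks_add_le {n : ℕ} (d e : PartDiag n) :
    numBlocks d + numBlocks e ≤ Nat.card (Quotient (stack d e)) + n := by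
  classical
  have : Fintype (Quotient d) := Fintype.ofFinite _
  have : Fintype (Quotient e) := Fintype.ofFinite _
  have : Fintype (Quotient (stack d e)) := Fintype.ofFinite _
  let φ : ((Quotient d → ℚ) × (Quotient e → ℚ)) →ₗ[ℚ] (Fin n → ℚ) :=
    { toFun := fun p i => p.1 (Quotient.mk d (Sum.inl i)) - p.2 (Quotient.mk e (Sum.inr i))
      map_add' := by intro p q; ext i; simp; ring
      map_smul' := by intro c p; ext i; simp; ring }
  let ψ : (Quotient (stack d e) → ℚ) →ₗ[ℚ] ((Quotient d → ℚ) × (Quotient e → ℚ)) :=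
    { toFun := fun c =>
        (fun q => c (Quotient.mk _ (upper q.out)), fun q => c (Quotient.mk _ (lower q.out)))
      map_add' := by intro p q; rfl
      map_smul' := by intro c p; rfl }
  have hker : LinearMap.ker φ ≤ LinearMap.range ψ := by
    rintro ⟨f, g⟩ hfg
    have hm : ∀ i, f (Quotient.mk d (Sum.inl i)) = g (Quotient.mk e (Sum.inr i)) := by
      intro i
      have := congrFun (LinearMap.mem_ker.1 hfg) i
      exact sub_eq_zero.1 this
    let b : Fin n → ℚ := fun i => g (Quotient.mk e (Sum.inl i))
    let m : Fin n → ℚ := fun i => f (Quotient.mk d (Sum.inl i))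
    let t : Fin n → ℚ := fun i => f (Quotient.mk d (Sum.inr i))
    have hf : ∀ x, Sum.elim m t x = f (Quotient.mk d x) := by
      rintro (x | x) <;> rfl
    have hg : ∀ x, Sum.elim b m x = g (Quotient.mk e x) := by
      rintro (x | x)
      · rfl
      · exact hm x
    have hle : stack d e ≤ Setoid.ker (Sum.elim b (Sum.elim m t)) := by
      rw [stack_le_ker]
      constructor
      · intro x y hxy
        rw [Setoid.ker_def, hf, hf]
        exact congrArg f (Quotient.sound hxy)
      · intro x y hxy
        rw [Setoid.ker_def, hg, hg]
        exact congrArg g (Quotient.sound hxy)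
    refine ⟨Quotient.lift (Sum.elim b (Sum.elim m t)) (fun x y h => hle h), ?_⟩
    refine Prod.ext ?_ ?_
    · funext q
      change Sum.elim m t q.out = f q
      rw [hf, Quotient.out_eq]
    · funext q
      have : Sum.elim b (Sum.elim m t) (lower q.out) = Sum.elim b m q.out := by
        rcases q.out with x | x <;> rfl
      change Sum.elim b (Sum.elim m t) (lower q.out) = g q
      rw [this, hg, Quotient.out_eq]
  have h1 := LinearMap.finrank_range_add_finrank_ker φ
  have h2 : Module.finrank ℚ (LinearMap.range φ) ≤ n := by
    simpa using Submodule.finrank_le (LinearMap.range φ)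
  have h3 := Submodule.finrank_mono hker
  have h4 : Module.finrank ℚ (LinearMap.range ψ) ≤ Nat.card (Quotient (stack d e)) := by
    simpa [Nat.card_eq_fintype_card] using LinearMap.finrank_range_le ψ
  have h5 : Module.finrank ℚ ((Quotient d → ℚ) × (Quotient e → ℚ))
      = numBlocks d + numBlocks e := by
    simp [numBlocks, Nat.card_eq_fintype_card]
  omega

theorem card_stack {n : ℕ} (d e : PartDiag n) :
    Nat.card (Quotient (stack d e)) = numBlocks (comp d e) + floating d e := by
  classical
  have h := Nat.card_congr (Equiv.sumCompl
    (fun q : Quotient (stack d e) => ∀ x, Quotient.mk (stack d e) (outer x) ≠ q))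
  rw [Nat.card_sum] at h
  have h2 : numBlocks (comp d e) = Nat.card {q : Quotient (stack d e) //
      ¬ ∀ x, Quotient.mk (stack d e) (outer x) ≠ q} := by
    let G : Quotient (comp d e) → {q : Quotient (stack d e) //
        ¬ ∀ x, Quotient.mk (stack d e) (outer x) ≠ q} :=
      Quotient.lift (fun x => ⟨Quotient.mk (stack d e) (outer x), fun hx => hx x rfl⟩)
        (fun x y hxy => by
          have h3 : stack d e (outer x) (outer y) := hxy
          exact Subtype.ext (Quotient.sound h3))
    refine Nat.card_congr (Equiv.ofBijective G ⟨?_, ?_⟩)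
    · intro p q
      induction p using Quotient.inductionOn
      induction q using Quotient.inductionOn
      intro hpq
      have h3 := Quotient.exact (s := stack d e) (congrArg Subtype.val hpq)
      exact Quotient.sound (s := comp d e) h3
    · rintro ⟨q, hq⟩
      push Not at hq
      obtain ⟨x, hx⟩ := hq
      exact ⟨Quotient.mk _ x, Subtype.ext hx⟩
  unfold floating
  omega

/-- The matrix of a diagram acting on two-coloured points. -/
noncomputable def toMatrix {n : ℕ} (d : PartDiag n) :
    Matrix (Fin n → Bool) (Fin n → Bool) ℕ :=
  fun t b => Nat.card {_x : Unit // d ≤ Setoid.ker (Sum.elim b t)}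

theorem toMatrix_pos {n : ℕ} (d : PartDiag n) (t b : Fin n → Bool)
    (h : d ≤ Setoid.ker (Sum.elim b t)) : toMatrix d t b = 1 := by
  simp [toMatrix, h]

theorem toMatrix_neg {n : ℕ} (d : PartDiag n) (t b : Fin n → Bool)
    (h : ¬ d ≤ Setoid.ker (Sum.elim b t)) : toMatrix d t b = 0 := by
  simp [toMatrix, h]

theorem card_extensions {n : ℕ} (d e : PartDiag n) (b t : Fin n → Bool)
    (h : comp d e ≤ Setoid.ker (Sum.elim b t)) :
    Nat.card {m : Fin n → Bool // stack d e ≤ Setoid.ker (Sum.elim b (Sum.elim m t))}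
      = 2 ^ floating d e := by
  classical
  have hout : ∀ (m : Fin n → Bool) x,
      Sum.elim b (Sum.elim m t) (outer x) = Sum.elim b t x := by
    rintro m (x | x) <;> rfl
  let Q := {q : Quotient (stack d e) // ∀ x, Quotient.mk (stack d e) (outer x) ≠ q}
  have : Finite Q := inferInstance
  have : Fintype Q := Fintype.ofFinite _
  let F : {m : Fin n → Bool // stack d e ≤ Setoid.ker (Sum.elim b (Sum.elim m t))} →
      (Q → Bool) :=
    fun m q => Quotient.lift (Sum.elim b (Sum.elim m.1 t)) (fun x y hxy => m.2 hxy) q.1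
  have hF : Function.Bijective F := by
    constructor
    · rintro ⟨m, hm⟩ ⟨m', hm'⟩ hmm
      refine Subtype.ext (funext fun i => ?_)
      by_cases hi : ∃ x, Quotient.mk (stack d e) (outer x) =
          Quotient.mk (stack d e) (Sum.inr (Sum.inl i))
      · obtain ⟨x, hx⟩ := hi
        have hx' := Quotient.exact hx
        have h1 := hm hx'
        have h2 := hm' hx'
        rw [Setoid.ker_def, hout] at h1 h2
        exact h1.symm.trans h2
      · push Not at hi
        exact congrFun hmm ⟨_, hi⟩
    · intro g
      let c : Quotient (stack d e) → Bool := fun q =>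
        if hq : ∃ x, Quotient.mk (stack d e) (outer x) = q then Sum.elim b t hq.choose
        else g ⟨q, fun x hx => hq ⟨x, hx⟩⟩
      have hc : ∀ x, c (Quotient.mk (stack d e) (outer x)) = Sum.elim b t x := by
        intro x
        have hq : ∃ y, Quotient.mk (stack d e) (outer y) =
          Quotient.mk (stack d e) (outer x) := ⟨x, rfl⟩
        have : c (Quotient.mk (stack d e) (outer x)) = Sum.elim b t hq.choose := dif_pos hq
        rw [this]
        have h3 := Quotient.exact (s := stack d e) hq.choose_spec
        exact h (show comp d e _ _ from h3)
      let m : Fin n → Bool := fun i => c (Quotient.mk _ (Sum.inr (Sum.inl i)))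
      have hm : ∀ y, Sum.elim b (Sum.elim m t) y = c (Quotient.mk _ y) := by
        rintro (y | y | y)
        · exact (hc (Sum.inl y)).symm
        · rfl
        · exact (hc (Sum.inr y)).symm
      have hle : stack d e ≤ Setoid.ker (Sum.elim b (Sum.elim m t)) := by
        intro x y hxy
        rw [Setoid.ker_def, hm, hm]
        exact congrArg c (Quotient.sound hxy)
      refine ⟨⟨m, hle⟩, ?_⟩
      funext q
      obtain ⟨q, hq⟩ := q
      induction q using Quotient.inductionOn with
      | h y =>
        change Sum.elim b (Sum.elim m t) y = _
        rw [hm]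
        exact dif_neg (fun ⟨x, hx⟩ => hq x hx)
  rw [Nat.card_congr (Equiv.ofBijective F hF), Nat.card_eq_fintype_card, Fintype.card_fun,
    Fintype.card_bool]
  congr 1
  rw [floating, Nat.card_eq_fintype_card]

theorem toMatrix_mul {n : ℕ} (d e : PartDiag n) :
    toMatrix d * toMatrix e = 2 ^ floating d e • toMatrix (comp d e) := by
  classical
  ext t b
  rw [Matrix.mul_apply, Matrix.smul_apply]
  have h1 : ∀ m : Fin n → Bool, toMatrix d t m * toMatrix e m b =
      if stack d e ≤ Setoid.ker (Sum.elim b (Sum.elim m t)) then 1 else 0 := by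
    intro m
    by_cases hd : d ≤ Setoid.ker (Sum.elim m t)
    · by_cases he : e ≤ Setoid.ker (Sum.elim b m)
      · rw [toMatrix_pos d t m hd, toMatrix_pos e m b he,
          if_pos ((stack_le_ker d e b m t).2 ⟨hd, he⟩)]
      · rw [toMatrix_neg e m b he, if_neg (fun h => he ((stack_le_ker d e b m t).1 h).2), mul_zero]
    · rw [toMatrix_neg d t m hd, if_neg (fun h => hd ((stack_le_ker d e b m t).1 h).1), zero_mul]
  simp_rw [h1]
  rw [Finset.sum_boole]
  by_cases h : comp d e ≤ Setoid.ker (Sum.elim b t)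
  · rw [toMatrix_pos _ t b h, ← card_extensions d e b t h, Nat.card_eq_fintype_card,
      Fintype.card_subtype]
    simp
  · rw [toMatrix_neg _ t b h, Finset.filter_false_of_mem]
    · simp
    · intro m _ hm
      apply h
      intro x y hxy
      have h2 := hm hxy
      rw [Setoid.ker_def] at h2 ⊢
      rcases x with x | x <;> rcases y with y | y <;> exact h2

theorem toMatrix_smul_inj {n : ℕ} {d e : PartDiag n} {p q : ℕ}
    (h : 2 ^ p • toMatrix d = 2 ^ q • toMatrix e) : p = q ∧ d = e := by
  classical
  have hconst : ∀ r : PartDiag n, toMatrix r (fun _ => true) (fun _ => true) = 1 := by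
    intro r
    apply toMatrix_pos
    intro x y _
    rw [Setoid.ker_def]
    rcases x with x | x <;> rcases y with y | y <;> rfl
  have hpq : p = q := by
    have h1 := congrFun (congrFun h (fun _ => true)) (fun _ => true)
    rw [Matrix.smul_apply, Matrix.smul_apply, hconst, hconst] at h1
    simpa using h1
  subst hpq
  refine ⟨rfl, ?_⟩
  have hle : ∀ t b : Fin n → Bool, d ≤ Setoid.ker (Sum.elim b t) ↔ e ≤ Setoid.ker (Sum.elim b t) := by
    intro t b
    have h1 := congrFun (congrFun h t) b
    rw [Matrix.smul_apply, Matrix.smul_apply] at h1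
    have h2 : toMatrix d t b = toMatrix e t b := by simpa using h1
    by_cases hd : d ≤ Setoid.ker (Sum.elim b t) <;> by_cases he : e ≤ Setoid.ker (Sum.elim b t)
    · exact ⟨fun _ => he, fun _ => hd⟩
    · rw [toMatrix_pos d t b hd, toMatrix_neg e t b he] at h2; omega
    · rw [toMatrix_neg d t b hd, toMatrix_pos e t b he] at h2; omega
    · exact ⟨fun h => absurd h hd, fun h => absurd h he⟩
  have sep : ∀ r s : PartDiag n, (∀ t b : Fin n → Bool, r ≤ Setoid.ker (Sum.elim b t) →
      s ≤ Setoid.ker (Sum.elim b t)) → s ≤ r := by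
    intro r s hrs x y hxy
    let c : Fin n ⊕ Fin n → Bool := fun z => decide (r x z)
    have hc : Sum.elim (fun i => c (Sum.inl i)) (fun i => c (Sum.inr i)) = c := by
      ext z; rcases z with z | z <;> rfl
    have h1 := hrs (fun i => c (Sum.inr i)) (fun i => c (Sum.inl i)) (by
      rw [hc]
      intro z w hzw
      rw [Setoid.ker_def]
      have hiff : r x z ↔ r x w :=
        ⟨fun h => r.trans' h hzw, fun h => r.trans' h (r.symm' hzw)⟩
      exact decide_eq_decide.2 hiff)
    rw [hc] at h1
    have h2 := h1 hxy
    rw [Setoid.ker_def] at h2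
    have h3 : c x = true := decide_eq_true (r.refl' x)
    rw [h3] at h2
    exact of_decide_eq_true h2.symm
  exact le_antisymm (sep e d fun t b => (hle t b).2) (sep d e fun t b => (hle t b).1)

theorem toMatrix_one {n : ℕ} : toMatrix (one n) = 1 := by
  classical
  ext t b
  by_cases h : t = b
  · subst h
    rw [Matrix.one_apply_eq]
    apply toMatrix_pos
    intro x y hxy
    have h1 : (Sum.elim id id x : Fin n) = Sum.elim id id y := hxy
    rw [Setoid.ker_def]
    rcases x with x | x <;> rcases y with y | y <;> exact congrArg t h1
  · rw [Matrix.one_apply_ne h]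
    apply toMatrix_neg
    intro hle
    apply h
    funext i
    have h1 : (one n) (Sum.inr i) (Sum.inl i) := (rfl : (i : Fin n) = i)
    exact hle h1

theorem comp_assoc_floating {n : ℕ} (d e f : PartDiag n) :
    floating d e + floating (comp d e) f = floating e f + floating d (comp e f) ∧
      comp (comp d e) f = comp d (comp e f) := by
  apply toMatrix_smul_inj
  have h := mul_assoc (toMatrix d) (toMatrix e) (toMatrix f)
  rw [toMatrix_mul, toMatrix_mul e f, Matrix.smul_mul, Matrix.mul_smul, toMatrix_mul,
    toMatrix_mul, smul_smul, smul_smul, ← pow_add, ← pow_add] at h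
  exact h

theorem one_comp_floating {n : ℕ} (d : PartDiag n) :
    floating (one n) d = 0 ∧ comp (one n) d = d := by
  apply toMatrix_smul_inj
  rw [← toMatrix_mul, toMatrix_one, one_mul, pow_zero, one_smul]

theorem comp_one_floating {n : ℕ} (d : PartDiag n) :
    floating d (one n) = 0 ∧ comp d (one n) = d := by
  apply toMatrix_smul_inj
  rw [← toMatrix_mul, toMatrix_one, mul_one, pow_zero, one_smul]

theorem numBlocks_one (n : ℕ) : numBlocks (one n) = n := by
  have h : Function.Surjective (Sum.elim id id : Fin n ⊕ Fin n → Fin n) :=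
    fun i => ⟨Sum.inl i, rfl⟩
  have := Nat.card_congr (Setoid.quotientKerEquivOfSurjective _ h)
  rw [Nat.card_eq_fintype_card (α := Fin n), Fintype.card_fin] at this
  exact this

theorem handles_add {n : ℕ} (d e : PartDiag n) :
    handles d e + (numBlocks d + numBlocks e) = numBlocks (comp d e) + floating d e + n := by
  have h := numBlocks_add_le d e
  rw [← card_stack]
  unfold handles
  omega

theorem handles_assoc {n : ℕ} (d e f : PartDiag n) :
    handles d e + handles (comp d e) f = handles e f + handles d (comp e f) := by
  have h1 := handles_add d e
  have h2 := handles_add (comp d e) f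
  have h3 := handles_add e f
  have h4 := handles_add d (comp e f)
  obtain ⟨h5, h6⟩ := comp_assoc_floating d e f
  rw [h6] at h2
  omega

/-- The scalar in the product of two diagrams: every floating component of genus `g` is evaluated
to `a₀ * u ^ g`, and every handle on a non-floating component to `u`. -/
noncomputable def coeff {K : Type*} [Field K] (a₀ u : K) {n : ℕ} (d e : PartDiag n) : K :=
  a₀ ^ floating d e * u ^ handles d e

theorem coeff_assoc {K : Type*} [Field K] (a₀ u : K) {n : ℕ} (d e f : PartDiag n) :
    coeff a₀ u d e * coeff a₀ u (comp d e) f = coeff a₀ u e f * coeff a₀ u d (comp e f) := by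
  have h1 := (comp_assoc_floating d e f).1
  have h2 := handles_assoc d e f
  calc _ = a₀ ^ (floating d e + floating (comp d e) f) *
        u ^ (handles d e + handles (comp d e) f) := by unfold coeff; ring
    _ = _ := by rw [h1, h2]; unfold coeff; ring

theorem coeff_one_left {K : Type*} [Field K] (a₀ u : K) {n : ℕ} (d : PartDiag n) :
    coeff a₀ u (one n) d = 1 := by
  have h1 := one_comp_floating d
  have h2 := handles_add (one n) d
  rw [h1.1, h1.2, numBlocks_one] at h2
  have h3 : handles (one n) d = 0 := by omega
  simp [coeff, h1.1, h3]

theorem coeff_one_right {K : Type*} [Field K] (a₀ u : K) {n : ℕ} (d : PartDiag n) :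
    coeff a₀ u d (one n) = 1 := by
  have h1 := comp_one_floating d
  have h2 := handles_add d (one n)
  rw [h1.1, h1.2, numBlocks_one] at h2
  have h3 : handles d (one n) = 0 := by omega
  simp [coeff, h1.1, h3]

end PartDiag

/-- The partition algebra on `n` strands with genus evaluation `a_g = a₀ * u ^ g` and handle
relation `handle = u`: the vector space with basis the partition diagrams; the product is stacking
with the evaluation `PartDiag.coeff`. For `u = 1` this is the classical partition algebra with loop
parameter `a₀`. -/
def PaAlg (K : Type*) [Field K] (_a₀ _u : K) (n : ℕ) : Type _ := PartDiag n →₀ K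

namespace PaAlg

noncomputable instance {K : Type*} [Field K] (a₀ u : K) (n : ℕ) : AddCommGroup (PaAlg K a₀ u n) :=
  inferInstanceAs (AddCommGroup (PartDiag n →₀ K))

noncomputable instance {K : Type*} [Field K] (a₀ u : K) (n : ℕ) : Module K (PaAlg K a₀ u n) :=
  inferInstanceAs (Module K (PartDiag n →₀ K))

/-- The basis vector of a diagram. -/
noncomputable def of {K : Type*} [Field K] (a₀ u : K) {n : ℕ} (d : PartDiag n) : PaAlg K a₀ u n :=
  Finsupp.single d 1

/-- The bilinear product with `d * e = coeff d e • (d stacked on top of e)`. -/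
noncomputable def mulMap {K : Type*} [Field K] (a₀ u : K) (n : ℕ) :
    PaAlg K a₀ u n →ₗ[K] PaAlg K a₀ u n →ₗ[K] PaAlg K a₀ u n :=
  Finsupp.lift (PaAlg K a₀ u n →ₗ[K] PaAlg K a₀ u n) K (PartDiag n) fun d =>
    Finsupp.lift (PaAlg K a₀ u n) K (PartDiag n) fun e =>
      PartDiag.coeff a₀ u d e • of a₀ u (PartDiag.comp d e)

theorem mulMap_of {K : Type*} [Field K] (a₀ u : K) {n : ℕ} (d e : PartDiag n) :
    mulMap a₀ u n (of a₀ u d) (of a₀ u e)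
      = PartDiag.coeff a₀ u d e • of a₀ u (PartDiag.comp d e) := by
  have key : ∀ (N : Type _) [AddCommGroup N] [Module K N] (f : PartDiag n → N) (d : PartDiag n),
      Finsupp.lift N K (PartDiag n) f (Finsupp.single d 1) = f d := by
    intro N _ _ f d
    simp
  have h1 : mulMap a₀ u n (of a₀ u d) = Finsupp.lift (PaAlg K a₀ u n) K (PartDiag n) fun e =>
      PartDiag.coeff a₀ u d e • of a₀ u (PartDiag.comp d e) := key _ _ d
  rw [h1]
  exact key _ _ e

theorem induction {K : Type*} [Field K] {a₀ u : K} {n : ℕ} {p : PaAlg K a₀ u n → Prop}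
    (x : PaAlg K a₀ u n) (h0 : p 0) (hadd : ∀ x y, p x → p y → p (x + y))
    (hof : ∀ (c : K) d, p (c • of a₀ u d)) : p x := by
  refine Finsupp.induction_linear (motive := p) x h0 hadd (fun d c => ?_)
  have h : (c • of a₀ u d : PaAlg K a₀ u n) = Finsupp.single d c := by
    change c • (Finsupp.single d (1 : K)) = Finsupp.single d c
    simp
  rw [← h]
  exact hof c d

theorem mulMap_assoc {K : Type*} [Field K] (a₀ u : K) {n : ℕ} (x y z : PaAlg K a₀ u n) :
    mulMap a₀ u n (mulMap a₀ u n x y) z = mulMap a₀ u n x (mulMap a₀ u n y z) := by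
  induction x using induction with
  | h0 => simp
  | hadd x x' h h' => simp only [map_add, LinearMap.add_apply, h, h']
  | hof c d =>
    induction y using induction with
    | h0 => simp
    | hadd y y' h h' => simp only [map_add, LinearMap.add_apply, h, h']
    | hof c' e =>
      induction z using induction with
      | h0 => simp
      | hadd z z' h h' => simp only [map_add, h, h']
      | hof c'' f =>
        simp only [map_smul, LinearMap.smul_apply, mulMap_of, smul_smul]
        rw [(PartDiag.comp_assoc_floating d e f).2]
        congr 1
        have h := PartDiag.coeff_assoc a₀ u d e f
        linear_combination (c * c' * c'') * h

theorem one_mulMap {K : Type*} [Field K] (a₀ u : K) {n : ℕ} (x : PaAlg K a₀ u n) :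
    mulMap a₀ u n (of a₀ u (PartDiag.one n)) x = x := by
  induction x using induction with
  | h0 => simp
  | hadd x x' h h' => simp only [map_add, h, h']
  | hof c d =>
    rw [map_smul, mulMap_of, PartDiag.coeff_one_left, (PartDiag.one_comp_floating d).2, one_smul]

theorem mulMap_one {K : Type*} [Field K] (a₀ u : K) {n : ℕ} (x : PaAlg K a₀ u n) :
    mulMap a₀ u n x (of a₀ u (PartDiag.one n)) = x := by
  induction x using induction with
  | h0 => simp
  | hadd x x' h h' => simp only [map_add, LinearMap.add_apply, h, h']
  | hof c d =>
    rw [map_smul, LinearMap.smul_apply, mulMap_of, PartDiag.coeff_one_right,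
      (PartDiag.comp_one_floating d).2, one_smul]

noncomputable instance {K : Type*} [Field K] (a₀ u : K) (n : ℕ) : Ring (PaAlg K a₀ u n) :=
  { (inferInstance : AddCommGroup (PaAlg K a₀ u n)) with
    mul := fun x y => mulMap a₀ u n x y
    one := of a₀ u (PartDiag.one n)
    left_distrib := fun x y z => map_add (mulMap a₀ u n x) y z
    right_distrib := fun x y z => LinearMap.map_add₂ (mulMap a₀ u n) x y z
    zero_mul := fun x => LinearMap.map_zero₂ (mulMap a₀ u n) x
    mul_zero := fun x => map_zero (mulMap a₀ u n x)
    mul_assoc := mulMap_assoc a₀ u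
    one_mul := one_mulMap a₀ u
    mul_one := mulMap_one a₀ u }

noncomputable instance {K : Type*} [Field K] (a₀ u : K) (n : ℕ) : Algebra K (PaAlg K a₀ u n) :=
  Algebra.ofModule (fun c x y => LinearMap.map_smul₂ (mulMap a₀ u n) c x y)
    (fun c x y => map_smul (mulMap a₀ u n x) c y)

theorem of_mul_of {K : Type*} [Field K] (a₀ u : K) {n : ℕ} (d e : PartDiag n) :
    of a₀ u d * of a₀ u e = PartDiag.coeff a₀ u d e • of a₀ u (PartDiag.comp d e) :=
  mulMap_of a₀ u d e

end PaAlg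

/-- The diagram algebra of the diagrams that satisfy `F`: the subalgebra of the partition algebra
generated by them. For a class `F` of diagrams that contains the identity and is closed under
stacking, as the four classes `IsPPa`, `IsMo`, `IsTL`, `IsPRo`, it is the linear span of the
diagrams in `F`. -/
noncomputable def DiagAlg (K : Type*) [Field K] (a₀ u : K) {n : ℕ} (F : PartDiag n → Prop) :
    Subalgebra K (PaAlg K a₀ u n) :=
  Algebra.adjoin K {x | ∃ d, F d ∧ x = PaAlg.of a₀ u d}

/-- A diagram in the class `F`, as an element of the diagram algebra. -/
noncomputable def DiagAlg.of {K : Type*} [Field K] (a₀ u : K) {n : ℕ} {F : PartDiag n → Prop}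
    (d : PartDiag n) (hd : F d) : DiagAlg K a₀ u F :=
  ⟨PaAlg.of a₀ u d, Algebra.subset_adjoin ⟨d, hd, rfl⟩⟩

/-- The module `L` over the diagram algebra has apex `k`: the diagrams with fewer than `k` through
strands annihilate it, those with `k` through strands do not all annihilate it. -/
def HasApex {K : Type*} [Field K] (a₀ u : K) {n : ℕ} (F : PartDiag n → Prop) (L : Type*)
    [AddCommGroup L] [Module (DiagAlg K a₀ u F) L] (k : ℕ) : Prop :=
  (∀ (d : PartDiag n) (hd : F d), d.through < k → ∀ v : L, DiagAlg.of a₀ u d hd • v = 0) ∧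
    ∃ (d : PartDiag n) (hd : F d), d.through = k ∧ ∃ v : L, DiagAlg.of a₀ u d hd • v ≠ 0

/-- Whenever the diagram algebra of the class `F`, over any field and for any parameters `a₀`, `u`,
is semisimple, then it has a simple module of apex `k`, and all simple modules of apex `k` have a
dimension satisfying `P`. -/
def SimpleDim {n : ℕ} (F : PartDiag n → Prop) (k : ℕ) (P : ℕ → Prop) : Prop :=
  ∀ (K : Type v) [Field K] (a₀ u : K), IsSemisimpleRing (DiagAlg K a₀ u F) →
    (∃ L : Submodule (DiagAlg K a₀ u F) (DiagAlg K a₀ u F),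
      IsSimpleModule (DiagAlg K a₀ u F) L ∧ HasApex a₀ u F L k) ∧
    ∀ (L : Type w) [AddCommGroup L] [Module K L] [Module (DiagAlg K a₀ u F) L]
      [IsScalarTower K (DiagAlg K a₀ u F) L],
      IsSimpleModule (DiagAlg K a₀ u F) L → HasApex a₀ u F L k → P (Module.finrank K L)

/-! A planar diagram is determined by its two halves, and in each of the four classes any two halves
with equally many through strands fit together. If stacking two diagrams with `k` through strands
loses no strand, the product keeps the outer half of each factor (`half_comp`, `half_flip_comp`),
and its scalar sees the upper factor only through the half that faces the middle (`coeff_congr`).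
So, modulo diagrams with fewer strands, products of diagrams are governed by a pairing of the halves
that meet.

Let `L` be simple of apex `k` and choose `d₀` with `k` through strands and `l` in `L` with `d₀ • l ≠
0`. Let `D t` have the lower half of `d₀` and the upper half `t`. The vectors `D t • l` span a
nonzero submodule, hence all of `L`. If a combination `ξ` of the `D t` kills `l`, then the pairing
of its coefficients with every half vanishes, so the ideal of diagrams with at most `k` strands
multiplies `ξ` into the ideal of those with fewer than `k`. Semisimplicity then puts `ξ` itself into
the smaller ideal (`mem_of_forall_mul_mem`), and all coefficients are zero. Hence `dim L` is the
number of halves with `k` through strands (`finrank_of_apex`). It involves neither `K` nor `a₀` nor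
`u`, which is why the estimates are uniform.

A noncrossing partition is encoded by recording, at each point, whether its block was met before and
whether it will be met again. The number of open blocks is the height of a lattice path, so halves
are paths from height `0` to height `k` that stay nonnegative, with letters depending on the class
(`ncard_halves_eq_count`). By reflection their number is a difference of two numbers of free walks
for TL, Mo and pPa, and a single such number for pRo.

The ballot formula turns the difference into `(k + 1) / (n + 1)` times one number of walks of length
`n + 1`. A local limit theorem with error `O(n ^ (-3/2))` therefore suffices, and no estimate of
differences is needed. It is proved by writing walk numbers as Fourier coefficients of powers of a
cosine and comparing with a Gaussian (`exists_fourier_bound`). The relative error `O(n ^ (-1/2))` of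
the theorem comes from passing from `(n + 1, k + 1)` back to `(n, k)` in `ballot_asymptotics`. -/

namespace PartDiag

/-! ### Reflection, halves and through strands -/

/-- The reflection of a diagram, exchanging bottom and top. -/
def flip {n : ℕ} (d : PartDiag n) : PartDiag n := Setoid.comap Sum.swap d

/-- The lower half of a diagram: the induced partition of the bottom points, together with the set
of bottom points that lie on through strands. -/
def half {n : ℕ} (d : PartDiag n) : Setoid (Fin n) × Set (Fin n) :=
  (Setoid.comap Sum.inl d, {i | ∃ j, d (Sum.inl i) (Sum.inr j)})

theorem flip_apply {n : ℕ} (d : PartDiag n) (x y : Fin n ⊕ Fin n) :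
    flip d x y ↔ d x.swap y.swap := Iff.rfl

theorem flip_flip {n : ℕ} (d : PartDiag n) : flip (flip d) = d := by
  ext x y
  rw [flip_apply, flip_apply, Sum.swap_swap, Sum.swap_swap]

theorem half_fst {n : ℕ} (d : PartDiag n) (i j : Fin n) :
    (half d).1 i j ↔ d (Sum.inl i) (Sum.inl j) := Iff.rfl

theorem mem_half {n : ℕ} (d : PartDiag n) (i : Fin n) :
    i ∈ (half d).2 ↔ ∃ j, d (Sum.inl i) (Sum.inr j) := Iff.rfl

theorem half_eq {n : ℕ} {d e : PartDiag n}
    (h1 : ∀ i j, d (Sum.inl i) (Sum.inl j) ↔ e (Sum.inl i) (Sum.inl j))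
    (h2 : ∀ i, (∃ j, d (Sum.inl i) (Sum.inr j)) ↔ ∃ j, e (Sum.inl i) (Sum.inr j)) :
    half d = half e := by
  refine Prod.ext (Setoid.ext h1) (Set.ext h2)

theorem stack_upper {n : ℕ} {d e : PartDiag n} {x y : Fin n ⊕ Fin n} (h : d x y) :
    stack d e (upper x) (upper y) :=
  (le_sup_left : _ ≤ stack d e) (Relation.EqvGen.rel _ _ ⟨x, y, h, rfl, rfl⟩)

theorem stack_lower {n : ℕ} {d e : PartDiag n} {x y : Fin n ⊕ Fin n} (h : e x y) :
    stack d e (lower x) (lower y) :=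
  (le_sup_right : _ ≤ stack d e) (Relation.EqvGen.rel _ _ ⟨x, y, h, rfl, rfl⟩)

/-- A function on the three layers that is constant on the blocks of both diagrams is constant on
the components of the stacked picture. -/
theorem stack_imp {n : ℕ} {α : Type*} {d e : PartDiag n} (f : Fin n ⊕ (Fin n ⊕ Fin n) → α)
    (hd : ∀ x y, d x y → f (upper x) = f (upper y))
    (he : ∀ x y, e x y → f (lower x) = f (lower y)) {x y : Fin n ⊕ (Fin n ⊕ Fin n)}
    (h : stack d e x y) : f x = f y := by
  have hle : stack d e ≤ Setoid.ker f := by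
    refine sup_le (Setoid.eqvGen_le ?_) (Setoid.eqvGen_le ?_)
    · rintro _ _ ⟨a, b, hab, rfl, rfl⟩
      exact hd a b hab
    · rintro _ _ ⟨a, b, hab, rfl, rfl⟩
      exact he a b hab
  exact hle h

/-- The reversal of the three layers. -/
def rev {n : ℕ} : Fin n ⊕ (Fin n ⊕ Fin n) → Fin n ⊕ (Fin n ⊕ Fin n)
  | Sum.inl i => Sum.inr (Sum.inr i)
  | Sum.inr (Sum.inl i) => Sum.inr (Sum.inl i)
  | Sum.inr (Sum.inr i) => Sum.inl i

theorem stack_flip_imp {n : ℕ} {d e : PartDiag n} {x y : Fin n ⊕ (Fin n ⊕ Fin n)}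
    (h : stack d e x y) : stack (flip e) (flip d) (rev x) (rev y) := by
  refine Quotient.exact (s := stack (flip e) (flip d)) (stack_imp (d := d) (e := e)
    (fun z => Quotient.mk (stack (flip e) (flip d)) (rev z)) ?_ ?_ h)
  · intro a b hab
    have h1 : flip d a.swap b.swap := by simpa [flip_apply] using hab
    have h2 := Quotient.sound (s := stack (flip e) (flip d)) (stack_lower (d := flip e) h1)
    rcases a with a | a <;> rcases b with b | b <;> exact h2
  · intro a b hab
    have h1 : flip e a.swap b.swap := by simpa [flip_apply] using hab
    have h2 := Quotient.sound (s := stack (flip e) (flip d)) (stack_upper (e := flip d) h1)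
    rcases a with a | a <;> rcases b with b | b <;> exact h2

theorem flip_comp {n : ℕ} (d e : PartDiag n) : flip (comp d e) = comp (flip e) (flip d) := by
  ext x y
  have h4 : ∀ z : Fin n ⊕ Fin n, rev (outer z) = outer z.swap := by rintro (z | z) <;> rfl
  constructor
  · intro h
    have h1 : stack d e (outer x.swap) (outer y.swap) := h
    have h2 := stack_flip_imp h1
    rw [h4, h4, Sum.swap_swap, Sum.swap_swap] at h2
    exact h2
  · intro h
    have h1 : stack (flip e) (flip d) (outer x) (outer y) := h
    have h2 := stack_flip_imp h1
    rw [h4, h4, flip_flip, flip_flip] at h2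
    exact h2

theorem through_flip {n : ℕ} (d : PartDiag n) : through (flip d) = through d := by
  have key : ∀ e : PartDiag n, through (flip e) ≤ through e := by
    intro e
    let φ : {q : Quotient (flip e) // (∃ i, Quotient.mk (flip e) (Sum.inl i) = q) ∧
        ∃ i, Quotient.mk (flip e) (Sum.inr i) = q} → {q : Quotient e //
        (∃ i, Quotient.mk e (Sum.inl i) = q) ∧ ∃ i, Quotient.mk e (Sum.inr i) = q} := fun q =>
      ⟨Quotient.lift (fun x => Quotient.mk e x.swap) (fun x y h => Quotient.sound h) q.1, by
        obtain ⟨q, ⟨i, rfl⟩, ⟨j, hj⟩⟩ := q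
        refine ⟨⟨j, ?_⟩, ⟨i, rfl⟩⟩
        exact Quotient.sound (s := e) (Quotient.exact (s := flip e) hj)⟩
    refine Nat.card_le_card_of_injective φ ?_
    rintro ⟨p, hp⟩ ⟨q, hq⟩ h
    have h' := congrArg Subtype.val h
    induction p using Quotient.inductionOn
    induction q using Quotient.inductionOn
    exact Subtype.ext (Quotient.sound (s := flip e) (Quotient.exact (s := e) h'))
  refine le_antisymm (key d) ?_
  conv_lhs => rw [← flip_flip d]
  exact key (flip d)

/-- The number of through strands, read off from the lower half. -/
theorem through_eq {n : ℕ} (d : PartDiag n) :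
    through d = Nat.card {q : Quotient (half d).1 //
      ∃ i ∈ (half d).2, Quotient.mk (half d).1 i = q} := by
  symm
  let φ : {q : Quotient (half d).1 // ∃ i ∈ (half d).2, Quotient.mk (half d).1 i = q} →
      {q : Quotient d // (∃ i, Quotient.mk d (Sum.inl i) = q) ∧
        ∃ i, Quotient.mk d (Sum.inr i) = q} := fun q =>
    ⟨Quotient.lift (fun i => Quotient.mk d (Sum.inl i)) (fun x y h => Quotient.sound h) q.1, by
      obtain ⟨q, i, ⟨j, hj⟩, rfl⟩ := q
      exact ⟨⟨i, rfl⟩, ⟨j, (Quotient.sound hj).symm⟩⟩⟩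
  refine Nat.card_congr (Equiv.ofBijective φ ⟨?_, ?_⟩)
  · rintro ⟨p, hp⟩ ⟨q, hq⟩ h
    have h' := congrArg Subtype.val h
    induction p using Quotient.inductionOn
    induction q using Quotient.inductionOn
    exact Subtype.ext (Quotient.sound (s := (half d).1) (Quotient.exact (s := d) h'))
  · rintro ⟨q, ⟨i, hi⟩, ⟨j, hj⟩⟩
    refine ⟨⟨Quotient.mk _ i, i, ⟨j, ?_⟩, rfl⟩, Subtype.ext hi⟩
    exact Quotient.exact (hi.trans hj.symm)

theorem through_eq_of_half_eq {n : ℕ} {d e : PartDiag n} (h : half d = half e) :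
    through d = through e := by rw [through_eq, through_eq, h]

/-- Inclusion and exclusion: every block meets the bottom or the top, and the blocks meeting both
are the through strands. This splits the Euler characteristic in `handles_add` into contributions of
the halves. -/
theorem numBlocks_eq {n : ℕ} (d : PartDiag n) :
    numBlocks d + through d = Nat.card (Quotient (half d).1) +
      Nat.card (Quotient (half (flip d)).1) := by
  classical
  have h := Set.ncard_union_add_ncard_inter (Set.range fun i => Quotient.mk d (Sum.inl i))
    (Set.range fun i => Quotient.mk d (Sum.inr i)) (Set.toFinite _) (Set.toFinite _)
  have hu : (Set.range fun i => Quotient.mk d (Sum.inl i)) ∪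
      (Set.range fun i => Quotient.mk d (Sum.inr i)) = Set.univ := by
    refine Set.eq_univ_of_forall fun q => ?_
    induction q using Quotient.inductionOn with
    | h x => rcases x with x | x
             · exact Or.inl ⟨x, rfl⟩
             · exact Or.inr ⟨x, rfl⟩
  rw [hu, Set.ncard_univ] at h
  have hl : (Set.range fun i => Quotient.mk d (Sum.inl i)).ncard
      = Nat.card (Quotient (half d).1) :=
    (Nat.card_congr (Setoid.comapQuotientEquiv Sum.inl d)).symm
  have hr : (Set.range fun i => Quotient.mk d (Sum.inr i)).ncard
      = Nat.card (Quotient (half (flip d)).1) :=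
    (Nat.card_congr (Setoid.comapQuotientEquiv Sum.inr d)).symm
  rw [hl, hr] at h
  exact h

/-! ### Lower halves under stacking -/

theorem comp_inl {n : ℕ} (y d : PartDiag n) (i j : Fin n) :
    comp y d (Sum.inl i) (Sum.inl j) ↔ stack y d (lower (Sum.inl i)) (lower (Sum.inl j)) := Iff.rfl

/-- A block of `d` that misses the middle layer is already a full component of the stacked picture:
its indicator function, extended by `False` to the other two layers, is constant on the blocks of
both diagrams. -/
theorem half_comp_mem {n : ℕ} {y d : PartDiag n} {i : Fin n} (h : i ∈ (half (comp y d)).2) :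
    i ∈ (half d).2 := by
  obtain ⟨j, hj⟩ := h
  by_contra hi
  have h1 := stack_imp (d := y) (e := d)
    (Sum.elim (fun l => d (Sum.inl i) (Sum.inl l)) (fun _ => False)) (x := outer (Sum.inl i))
    (y := outer (Sum.inr j)) (fun a b _ => rfl) ?_ hj
  · have : d (Sum.inl i) (Sum.inl i) = False := h1
    exact this.mp (d.refl' _)
  · have hm : ∀ l, ¬ d (Sum.inl i) (Sum.inr l) := fun l hl => hi ⟨l, hl⟩
    rintro (a | a) (b | b) hab
    · exact propext ⟨fun h => d.trans' h hab, fun h => d.trans' h (d.symm' hab)⟩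
    · exact propext ⟨fun h => hm b (d.trans' h hab), fun h => h.elim⟩
    · exact propext ⟨fun h => h.elim, fun h => hm a (d.trans' h (d.symm' hab))⟩
    · rfl

theorem half_comp_of_notMem {n : ℕ} {y d : PartDiag n} {i j : Fin n} (hi : i ∉ (half d).2)
    (h : comp y d (Sum.inl i) (Sum.inl j)) : d (Sum.inl i) (Sum.inl j) := by
  have h1 := stack_imp (d := y) (e := d)
    (Sum.elim (fun l => d (Sum.inl i) (Sum.inl l)) (fun _ => False)) (x := outer (Sum.inl i))
    (y := outer (Sum.inl j)) (fun a b _ => rfl) ?_ h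
  · have : d (Sum.inl i) (Sum.inl i) = d (Sum.inl i) (Sum.inl j) := h1
    exact this.mp (d.refl' _)
  · have hm : ∀ l, ¬ d (Sum.inl i) (Sum.inr l) := fun l hl => hi ⟨l, hl⟩
    rintro (a | a) (b | b) hab
    · exact propext ⟨fun h => d.trans' h hab, fun h => d.trans' h (d.symm' hab)⟩
    · exact propext ⟨fun h => hm b (d.trans' h hab), fun h => h.elim⟩
    · exact propext ⟨fun h => h.elim, fun h => hm a (d.trans' h (d.symm' hab))⟩
    · rfl

theorem half_comp_of_rel {n : ℕ} {y d : PartDiag n} {i j : Fin n}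
    (h : d (Sum.inl i) (Sum.inl j)) : comp y d (Sum.inl i) (Sum.inl j) :=
  stack_lower (d := y) h

/-- The map on lower halves induced by stacking. -/
def halfMap {n : ℕ} (y d : PartDiag n) (q : {q : Quotient (half d).1 //
      ∃ i ∈ (half d).2, Quotient.mk (half d).1 i = q}) : Quotient (half (comp y d)).1 :=
  Quotient.lift (fun i => Quotient.mk (half (comp y d)).1 i)
    (fun _ _ h => Quotient.sound (s := (half (comp y d)).1) (half_comp_of_rel h)) q.1

theorem subset_range_halfMap {n : ℕ} (y d : PartDiag n) :
    {q : Quotient (half (comp y d)).1 | ∃ i ∈ (half (comp y d)).2,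
      Quotient.mk (half (comp y d)).1 i = q} ⊆ Set.range (halfMap y d) := by
  rintro q ⟨i, hi, rfl⟩
  exact ⟨⟨Quotient.mk _ i, i, half_comp_mem hi, rfl⟩, rfl⟩

theorem through_comp_le_right {n : ℕ} (y d : PartDiag n) : through (comp y d) ≤ through d := by
  rw [through_eq, through_eq]
  refine (Set.ncard_le_ncard (subset_range_halfMap y d) (Set.toFinite _)).trans ?_
  rw [← Set.image_univ]
  refine (Set.ncard_image_le (Set.toFinite _)).trans ?_
  rw [Set.ncard_univ]

theorem through_comp_le_left {n : ℕ} (y d : PartDiag n) : through (comp y d) ≤ through y := by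
  rw [← through_flip, flip_comp, ← through_flip y]
  exact through_comp_le_right _ _

/-- The through strands of the composite are among the images of those of `d` under `halfMap`. If
the numbers agree, `halfMap` is a bijection between the two sets, so no through strand of `d` is cut
and no two are merged. Blocks of `d` that miss the middle are unchanged anyway. -/
theorem half_comp {n : ℕ} {y d : PartDiag n} (h : through (comp y d) = through d) :
    half (comp y d) = half d := by
  have hsub := subset_range_halfMap y d
  have h1 : (Set.range (halfMap y d)).ncard ≤ through d := by
    rw [← Set.image_univ, through_eq]
    refine (Set.ncard_image_le (Set.toFinite _)).trans ?_
    rw [Set.ncard_univ]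
  have h2 : {q : Quotient (half (comp y d)).1 | ∃ i ∈ (half (comp y d)).2,
      Quotient.mk (half (comp y d)).1 i = q}.ncard = through d := by
    rw [← h, through_eq]; rfl
  have h3 := Set.eq_of_subset_of_ncard_le hsub (h1.trans h2.ge) (Set.toFinite _)
  have hinj : Function.Injective (halfMap y d) := by
    rw [← Set.injOn_univ]
    refine Set.injOn_of_ncard_image_eq ?_ (Set.toFinite _)
    rw [Set.image_univ, ← h3, h2, through_eq, Set.ncard_univ]
  have hmem : ∀ i ∈ (half d).2, i ∈ (half (comp y d)).2 := by
    intro i hi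
    have h4 : Quotient.mk (half (comp y d)).1 i ∈ Set.range (halfMap y d) :=
      ⟨⟨Quotient.mk _ i, i, hi, rfl⟩, rfl⟩
    rw [← h3] at h4
    obtain ⟨j, ⟨l, hl⟩, hji⟩ := h4
    have h5 : comp y d (Sum.inl j) (Sum.inl i) := Quotient.exact (s := (half (comp y d)).1) hji
    exact ⟨l, (comp y d).trans' ((comp y d).symm' h5) hl⟩
  refine Prod.ext (Setoid.ext fun i j => ⟨fun hij => ?_, half_comp_of_rel⟩)
    (Set.ext fun i => ⟨half_comp_mem, hmem i⟩)
  by_cases hi : i ∈ (half d).2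
  · by_cases hj : j ∈ (half d).2
    · have h6 : (⟨Quotient.mk _ i, i, hi, rfl⟩ : {q : Quotient (half d).1 //
          ∃ i ∈ (half d).2, Quotient.mk (half d).1 i = q}) = ⟨Quotient.mk _ j, j, hj, rfl⟩ :=
        hinj (Quotient.sound (s := (half (comp y d)).1) hij)
      exact Quotient.exact (congrArg Subtype.val h6)
    · exact d.symm' (half_comp_of_notMem hj ((comp y d).symm' hij))
  · exact half_comp_of_notMem hi hij

theorem half_flip_comp {n : ℕ} {y d : PartDiag n} (h : through (comp y d) = through y) :
    half (flip (comp y d)) = half (flip y) := by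
  rw [flip_comp]
  refine half_comp ?_
  rw [← flip_comp, through_flip, through_flip, h]

/-! ### Dependence of the product on the half facing the middle -/

/-- The components of the two lower layers when a diagram with lower half `r` is put on `d`. -/
def attach {n : ℕ} (r : Setoid (Fin n)) (d : PartDiag n) : PartDiag n :=
  d ⊔ Setoid.map r Sum.inr

theorem attach_of_rel {n : ℕ} {r : Setoid (Fin n)} {d : PartDiag n} {x y : Fin n ⊕ Fin n}
    (h : d x y) : attach r d x y := (le_sup_left : d ≤ attach r d) h

theorem attach_of_half {n : ℕ} {r : Setoid (Fin n)} {d : PartDiag n} {i j : Fin n}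
    (h : r i j) : attach r d (Sum.inr i) (Sum.inr j) :=
  (le_sup_right : _ ≤ attach r d) (Relation.EqvGen.rel _ _ ⟨i, j, h, rfl, rfl⟩)

open Classical in
/-- The component of a point of the three layers, as a component of the two lower layers or as a
block of the upper diagram that does not meet the middle layer. -/
noncomputable def component {n : ℕ} (y d : PartDiag n) :
    Fin n ⊕ (Fin n ⊕ Fin n) → Quotient (attach (half y).1 d) ⊕ Quotient y
  | Sum.inl i => Sum.inl (Quotient.mk _ (Sum.inl i))
  | Sum.inr (Sum.inl i) => Sum.inl (Quotient.mk _ (Sum.inr i))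
  | Sum.inr (Sum.inr i) =>
    if h : ∃ j, y (Sum.inl j) (Sum.inr i) then Sum.inl (Quotient.mk _ (Sum.inr h.choose))
    else Sum.inr (Quotient.mk y (Sum.inr i))

theorem component_top {n : ℕ} {y d : PartDiag n} {i j : Fin n} (h : y (Sum.inl j) (Sum.inr i)) :
    component y d (Sum.inr (Sum.inr i)) = component y d (Sum.inr (Sum.inl j)) := by
  have h1 : ∃ j, y (Sum.inl j) (Sum.inr i) := ⟨j, h⟩
  have h2 : component y d (Sum.inr (Sum.inr i)) = Sum.inl (Quotient.mk _ (Sum.inr h1.choose)) :=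
    dif_pos h1
  rw [h2]
  refine congrArg Sum.inl (Quotient.sound (s := attach (half y).1 d) (attach_of_half ?_))
  exact y.trans' h1.choose_spec (y.symm' h)

theorem component_eq {n : ℕ} {y d : PartDiag n} {a b : Fin n ⊕ (Fin n ⊕ Fin n)}
    (h : stack y d a b) : component y d a = component y d b := by
  refine stack_imp (component y d) ?_ ?_ h
  · rintro (a | a) (b | b) hab
    · exact congrArg Sum.inl (Quotient.sound (s := attach (half y).1 d) (attach_of_half hab))
    · exact (component_top hab).symm
    · exact component_top (y.symm' hab)
    · by_cases ha : ∃ j, y (Sum.inl j) (Sum.inr a)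
      · obtain ⟨j, hj⟩ := ha
        exact (component_top hj).trans (component_top (y.trans' hj hab)).symm
      · have hb : ¬ ∃ j, y (Sum.inl j) (Sum.inr b) := fun ⟨j, hj⟩ =>
          ha ⟨j, y.trans' hj (y.symm' hab)⟩
        have h1 : component y d (upper (Sum.inr a)) = Sum.inr (Quotient.mk y (Sum.inr a)) :=
          dif_neg ha
        have h2 : component y d (upper (Sum.inr b)) = Sum.inr (Quotient.mk y (Sum.inr b)) :=
          dif_neg hb
        rw [h1, h2]
        exact congrArg Sum.inr (Quotient.sound hab)
  · rintro (a | a) (b | b) hab <;>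
      exact congrArg Sum.inl (Quotient.sound (s := attach (half y).1 d) (attach_of_rel hab))

theorem stack_of_attach {n : ℕ} {y d : PartDiag n} {a b : Fin n ⊕ Fin n}
    (h : attach (half y).1 d a b) : stack y d (lower a) (lower b) := by
  have hle : attach (half y).1 d ≤ Setoid.comap lower (stack y d) := by
    refine sup_le (fun a b hab => stack_lower hab) (Setoid.eqvGen_le ?_)
    rintro _ _ ⟨i, j, hij, rfl, rfl⟩
    exact stack_upper (x := Sum.inl i) (y := Sum.inl j) hij
  exact hle h

/-- A connection that passes through the top layer could be replaced by one inside the half of `y`.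
Formally, `component` is an invariant of the stacked components, and on the two lower layers it
returns the class under `attach`. -/
theorem stack_lower_iff {n : ℕ} {y d : PartDiag n} {a b : Fin n ⊕ Fin n} :
    stack y d (lower a) (lower b) ↔ attach (half y).1 d a b := by
  refine ⟨fun h => ?_, stack_of_attach⟩
  have h1 := component_eq h
  have h2 : ∀ a : Fin n ⊕ Fin n, component y d (lower a) = Sum.inl (Quotient.mk _ a) := by
    rintro (a | a) <;> rfl
  rw [h2, h2] at h1
  exact Quotient.exact (Sum.inl_injective h1)

theorem stack_top_iff {n : ℕ} {y d : PartDiag n} {a : Fin n ⊕ Fin n} :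
    (∃ j, stack y d (lower a) (Sum.inr (Sum.inr j))) ↔
      ∃ m ∈ (half y).2, attach (half y).1 d a (Sum.inr m) := by
  constructor
  · rintro ⟨j, hj⟩
    by_cases h : ∃ m, y (Sum.inl m) (Sum.inr j)
    · obtain ⟨m, hm⟩ := h
      refine ⟨m, ⟨j, hm⟩, stack_lower_iff.1 ?_⟩
      exact (stack y d).trans' hj ((stack y d).symm' (stack_upper hm))
    · have h1 := component_eq hj
      have h2 : component y d (Sum.inr (Sum.inr j)) = Sum.inr (Quotient.mk y (Sum.inr j)) :=
        dif_neg h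
      rw [h2] at h1
      rcases a with a | a <;> cases h1
  · rintro ⟨m, ⟨j, hj⟩, hm⟩
    exact ⟨j, (stack y d).trans' (stack_of_attach hm) (stack_upper hj)⟩

/-- The lower half of a composition depends on the upper diagram only through its lower half. -/
theorem half_comp_congr {n : ℕ} {y y' d : PartDiag n} (h : half y = half y') :
    half (comp y d) = half (comp y' d) := by
  refine half_eq (fun i j => ?_) (fun i => ?_)
  · rw [comp_inl, comp_inl, stack_lower_iff, stack_lower_iff, h]
  · have h1 := stack_top_iff (y := y) (d := d) (a := Sum.inl i)
    have h2 := stack_top_iff (y := y') (d := d) (a := Sum.inl i)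
    rw [h] at h1
    exact h1.trans h2.symm

/-- Every floating component has a middle point, so it is visible in the two lower layers. The point
of this form is that `y` enters only through `half y`. -/
theorem floating_eq {n : ℕ} (y d : PartDiag n) :
    floating y d = Nat.card {q : Quotient (attach (half y).1 d) //
      (∀ i, Quotient.mk _ (Sum.inl i) ≠ q) ∧ ∀ i ∈ (half y).2, Quotient.mk _ (Sum.inr i) ≠ q} := by
  symm
  let φ : {q : Quotient (attach (half y).1 d) //
      (∀ i, Quotient.mk _ (Sum.inl i) ≠ q) ∧ ∀ i ∈ (half y).2, Quotient.mk _ (Sum.inr i) ≠ q} →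
      {q : Quotient (stack y d) // ∀ x, Quotient.mk (stack y d) (outer x) ≠ q} := fun q =>
    ⟨Quotient.lift (fun a => Quotient.mk (stack y d) (lower a))
      (fun a b h => Quotient.sound (stack_of_attach h)) q.1, by
      obtain ⟨q, hq1, hq2⟩ := q
      induction q using Quotient.inductionOn with
      | h a =>
        rintro (x | x) hx
        · have h1 : stack y d (lower (Sum.inl x)) (lower a) := Quotient.exact hx
          exact hq1 x (Quotient.sound (stack_lower_iff.1 h1))
        · have h1 : stack y d (Sum.inr (Sum.inr x)) (lower a) := Quotient.exact hx
          obtain ⟨m, hm, hma⟩ := stack_top_iff.1 ⟨x, (stack y d).symm' h1⟩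
          exact hq2 m hm (Quotient.sound ((attach _ _).symm' hma))⟩
  refine Nat.card_congr (Equiv.ofBijective φ ⟨?_, ?_⟩)
  · rintro ⟨p, hp⟩ ⟨q, hq⟩ h
    have h' := congrArg Subtype.val h
    induction p using Quotient.inductionOn
    induction q using Quotient.inductionOn
    exact Subtype.ext (Quotient.sound (stack_lower_iff.1 (Quotient.exact (s := stack y d) h')))
  · rintro ⟨q, hq⟩
    induction q using Quotient.inductionOn with
    | h x =>
      rcases x with x | x | x
      · exact (hq (Sum.inl x) rfl).elim
      · refine ⟨⟨Quotient.mk _ (Sum.inr x), fun i hi => ?_, fun i hi hix => ?_⟩, rfl⟩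
        · exact hq (Sum.inl i) (Quotient.sound (stack_of_attach (Quotient.exact hi)))
        · obtain ⟨j, hj⟩ := stack_top_iff.2 ⟨i, hi, (attach _ _).symm' (Quotient.exact hix)⟩
          exact hq (Sum.inr j) (Quotient.sound ((stack y d).symm' hj))
      · exact (hq (Sum.inr x) rfl).elim

theorem floating_congr {n : ℕ} {y y' d : PartDiag n} (h : half y = half y') :
    floating y d = floating y' d := by rw [floating_eq, floating_eq, h]

/-- By `handles_add` the handles are counted by numbers of blocks and floating components. Since no
strand of `y` is lost, `comp y d` and `y` have the same upper half, whose contribution cancels by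
`numBlocks_eq`; what remains depends on `half y` and `d`. -/
theorem handles_congr {n : ℕ} {y y' d : PartDiag n} (h : half y = half y')
    (hy : through (comp y d) = through y) : handles y d = handles y' d := by
  have hc := half_comp_congr (d := d) h
  have ht := through_eq_of_half_eq h
  have htc := through_eq_of_half_eq hc
  have hy' : through (comp y' d) = through y' := by omega
  have h1 := handles_add y d
  have h2 := handles_add y' d
  have h3 := numBlocks_eq y
  have h4 := numBlocks_eq y'
  have h5 := numBlocks_eq (comp y d)
  have h6 := numBlocks_eq (comp y' d)
  rw [half_flip_comp hy, hc] at h5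
  rw [half_flip_comp hy'] at h6
  rw [h] at h3
  rw [floating_congr h] at h1
  omega

/-- This is the cellular property: in products that lose no strand of `y`, the upper half of `y`
does not influence the scalar, so it can be exchanged freely. -/
theorem coeff_congr {K : Type*} [Field K] (a₀ u : K) {n : ℕ} {y y' d : PartDiag n}
    (h : half y = half y') (hy : through (comp y d) = through y) :
    coeff a₀ u y d = coeff a₀ u y' d := by
  rw [coeff, coeff, floating_congr h, handles_congr h hy]

end PartDiag

/-! ### Closure of the four classes under stacking, by gluing one pair of middle points at a time -/

namespace PartDiag

section Glue

variable {α : Type*}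

/-- The setoid obtained by merging the blocks of two points. -/
def glue (S : Setoid α) (x y : α) : Setoid α where
  r a b := S a b ∨ (S a x ∧ S y b) ∨ (S a y ∧ S x b)
  iseqv :=
    { refl := fun a => Or.inl (S.refl' a)
      symm := by
        have := @S.symm'
        grind
      trans := by
        have h1 := @S.symm'
        have h2 := @S.trans'
        intro a b c hab hbc
        rcases hab with h | ⟨h, h'⟩ | ⟨h, h'⟩ <;> rcases hbc with k | ⟨k, k'⟩ | ⟨k, k'⟩
        · exact Or.inl (h2 h k)
        · exact Or.inr (Or.inl ⟨h2 h k, k'⟩)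
        · exact Or.inr (Or.inr ⟨h2 h k, k'⟩)
        · exact Or.inr (Or.inl ⟨h, h2 h' k⟩)
        · exact Or.inr (Or.inl ⟨h, k'⟩)
        · exact Or.inl (h2 h k')
        · exact Or.inr (Or.inr ⟨h, h2 h' k⟩)
        · exact Or.inl (h2 h k')
        · exact Or.inr (Or.inr ⟨h, k'⟩) }

theorem glue_iff {S : Setoid α} {x y a b : α} :
    glue S x y a b ↔ S a b ∨ (S a x ∧ S y b) ∨ (S a y ∧ S x b) := Iff.rfl

/-- No two blocks cross on the set `A` of points, in the order given by `f`. -/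
def NoncrossingOn (f : α → ℤ) (S : Setoid α) (A : Set α) : Prop :=
  ∀ a ∈ A, ∀ b ∈ A, ∀ c ∈ A, ∀ e ∈ A, f a < f b → f b < f c → f c < f e → S a c → S b e → S a b

/-- No block contains three points of `A`. -/
def SmallOn (S : Setoid α) (A : Set α) : Prop :=
  ∀ a ∈ A, ∀ b ∈ A, ∀ c ∈ A, a ≠ b → a ≠ c → b ≠ c → S a b → S a c → False

/-- Every block that meets `A` contains at least two points of `A`. -/
def PairedOn (S : Setoid α) (A : Set α) : Prop := ∀ a ∈ A, ∃ b ∈ A, b ≠ a ∧ S a b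

/-- No block contains two points of `A` of the same colour. -/
def RainbowOn (f : α → Bool) (S : Setoid α) (A : Set α) : Prop :=
  ∀ a ∈ A, ∀ b ∈ A, f a = f b → S a b → a = b

/-- By `hxy` no other point of `A` lies between `x` and `y`. A crossing that uses the new connection
through `x` and `y` therefore gives a crossing of the old partition with `x` or `y` as one of its
four points. -/
theorem NoncrossingOn.glue {f : α → ℤ} {S : Setoid α} {A : Set α} {x y : α}
    (h : NoncrossingOn f S A) (hx : x ∈ A) (hy : y ∈ A)
    (hxy : ∀ z ∈ A, z ≠ x → z ≠ y → (f z < f x ∧ f z < f y) ∨ (f x < f z ∧ f y < f z)) :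
    NoncrossingOn f (glue S x y) (A \ {x, y}) := by
  have h1 := @S.symm'
  have h2 := @S.trans'
  -- In `key` the inner pair `b`, `e` is joined through the bridge from `x` to `y`; in `key'` it is
  -- the outer pair `a`, `c`. The cases depend on where the bridge lies relative to the four points.
  have key : ∀ x ∈ A, ∀ y ∈ A, (∀ z ∈ A, z ≠ x → z ≠ y →
      (f z < f x ∧ f z < f y) ∨ (f x < f z ∧ f y < f z)) → ∀ a ∈ A, ∀ b ∈ A, ∀ c ∈ A, ∀ e ∈ A,
      a ≠ x → a ≠ y → b ≠ x → b ≠ y → c ≠ x → c ≠ y → e ≠ x → e ≠ y →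
      f a < f b → f b < f c → f c < f e → S a c → S b x → S y e →
      S a b ∨ (S a x ∧ S y b) ∨ (S a y ∧ S x b) := by
    intro x hx y hy hxy a ha b hb c hc e he hax hay hbx hby hcx hcy hex hey hab hbc hce hac hbx' hye
    rcases hxy a ha hax hay with g1 | g1
    · rcases hxy c hc hcx hcy with g2 | g2
      · exact Or.inl (h a ha b hb c hc x hx hab hbc g2.1 hac hbx')
      · exact Or.inr (Or.inr ⟨h a ha y hy c hc e he g1.2 g2.2 hce hac hye, h1 hbx'⟩)
    · have h3 := h x hx a ha b hb c hc g1.1 hab hbc (h1 hbx') hac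
      exact Or.inl (h2 (h1 h3) (h1 hbx'))
  have key' : ∀ x ∈ A, ∀ y ∈ A, (∀ z ∈ A, z ≠ x → z ≠ y →
      (f z < f x ∧ f z < f y) ∨ (f x < f z ∧ f y < f z)) → ∀ a ∈ A, ∀ b ∈ A, ∀ c ∈ A, ∀ e ∈ A,
      a ≠ x → a ≠ y → b ≠ x → b ≠ y → c ≠ x → c ≠ y → e ≠ x → e ≠ y →
      f a < f b → f b < f c → f c < f e → S a x → S y c → S b e →
      S a b ∨ (S a x ∧ S y b) ∨ (S a y ∧ S x b) := by
    intro x hx y hy hxy a ha b hb c hc e he hax hay hbx hby hcx hcy hex hey hab hbc hce hax' hyc hbe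
    rcases hxy b hb hbx hby with g1 | g1
    · rcases hxy e he hex hey with g2 | g2
      · have h3 := h b hb c hc e he y hy hbc hce g2.2 hbe (h1 hyc)
        exact Or.inr (Or.inl ⟨hax', h2 hyc (h1 h3)⟩)
      · exact Or.inl (h a ha b hb x hx e he hab g1.1 g2.1 hax' hbe)
    · have h3 := h y hy b hb c hc e he g1.2 hbc hce hyc hbe
      exact Or.inr (Or.inl ⟨hax', h3⟩)
  have hyx : ∀ z ∈ A, z ≠ y → z ≠ x → (f z < f y ∧ f z < f x) ∨ (f y < f z ∧ f x < f z) :=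
    fun z hz g1 g2 => (hxy z hz g2 g1).imp And.symm And.symm
  rintro a ⟨ha, ha'⟩ b ⟨hb, hb'⟩ c ⟨hc, hc'⟩ e ⟨he, he'⟩ hab hbc hce hac hbe
  simp only [Set.mem_insert_iff, Set.mem_singleton_iff, not_or] at ha' hb' hc' he'
  rw [glue_iff] at hac hbe ⊢
  rcases hac with hac | ⟨k, k'⟩ | ⟨k, k'⟩ <;> rcases hbe with hbe | ⟨l, l'⟩ | ⟨l, l'⟩
  · exact Or.inl (h a ha b hb c hc e he hab hbc hce hac hbe)
  · exact key x hx y hy hxy a ha b hb c hc e he ha'.1 ha'.2 hb'.1 hb'.2 hc'.1 hc'.2 he'.1 he'.2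
      hab hbc hce hac l l'
  · exact (key y hy x hx hyx a ha b hb c hc e he ha'.2 ha'.1 hb'.2 hb'.1 hc'.2 hc'.1 he'.2 he'.1
      hab hbc hce hac l l').imp_right Or.symm
  · exact key' x hx y hy hxy a ha b hb c hc e he ha'.1 ha'.2 hb'.1 hb'.2 hc'.1 hc'.2 he'.1 he'.2
      hab hbc hce k k' hbe
  · exact Or.inl (h2 k (h1 l))
  · exact Or.inr (Or.inl ⟨k, h1 l⟩)
  · exact (key' y hy x hx hyx a ha b hb c hc e he ha'.2 ha'.1 hb'.2 hb'.1 hc'.2 hc'.1 he'.2 he'.1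
      hab hbc hce k k' hbe).imp_right Or.symm
  · exact Or.inr (Or.inr ⟨k, h1 l⟩)
  · exact Or.inl (h2 k (h1 l))

theorem SmallOn.glue {S : Setoid α} {A : Set α} {x y : α} (h : SmallOn S A) (hx : x ∈ A)
    (hy : y ∈ A) : SmallOn (glue S x y) (A \ {x, y}) := by
  have h1 := @S.symm'
  have h2 := @S.trans'
  rintro a ⟨ha, ha'⟩ b ⟨hb, hb'⟩ c ⟨hc, hc'⟩ hab hac hbc kb kc
  simp only [Set.mem_insert_iff, Set.mem_singleton_iff, not_or] at ha' hb' hc'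
  rw [glue_iff] at kb kc
  rcases kb with kb | ⟨k, k'⟩ | ⟨k, k'⟩ <;> rcases kc with kc | ⟨l, l'⟩ | ⟨l, l'⟩
  · exact h a ha b hb c hc hab hac hbc kb kc
  · exact h a ha b hb x hx hab ha'.1 hb'.1 kb l
  · exact h a ha b hb y hy hab ha'.2 hb'.2 kb l
  · exact h a ha c hc x hx hac ha'.1 hc'.1 kc k
  · exact h y hy b hb c hc (Ne.symm hb'.2) (Ne.symm hc'.2) hbc k' l'
  · exact h a ha b hb c hc hab hac hbc (h2 l k') (h2 k l')
  · exact h a ha c hc y hy hac ha'.2 hc'.2 kc k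
  · exact h a ha b hb c hc hab hac hbc (h2 l k') (h2 k l')
  · exact h x hx b hb c hc (Ne.symm hb'.1) (Ne.symm hc'.1) hbc k' l'

/-- If the partner of `a` was `x`, the partner of `y` takes its place. By smallness this partner is
neither `x` nor `a`, since otherwise `a`, `x`, `y` would be three points of one block. -/
theorem PairedOn.glue {S : Setoid α} {A : Set α} {x y : α} (h : PairedOn S A) (hs : SmallOn S A)
    (hx : x ∈ A) (hy : y ∈ A) (hxy : x ≠ y) : PairedOn (glue S x y) (A \ {x, y}) := by
  have h1 := @S.symm'
  have h2 := @S.trans'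
  have key : ∀ x ∈ A, ∀ y ∈ A, x ≠ y → ∀ a ∈ A, a ≠ x → a ≠ y → S a x →
      ∃ c ∈ A, c ≠ x ∧ c ≠ y ∧ c ≠ a ∧ S y c := by
    intro x hx y hy hxy a ha hax hay hs'
    obtain ⟨c, hc, hcy, hyc⟩ := h y hy
    refine ⟨c, hc, ?_, hcy, ?_, hyc⟩
    · rintro rfl
      exact hs a ha c hc y hy hax hay hxy hs' (h2 hs' (h1 hyc))
    · rintro rfl
      exact hs c ha x hx y hy hax hay hxy hs' (h1 hyc)
  rintro a ⟨ha, ha'⟩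
  simp only [Set.mem_insert_iff, Set.mem_singleton_iff, not_or] at ha'
  obtain ⟨b, hb, hba, hab⟩ := h a ha
  by_cases hbx : b = x
  · subst hbx
    obtain ⟨c, hc, hcx, hcy, hca, hyc⟩ := key b hx y hy hxy a ha ha'.1 ha'.2 hab
    exact ⟨c, ⟨hc, by simp [hcx, hcy]⟩, hca, Or.inr (Or.inl ⟨hab, hyc⟩)⟩
  by_cases hby : b = y
  · subst hby
    obtain ⟨c, hc, hcx, hcy, hca, hyc⟩ := key b hy x hx hxy.symm a ha ha'.2 ha'.1 hab
    exact ⟨c, ⟨hc, by simp [hcx, hcy]⟩, hca, Or.inr (Or.inr ⟨hab, hyc⟩)⟩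
  · exact ⟨b, ⟨hb, by simp [hbx, hby]⟩, hba, Or.inl hab⟩

/-- Two distinct points of one block have different colours, and so do `x` and `y`. A connection
from `a` through `x` and `y` to `b` changes the colour three times, so its ends differ in colour. -/
theorem RainbowOn.glue {f : α → Bool} {S : Setoid α} {A : Set α} {x y : α} (h : RainbowOn f S A)
    (hx : x ∈ A) (hy : y ∈ A) (hxy : f x ≠ f y) : RainbowOn f (glue S x y) (A \ {x, y}) := by
  rintro a ⟨ha, ha'⟩ b ⟨hb, hb'⟩ hab k
  simp only [Set.mem_insert_iff, Set.mem_singleton_iff, not_or] at ha' hb'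
  have hc : ∀ p q r s : Bool, p ≠ q → q ≠ r → r ≠ s → p ≠ s := by decide
  rcases k with k | ⟨k, k'⟩ | ⟨k, k'⟩
  · exact h a ha b hb hab k
  · exact (hc _ _ _ _ (fun e => ha'.1 (h a ha x hx e k)) hxy
      (fun e => hb'.2 (h y hy b hb e k').symm) hab).elim
  · exact (hc _ _ _ _ (fun e => ha'.2 (h a ha y hy e k)) hxy.symm
      (fun e => hb'.1 (h x hx b hb e k').symm) hab).elim

end Glue

/-- The `4 n` points of a pair of diagrams on a line: first the lower diagram, bottom points first,
then the upper diagram, bottom points first. Matched middle points are symmetric about zero. -/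
def linePos {n : ℕ} : (Fin n ⊕ Fin n) ⊕ (Fin n ⊕ Fin n) → ℤ
  | Sum.inl (Sum.inl i) => -2 * n + i
  | Sum.inl (Sum.inr i) => -1 - i
  | Sum.inr (Sum.inl i) => i
  | Sum.inr (Sum.inr i) => 2 * n - 1 - i

/-- The disjoint union of two diagrams. -/
def disjoint {n : ℕ} (d e : PartDiag n) : Setoid ((Fin n ⊕ Fin n) ⊕ (Fin n ⊕ Fin n)) :=
  Setoid.ker (Sum.map (Quotient.mk e) (Quotient.mk d))

/-- The union of two diagrams after the first `m` pairs of middle points have been glued. -/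
def glued {n : ℕ} (d e : PartDiag n) : ℕ → Setoid ((Fin n ⊕ Fin n) ⊕ (Fin n ⊕ Fin n))
  | 0 => disjoint d e
  | m + 1 => if h : m < n then glue (glued d e m) (Sum.inl (Sum.inr ⟨m, h⟩))
      (Sum.inr (Sum.inl ⟨m, h⟩)) else glued d e m

/-- The points that remain after the first `m` pairs of middle points have been removed. -/
def alive (n m : ℕ) : Set ((Fin n ⊕ Fin n) ⊕ (Fin n ⊕ Fin n)) :=
  {z | linePos z < -m ∨ m ≤ linePos z}

theorem glued_succ {n : ℕ} (d e : PartDiag n) (i : Fin n) : glued d e (i + 1) =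
    glue (glued d e i) (Sum.inl (Sum.inr i)) (Sum.inr (Sum.inl i)) := by
  rw [glued, dif_pos i.2]

theorem linePos_injective {n : ℕ} : Function.Injective (linePos (n := n)) := by
  rintro ((a | a) | (a | a)) ((b | b) | (b | b)) h <;> simp only [linePos] at h <;>
    have h1 := a.2 <;> have h2 := b.2 <;>
    first | (exfalso; omega) | (have : a = b := Fin.ext (by omega)); subst this; rfl

theorem alive_succ {n : ℕ} (i : Fin n) : alive n (i + 1) =
    alive n i \ {Sum.inl (Sum.inr i), Sum.inr (Sum.inl i)} := by
  ext z
  have h1 : z = Sum.inl (Sum.inr i) ↔ linePos z = -1 - (i : ℤ) :=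
    ⟨fun h => by rw [h]; rfl, fun h => linePos_injective h⟩
  have h2 : z = Sum.inr (Sum.inl i) ↔ linePos z = (i : ℤ) :=
    ⟨fun h => by rw [h]; rfl, fun h => linePos_injective h⟩
  simp only [alive, Set.mem_sdiff, Set.mem_ofPred_eq, Set.mem_insert_iff, Set.mem_singleton_iff,
    h1, h2]
  push_cast
  omega

theorem mem_alive_left {n : ℕ} (i : Fin n) : Sum.inl (Sum.inr i) ∈ alive n i := by
  left; simp only [linePos]; omega

theorem mem_alive_right {n : ℕ} (i : Fin n) : Sum.inr (Sum.inl i) ∈ alive n i := by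
  right; simp only [linePos]; omega

/-- The middle pairs sit at `-1 - i` and `i`, nested around zero, and are glued from the innermost
outwards. When a pair is glued, all points between its members have already been removed, so a
property need only survive the gluing of neighbours. -/
theorem glued_induction {n : ℕ} (d e : PartDiag n)
    (P : Setoid ((Fin n ⊕ Fin n) ⊕ (Fin n ⊕ Fin n)) →
      Set ((Fin n ⊕ Fin n) ⊕ (Fin n ⊕ Fin n)) → Prop)
    (h0 : P (disjoint d e) Set.univ)
    (hs : ∀ (i : Fin n) S, P S (alive n i) → P (glue S (Sum.inl (Sum.inr i)) (Sum.inr (Sum.inl i)))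
      (alive n i \ {Sum.inl (Sum.inr i), Sum.inr (Sum.inl i)})) : P (glued d e n) (alive n n) := by
  have : ∀ m ≤ n, P (glued d e m) (alive n m) := by
    intro m
    induction m with
    | zero =>
      intro _
      have : alive n 0 = Set.univ := by
        refine Set.eq_univ_of_forall fun z => ?_
        simp only [alive, Set.mem_ofPred_eq]
        omega
      rw [this]
      exact h0
    | succ m ih =>
      intro hm
      have h1 := hs ⟨m, hm⟩ _ (ih (by omega))
      have h2 := glued_succ d e ⟨m, hm⟩
      have h3 := alive_succ (⟨m, hm⟩ : Fin n)
      simp only at h2 h3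
      rw [h2, h3]
      exact h1
  exact this n le_rfl

theorem glued_mono {n : ℕ} (d e : PartDiag n) {m m' : ℕ} (h : m ≤ m') :
    glued d e m ≤ glued d e m' := by
  induction h with
  | refl => exact le_rfl
  | @step k _ ih =>
    refine ih.trans ?_
    rw [glued]
    split_ifs with h
    · exact fun a b hab => Or.inl hab
    · exact le_rfl

/-- The image of a point of the line in the three layers. -/
def layer {n : ℕ} : (Fin n ⊕ Fin n) ⊕ (Fin n ⊕ Fin n) → Fin n ⊕ (Fin n ⊕ Fin n) :=
  Sum.elim lower upper

theorem disjoint_inl {n : ℕ} {d e : PartDiag n} {a b : Fin n ⊕ Fin n} :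
    disjoint d e (Sum.inl a) (Sum.inl b) ↔ e a b :=
  ⟨fun h => Quotient.exact (Sum.inl_injective h), fun h => congrArg Sum.inl (Quotient.sound h)⟩

theorem disjoint_inr {n : ℕ} {d e : PartDiag n} {a b : Fin n ⊕ Fin n} :
    disjoint d e (Sum.inr a) (Sum.inr b) ↔ d a b :=
  ⟨fun h => Quotient.exact (Sum.inr_injective h), fun h => congrArg Sum.inr (Quotient.sound h)⟩

theorem disjoint_inl_inr {n : ℕ} {d e : PartDiag n} {a b : Fin n ⊕ Fin n} :
    ¬ disjoint d e (Sum.inl a) (Sum.inr b) := fun h => by cases h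

theorem disjoint_inr_inl {n : ℕ} {d e : PartDiag n} {a b : Fin n ⊕ Fin n} :
    ¬ disjoint d e (Sum.inr a) (Sum.inl b) := fun h => by cases h

theorem glued_le {n : ℕ} (d e : PartDiag n) :
    ∀ m, glued d e m ≤ Setoid.comap layer (stack d e) := by
  intro m
  induction m with
  | zero =>
    rintro (a | a) (b | b) h
    · exact stack_lower (disjoint_inl.1 h)
    · exact (disjoint_inl_inr h).elim
    · exact (disjoint_inr_inl h).elim
    · exact stack_upper (disjoint_inr.1 h)
  | succ m ih =>
    rw [glued]
    split_ifs with hm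
    · rintro a b (h | ⟨h, h'⟩ | ⟨h, h'⟩)
      · exact ih h
      · have h1 := ih h
        have h2 := ih h'
        exact (stack d e).trans' h1 h2
      · have h1 := ih h
        have h2 := ih h'
        exact (stack d e).trans' h1 h2
    · exact ih

/-- The outer points on the line. -/
def outerLine {n : ℕ} : Fin n ⊕ Fin n → (Fin n ⊕ Fin n) ⊕ (Fin n ⊕ Fin n) :=
  Sum.map Sum.inl Sum.inr

theorem glued_outer {n : ℕ} {d e : PartDiag n} {x y : Fin n ⊕ Fin n} :
    glued d e n (outerLine x) (outerLine y) ↔ comp d e x y := by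
  have hol : ∀ z : Fin n ⊕ Fin n, layer (outerLine z) = outer z := by rintro (z | z) <;> rfl
  constructor
  · intro h
    have h1 : stack d e (layer (outerLine x)) (layer (outerLine y)) := glued_le d e n h
    rwa [hol, hol] at h1
  · intro h
    -- `σ` represents a middle point by its copy in the upper diagram; `hmid` says that the copy in
    -- the lower diagram has been glued to it.
    let σ : Fin n ⊕ (Fin n ⊕ Fin n) → (Fin n ⊕ Fin n) ⊕ (Fin n ⊕ Fin n) :=
      Sum.elim (fun i => Sum.inl (Sum.inl i)) Sum.inr
    have hmid : ∀ i : Fin n, glued d e n (Sum.inl (Sum.inr i)) (Sum.inr (Sum.inl i)) := by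
      intro i
      refine glued_mono d e (m := i + 1) i.2 ?_
      rw [glued_succ]
      exact Or.inr (Or.inl ⟨Setoid.refl' _ _, Setoid.refl' _ _⟩)
    have h0 : disjoint d e ≤ glued d e n := glued_mono d e (Nat.zero_le n)
    have hσ : ∀ z : Fin n ⊕ Fin n, σ (outer z) = outerLine z := by rintro (z | z) <;> rfl
    have hlow : ∀ z : Fin n ⊕ Fin n, glued d e n (Sum.inl z) (σ (lower z)) := by
      rintro (z | z)
      · exact Setoid.refl' _ _
      · exact hmid z
    rw [← hσ, ← hσ]
    refine Quotient.exact (stack_imp (d := d) (e := e) (fun z => Quotient.mk _ (σ z)) ?_ ?_ h)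
    · intro a b hab
      exact Quotient.sound (h0 (disjoint_inr.2 hab))
    · intro a b hab
      refine Quotient.sound ?_
      exact (glued d e n).trans' ((glued d e n).symm' (hlow a))
        ((glued d e n).trans' (h0 (disjoint_inl.2 hab)) (hlow b))

theorem outerLine_mem {n : ℕ} (x : Fin n ⊕ Fin n) : outerLine x ∈ alive n n := by
  rcases x with x | x
  · left; simp only [outerLine, Sum.map_inl, linePos]; omega
  · right; simp only [outerLine, Sum.map_inr, linePos]; omega

theorem mem_alive_iff {n : ℕ} {z : (Fin n ⊕ Fin n) ⊕ (Fin n ⊕ Fin n)} :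
    z ∈ alive n n ↔ ∃ x, outerLine x = z := by
  refine ⟨fun h => ?_, fun ⟨x, hx⟩ => hx ▸ outerLine_mem x⟩
  rcases z with (z | z) | (z | z)
  · exact ⟨Sum.inl z, rfl⟩
  · rcases h with h | h <;> simp only [linePos] at h <;> omega
  · rcases h with h | h <;> simp only [linePos] at h <;> omega
  · exact ⟨Sum.inr z, rfl⟩

theorem outerLine_injective {n : ℕ} : Function.Injective (outerLine (n := n)) := by
  rintro (x | x) (y | y) h <;> simp_all [outerLine]

theorem pos_lt_iff {n : ℕ} {x y : Fin n ⊕ Fin n} :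
    pos x < pos y ↔ linePos (outerLine x) < linePos (outerLine y) := by
  rcases x with x | x <;> rcases y with y | y <;>
    simp only [pos, outerLine, linePos, Sum.elim_inl, Sum.elim_inr, Sum.map_inl, Sum.map_inr] <;>
    omega

theorem linePos_inl_lt {n : ℕ} {x y : Fin n ⊕ Fin n} :
    linePos (Sum.inl x) < linePos (Sum.inl y) ↔ pos x < pos y := by
  rcases x with x | x <;> rcases y with y | y <;>
    simp only [pos, linePos, Sum.elim_inl, Sum.elim_inr] <;> omega

theorem linePos_inr_lt {n : ℕ} {x y : Fin n ⊕ Fin n} :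
    linePos (Sum.inr x) < linePos (Sum.inr y) ↔ pos x < pos y := by
  rcases x with x | x <;> rcases y with y | y <;>
    simp only [pos, linePos, Sum.elim_inl, Sum.elim_inr] <;> omega

theorem linePos_inl_lt_inr {n : ℕ} (x y : Fin n ⊕ Fin n) :
    linePos (Sum.inl x) < linePos (Sum.inr y) := by
  rcases x with x | x <;> rcases y with y | y <;> simp only [linePos] <;> omega

theorem Planar.comp {n : ℕ} {d e : PartDiag n} (hd : Planar d) (he : Planar e) :
    Planar (comp d e) := by
  have key : NoncrossingOn linePos (glued d e n) (alive n n) := by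
    refine glued_induction d e (NoncrossingOn linePos) ?_ ?_
    -- All points of the lower diagram precede those of the upper one, so a crossing of the disjoint
    -- union lies within one of the two diagrams.
    · rintro (a | a) - (b | b) - (c | c) - (f | f) - hab hbc hcf hac hbf
      · rw [linePos_inl_lt] at hab hbc hcf
        exact disjoint_inl.2 (he _ _ _ _ hab hbc hcf (disjoint_inl.1 hac) (disjoint_inl.1 hbf))
      all_goals first
        | exact (disjoint_inl_inr hac).elim
        | exact (disjoint_inl_inr hbf).elim
        | exact (disjoint_inr_inl hac).elim
        | exact (disjoint_inr_inl hbf).elim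
        | exact ((linePos_inl_lt_inr _ _).not_gt hab).elim
        | exact ((linePos_inl_lt_inr _ _).not_gt hbc).elim
        | skip
      rw [linePos_inr_lt] at hab hbc hcf
      exact disjoint_inr.2 (hd _ _ _ _ hab hbc hcf (disjoint_inr.1 hac) (disjoint_inr.1 hbf))
    · intro i S h
      refine h.glue (mem_alive_left i) (mem_alive_right i) ?_
      intro z hz h1 h2
      have h1' : linePos z ≠ -1 - (i : ℤ) := fun h => h1 (linePos_injective h)
      have h2' : linePos z ≠ (i : ℤ) := fun h => h2 (linePos_injective h)
      simp only [alive, Set.mem_ofPred_eq] at hz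
      have e1 : linePos (Sum.inl (Sum.inr i)) = -1 - (i : ℤ) := rfl
      have e2 : linePos (Sum.inr (Sum.inl i)) = (i : ℤ) := rfl
      rw [e1, e2]
      omega
  intro w x y z hwx hxy hyz hwy hxz
  rw [pos_lt_iff] at hwx hxy hyz
  rw [← glued_outer] at *
  exact key _ (outerLine_mem _) _ (outerLine_mem _) _ (outerLine_mem _) _ (outerLine_mem _)
    hwx hxy hyz hwy hxz

/-- No block has three points. -/
def Small {n : ℕ} (d : PartDiag n) : Prop :=
  ∀ a b c, a ≠ b → a ≠ c → b ≠ c → d a b → d a c → False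

/-- Every block has at least two points. -/
def Paired {n : ℕ} (d : PartDiag n) : Prop := ∀ a, ∃ b, b ≠ a ∧ d a b

/-- Every block has at most one bottom and at most one top point. -/
def Rook {n : ℕ} (d : PartDiag n) : Prop := ∀ a b, a.isLeft = b.isLeft → d a b → a = b

theorem disjoint_small {n : ℕ} {d e : PartDiag n} (hd : Small d) (he : Small e) :
    SmallOn (disjoint d e) Set.univ := by
  rintro (a | a) - (b | b) - (c | c) - hab hac hbc kab kac
  · exact he a b c (fun h => hab (h ▸ rfl)) (fun h => hac (h ▸ rfl)) (fun h => hbc (h ▸ rfl))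
      (disjoint_inl.1 kab) (disjoint_inl.1 kac)
  all_goals first
    | exact (disjoint_inl_inr kab).elim
    | exact (disjoint_inl_inr kac).elim
    | exact (disjoint_inr_inl kab).elim
    | exact (disjoint_inr_inl kac).elim
    | skip
  exact hd a b c (fun h => hab (h ▸ rfl)) (fun h => hac (h ▸ rfl)) (fun h => hbc (h ▸ rfl))
      (disjoint_inr.1 kab) (disjoint_inr.1 kac)

theorem Small.comp {n : ℕ} {d e : PartDiag n} (hd : Small d) (he : Small e) :
    Small (comp d e) := by
  have key : SmallOn (glued d e n) (alive n n) :=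
    glued_induction d e SmallOn (disjoint_small hd he)
      (fun i S h => h.glue (mem_alive_left i) (mem_alive_right i))
  intro a b c hab hac hbc kab kac
  rw [← glued_outer] at kab kac
  exact key _ (outerLine_mem a) _ (outerLine_mem b) _ (outerLine_mem c)
    (outerLine_injective.ne hab) (outerLine_injective.ne hac) (outerLine_injective.ne hbc) kab kac

theorem Paired.comp {n : ℕ} {d e : PartDiag n} (hd : Small d) (he : Small e) (hd' : Paired d)
    (he' : Paired e) : Paired (comp d e) := by
  have key : SmallOn (glued d e n) (alive n n) ∧ PairedOn (glued d e n) (alive n n) := by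
    refine glued_induction d e (fun S A => SmallOn S A ∧ PairedOn S A)
      ⟨disjoint_small hd he, ?_⟩
      (fun i S h => ⟨h.1.glue (mem_alive_left i) (mem_alive_right i),
        h.2.glue h.1 (mem_alive_left i) (mem_alive_right i) (by simp)⟩)
    rintro (a | a) -
    · obtain ⟨b, hb, hab⟩ := he' a
      exact ⟨Sum.inl b, trivial, fun h => hb (Sum.inl_injective h), disjoint_inl.2 hab⟩
    · obtain ⟨b, hb, hab⟩ := hd' a
      exact ⟨Sum.inr b, trivial, fun h => hb (Sum.inr_injective h), disjoint_inr.2 hab⟩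
  intro a
  obtain ⟨b, hb, hba, hab⟩ := key.2 _ (outerLine_mem a)
  obtain ⟨b, rfl⟩ := mem_alive_iff.1 hb
  exact ⟨b, fun h => hba (h ▸ rfl), glued_outer.1 hab⟩

theorem Rook.comp {n : ℕ} {d e : PartDiag n} (hd : Rook d) (he : Rook e) : Rook (comp d e) := by
  have key : RainbowOn (Sum.elim Sum.isLeft Sum.isLeft) (glued d e n) (alive n n) := by
    refine glued_induction d e (RainbowOn (Sum.elim Sum.isLeft Sum.isLeft)) ?_
      (fun i S h => h.glue (mem_alive_left i) (mem_alive_right i) (by simp))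
    rintro (a | a) - (b | b) - hab k
    · exact congrArg Sum.inl (he a b hab (disjoint_inl.1 k))
    · exact (disjoint_inl_inr k).elim
    · exact (disjoint_inr_inl k).elim
    · exact congrArg Sum.inr (hd a b hab (disjoint_inr.1 k))
  intro a b hab k
  rw [← glued_outer] at k
  refine outerLine_injective (key _ (outerLine_mem a) _ (outerLine_mem b) ?_ k)
  rcases a with a | a <;> rcases b with b | b <;> simp_all [outerLine]

end PartDiag

/-! ### Noncrossing partitions as words and lattice paths -/

/-- A partition of the natural numbers no two blocks of which cross. -/
def Noncrossing (S : Setoid ℕ) : Prop :=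
  ∀ a b c e, a < b → b < c → c < e → S a c → S b e → S a b

namespace Noncrossing

/-- The height of a word at a given time. A letter records whether it continues (or ends) an open
block, and whether it leaves its block open. -/
def wordHeight (W : ℕ → Bool × Bool) : ℕ → ℤ
  | 0 => 0
  | t + 1 => wordHeight W t + (if (W t).2 then 1 else 0) - (if (W t).1 then 1 else 0)

theorem wordHeight_congr {W W' : ℕ → Bool × Bool} {n : ℕ} (h : ∀ t < n, W t = W' t) :
    ∀ t ≤ n, wordHeight W t = wordHeight W' t := by
  intro t
  induction t with
  | zero => intro _; rfl
  | succ t ih => intro ht; rw [wordHeight, wordHeight, ih (by omega), h t ht]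

/-- The letters at `i < j` belong to the same block of the partition described by the word. -/
def WordRel (W : ℕ → Bool × Bool) (i j : ℕ) : Prop :=
  (W i).2 = true ∧ (W j).1 = true ∧ wordHeight W (i + 1) = wordHeight W j ∧
    ∀ t, i < t → t ≤ j → wordHeight W j ≤ wordHeight W t

theorem WordRel.congr {W W' : ℕ → Bool × Bool} {n : ℕ} (h : ∀ t < n, W t = W' t) {i j : ℕ}
    (hij : i < j) (hj : j < n) : WordRel W i j ↔ WordRel W' i j := by
  have h1 := wordHeight_congr h
  unfold WordRel
  rw [h i (by omega), h j hj, h1 (i + 1) (by omega), h1 j hj.le]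
  refine and_congr_right fun _ => and_congr_right fun _ => and_congr_right fun _ => ?_
  refine forall_congr' fun t => ?_
  refine imp_congr_right fun _ => forall_congr' fun ht => ?_
  rw [h1 t (by omega)]

/-- The partition described by a word. -/
def ofWord (W : ℕ → Bool × Bool) : Setoid ℕ where
  r i j := i = j ∨ (i < j ∧ WordRel W i j) ∨ (j < i ∧ WordRel W j i)
  iseqv :=
    { refl := fun _ => Or.inl rfl
      symm := by
        rintro x y (h | h | h)
        · exact Or.inl h.symm
        · exact Or.inr (Or.inr h)
        · exact Or.inr (Or.inl h)
      trans := by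
        -- Three forms of transitivity for `i < j < k`. In `t2` and `t3` it has to be shown that the
        -- letter in question has its second bit, by the path not dropping below the level of the
        -- block after `j` (`t2`), respectively its first bit, by the path not being below that
        -- level before `j` (`t3`).
        have t1 : ∀ {i j k}, i < j → j < k → WordRel W i j → WordRel W j k → WordRel W i k := by
          rintro i j k hij hjk ⟨a1, a2, a3, a4⟩ ⟨b1, b2, b3, b4⟩
          have e1 : wordHeight W (j + 1) = wordHeight W j := by
            rw [wordHeight, if_pos b1, if_pos a2]; ring
          refine ⟨a1, b2, by omega, fun t h1 h2 => ?_⟩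
          by_cases ht : t ≤ j
          · have := a4 t h1 ht; omega
          · exact b4 t (by omega) h2
        have t2 : ∀ {i j k}, i < j → j < k → WordRel W i j → WordRel W i k → WordRel W j k := by
          rintro i j k hij hjk ⟨a1, a2, a3, a4⟩ ⟨b1, b2, b3, b4⟩
          have e1 := b4 (j + 1) (by omega) (by omega)
          have e2 : wordHeight W (j + 1) = wordHeight W j + (if (W j).2 then 1 else 0) - 1 := by
            rw [wordHeight, if_pos a2]
          have e3 : (W j).2 = true := by
            by_contra h
            rw [if_neg h] at e2
            omega
          rw [if_pos e3] at e2
          exact ⟨e3, b2, by omega, fun t h1 h2 => b4 t (by omega) h2⟩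
        have t3 : ∀ {i j k}, i < j → j < k → WordRel W i k → WordRel W j k → WordRel W i j := by
          rintro i j k hij hjk ⟨a1, a2, a3, a4⟩ ⟨b1, b2, b3, b4⟩
          have e1 := a4 j (by omega) (by omega)
          have e2 : wordHeight W (j + 1) = wordHeight W j + 1 - (if (W j).1 then 1 else 0) := by
            rw [wordHeight, if_pos b1]
          have e3 : (W j).1 = true := by
            by_contra h
            rw [if_neg h] at e2
            omega
          rw [if_pos e3] at e2
          refine ⟨a1, e3, by omega, fun t h1 h2 => ?_⟩
          have := a4 t h1 (by omega)
          omega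
        rintro x y z (rfl | ⟨h, k⟩ | ⟨h, k⟩) hyz
        · exact hyz
        · rcases hyz with rfl | ⟨l, m⟩ | ⟨l, m⟩
          · exact Or.inr (Or.inl ⟨h, k⟩)
          · exact Or.inr (Or.inl ⟨h.trans l, t1 h l k m⟩)
          · rcases lt_trichotomy x z with g | g | g
            · exact Or.inr (Or.inl ⟨g, t3 g l k m⟩)
            · exact Or.inl g
            · exact Or.inr (Or.inr ⟨g, t3 g h m k⟩)
        · rcases hyz with rfl | ⟨l, m⟩ | ⟨l, m⟩
          · exact Or.inr (Or.inr ⟨h, k⟩)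
          · rcases lt_trichotomy x z with g | g | g
            · exact Or.inr (Or.inl ⟨g, t2 h g k m⟩)
            · exact Or.inl g
            · exact Or.inr (Or.inr ⟨g, t2 l g m k⟩)
          · exact Or.inr (Or.inr ⟨l.trans h, t1 l h m k⟩) }

theorem ofWord_iff {W : ℕ → Bool × Bool} {i j : ℕ} (h : i < j) : ofWord W i j ↔ WordRel W i j := by
  refine ⟨?_, fun k => Or.inr (Or.inl ⟨h, k⟩)⟩
  rintro (k | ⟨-, k⟩ | ⟨k, -⟩)
  · omega
  · exact k
  · omega

/-- A block has a fixed level, below which the path does not go between two of its points. A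
crossing compares the levels of the two blocks in both directions, so the levels agree, and `b`
continues the block of `a`. -/
theorem noncrossing_ofWord (W : ℕ → Bool × Bool) : Noncrossing (ofWord W) := by
  intro a b c e hab hbc hce hac hbe
  rw [ofWord_iff (by omega)] at hac hbe ⊢
  obtain ⟨a1, a2, a3, a4⟩ := hac
  obtain ⟨b1, b2, b3, b4⟩ := hbe
  have e1 := b4 c (by omega) (by omega)
  have e2 := a4 (b + 1) (by omega) (by omega)
  have e3 := a4 b (by omega) (by omega)
  have e4 : wordHeight W (b + 1) = wordHeight W b + 1 - (if (W b).1 then 1 else 0) := by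
    rw [wordHeight, if_pos b1]
  have e5 : (W b).1 = true := by
    by_contra h
    rw [if_neg h] at e4
    omega
  rw [if_pos e5] at e4
  refine ⟨a1, e5, by omega, fun t h1 h2 => ?_⟩
  have := a4 t h1 (by omega)
  omega

open Classical in
/-- The word of a partition of the natural numbers. -/
noncomputable def word (S : Setoid ℕ) (t : ℕ) : Bool × Bool :=
  (decide (∃ i < t, S i t), decide (∃ j > t, S t j))

theorem word_fst {S : Setoid ℕ} {t : ℕ} : (word S t).1 = true ↔ ∃ i < t, S i t := by
  simp [word]

theorem word_snd {S : Setoid ℕ} {t : ℕ} : (word S t).2 = true ↔ ∃ j > t, S t j := by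
  simp [word]

/-- The blocks with a point before and a point not before `t`. -/
def openBlocks (S : Setoid ℕ) (t : ℕ) : Set (Quotient S) :=
  {q | (∃ a < t, Quotient.mk S a = q) ∧ ∃ b ≥ t, Quotient.mk S b = q}

theorem finite_openBlocks (S : Setoid ℕ) (t : ℕ) : (openBlocks S t).Finite := by
  refine ((Set.finite_Iio t).image (Quotient.mk S)).subset ?_
  rintro q ⟨⟨a, ha, rfl⟩, -⟩
  exact ⟨a, ha, rfl⟩

theorem mk_mem_openBlocks {S : Setoid ℕ} {t : ℕ} :
    Quotient.mk S t ∈ openBlocks S t ↔ (word S t).1 = true := by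
  rw [word_fst]
  constructor
  · rintro ⟨⟨a, ha, h⟩, -⟩
    exact ⟨a, ha, Quotient.exact h⟩
  · rintro ⟨a, ha, h⟩
    exact ⟨⟨a, ha, Quotient.sound h⟩, t, le_rfl, rfl⟩

theorem mk_mem_openBlocks_succ {S : Setoid ℕ} {t : ℕ} :
    Quotient.mk S t ∈ openBlocks S (t + 1) ↔ (word S t).2 = true := by
  rw [word_snd]
  constructor
  · rintro ⟨-, a, ha, h⟩
    exact ⟨a, ha, S.symm' (Quotient.exact h)⟩
  · rintro ⟨a, ha, h⟩
    exact ⟨⟨t, t.lt_succ_self, rfl⟩, a, ha, (Quotient.sound h).symm⟩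

theorem openBlocks_diff (S : Setoid ℕ) (t : ℕ) :
    openBlocks S (t + 1) \ {Quotient.mk S t} = openBlocks S t \ {Quotient.mk S t} := by
  ext q
  constructor
  · rintro ⟨⟨⟨a, ha, rfl⟩, b, hb, hab⟩, hq⟩
    refine ⟨⟨⟨a, ?_, rfl⟩, b, by omega, hab⟩, hq⟩
    rcases Nat.lt_succ_iff_lt_or_eq.1 ha with h | rfl
    · exact h
    · exact (hq rfl).elim
  · rintro ⟨⟨⟨a, ha, rfl⟩, b, hb, hab⟩, hq⟩
    refine ⟨⟨⟨a, by omega, rfl⟩, b, ?_, hab⟩, hq⟩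
    rcases hb.eq_or_lt with rfl | h
    · exact (hq hab.symm).elim
    · exact h

/-- The height counts open blocks: passing `t` can change the status of the block of `t` only, and
the two bits of the letter say whether this block is open before and after. -/
theorem wordHeight_word (S : Setoid ℕ) (t : ℕ) :
    wordHeight (word S) t = (openBlocks S t).ncard := by
  induction t with
  | zero =>
    have : openBlocks S 0 = ∅ := by
      ext q
      constructor
      · rintro ⟨⟨a, ha, -⟩, -⟩
        omega
      · exact fun h => h.elim
    rw [this, Set.ncard_empty]; rfl
  | succ t ih =>
    have h1 : ∀ A : Set (Quotient S), A.Finite → ∀ b : Bool, (Quotient.mk S t ∈ A ↔ b = true) →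
        (A.ncard : ℤ) = (A \ {Quotient.mk S t}).ncard + if b then 1 else 0 := by
      intro A hA b hb
      by_cases h : b = true
      · rw [if_pos h, ← Set.ncard_sdiff_singleton_add_one (hb.2 h) hA]
        push_cast; ring
      · rw [if_neg h, Set.sdiff_singleton_eq_self (fun k => h (hb.1 k))]; ring
    rw [wordHeight, ih, h1 _ (finite_openBlocks S t) _ mk_mem_openBlocks,
      h1 _ (finite_openBlocks S (t + 1)) _ mk_mem_openBlocks_succ, openBlocks_diff]
    ring

variable {S : Setoid ℕ}

/-- Apart from the block of `i` and `j` itself, a block that starts strictly between `i` and `j`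
cannot leave this interval without a crossing. So whatever is open at `j` was open at `t`. -/
theorem openBlocks_subset (h : Noncrossing S) {i j t : ℕ} (hij : S i j) (hi : i < t)
    (hj : t ≤ j) : openBlocks S j ⊆ openBlocks S t := by
  rintro q ⟨⟨a, ha, rfl⟩, b, hb, hab⟩
  have hba : S a b := S.symm' (Quotient.exact hab)
  by_cases hai : S a i
  · have e1 : Quotient.mk S i = Quotient.mk S a := (Quotient.sound hai).symm
    exact ⟨⟨i, hi, e1⟩, j, hj, (Quotient.sound (S.trans' hai hij)).symm⟩
  · refine ⟨⟨a, ?_, rfl⟩, b, by omega, hab⟩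
    by_contra hat
    have hb' : j < b := by
      rcases hb.lt_or_eq with h' | rfl
      · exact h'
      · exact (hai (S.trans' hba (S.symm' hij))).elim
    exact hai (S.symm' (h i a j b (by omega) ha hb' hij hba))

/-- A block other than that of `i` that is open just after `i` started before `i`; by noncrossing it
cannot have a last point between `i` and `j`. The condition `hc`, that `i` and `j` are neighbours in
their block, suits the induction in `wordHeight_succ_of_rel`. -/
theorem openBlocks_succ_subset (h : Noncrossing S) {i j : ℕ} (hij : S i j) (hlt : i < j)
    (hc : ∀ c, i < c → c < j → ¬ S i c) : openBlocks S (i + 1) ⊆ openBlocks S j := by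
  rintro q ⟨⟨a, ha, rfl⟩, b, hb, hab⟩
  have hba : S a b := S.symm' (Quotient.exact hab)
  by_cases hai : S a i
  · exact ⟨⟨i, hlt, (Quotient.sound hai).symm⟩, j, le_rfl,
      (Quotient.sound (S.trans' hai hij)).symm⟩
  · have hai' : a < i := by
      rcases Nat.lt_succ_iff_lt_or_eq.1 ha with h' | rfl
      · exact h'
      · exact (hai (S.refl' _)).elim
    refine ⟨⟨a, by omega, rfl⟩, b, ?_, hab⟩
    by_contra hbj
    exact hai (h a i b j hai' hb (by omega) hba hij)

theorem wordHeight_le (h : Noncrossing S) {i j t : ℕ} (hij : S i j) (hi : i < t) (hj : t ≤ j) :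
    wordHeight (word S) j ≤ wordHeight (word S) t := by
  rw [wordHeight_word, wordHeight_word]
  exact_mod_cast Set.ncard_le_ncard (h.openBlocks_subset hij hi hj) (finite_openBlocks S t)

theorem wordHeight_succ_of_rel (h : Noncrossing S) {i j : ℕ} (hlt : i < j) (hij : S i j) :
    wordHeight (word S) (i + 1) = wordHeight (word S) j := by
  induction j using Nat.strong_induction_on with
  | h j ih =>
    by_cases hc : ∀ c, i < c → c < j → ¬ S i c
    · refine le_antisymm ?_ (h.wordHeight_le hij (by omega) (by omega))
      rw [wordHeight_word, wordHeight_word]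
      exact_mod_cast Set.ncard_le_ncard (h.openBlocks_succ_subset hij hlt hc)
        (finite_openBlocks S j)
    · push Not at hc
      obtain ⟨c, h1, h2, h3⟩ := hc
      refine le_antisymm ?_ (h.wordHeight_le hij (by omega) (by omega))
      classical
      -- `m` below is the last point of the block strictly before `j`. Its letter has both bits, so
      -- the height does not change there, and the induction hypothesis covers the part up to `m`.
      let P : ℕ → Prop := fun c => i < c ∧ c < j ∧ S i c
      have hP : P c := ⟨h1, h2, h3⟩
      have hmax := Nat.findGreatest_spec (P := P) h2.le hP
      set m := Nat.findGreatest P j with hm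
      have hmm : ∀ c', m < c' → c' < j → ¬ S m c' := by
        intro c' g1 g2 g3
        have g4 : P c' := ⟨hmax.1.trans g1, g2, S.trans' hmax.2.2 g3⟩
        exact absurd (Nat.le_findGreatest g2.le g4) (by omega)
      have hmj : S m j := S.trans' (S.symm' hmax.2.2) hij
      have e1 := ih m hmax.2.1 hmax.1 hmax.2.2
      have e2 : wordHeight (word S) (m + 1) = wordHeight (word S) m := by
        rw [wordHeight, if_pos (word_snd.2 ⟨j, hmax.2.1, hmj⟩),
          if_pos (word_fst.2 ⟨i, hmax.1, hmax.2.2⟩)]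
        ring
      have e3 : wordHeight (word S) (m + 1) ≤ wordHeight (word S) j := by
        rw [wordHeight_word, wordHeight_word]
        exact_mod_cast Set.ncard_le_ncard (h.openBlocks_succ_subset hmj hmax.2.1 hmm)
          (finite_openBlocks S j)
      omega

/-- A noncrossing partition is described by its word. -/
theorem rel_iff (h : Noncrossing S) {i j : ℕ} (hlt : i < j) : S i j ↔ WordRel (word S) i j := by
  constructor
  · intro hij
    exact ⟨word_snd.2 ⟨j, hlt, hij⟩, word_fst.2 ⟨i, hlt, hij⟩, h.wordHeight_succ_of_rel hlt hij,
      fun t h1 h2 => h.wordHeight_le hij h1 h2⟩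
  · rintro ⟨a1, a2, a3, a4⟩
    by_contra hij
    classical
    -- `m` below is the last point of the block of `i` up to `j`. It differs from `j` because `i`
    -- and `j` are assumed to be unrelated.
    let P : ℕ → Prop := fun c => i ≤ c ∧ S i c
    have hP : P i := ⟨le_rfl, S.refl' _⟩
    have hmax := Nat.findGreatest_spec (P := P) hlt.le hP
    have hmj : Nat.findGreatest P j ≤ j := Nat.findGreatest_le j
    have hgr : ∀ c, Nat.findGreatest P j < c → c ≤ j → ¬ P c := fun c g1 g2 g3 =>
      absurd (Nat.le_findGreatest g2 g3) (by omega)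
    set m := Nat.findGreatest P j
    have hmj' : m < j := by
      rcases hmj.lt_or_eq with h' | h'
      · exact h'
      · exact (hij (h' ▸ hmax.2)).elim
    have e1 : (word S m).1 = true → wordHeight (word S) m = wordHeight (word S) j ∧ i < m ∨
        m = i := by
      intro _
      rcases hmax.1.eq_or_lt with h' | h'
      · exact Or.inr h'.symm
      · exact Or.inl ⟨(h.wordHeight_succ_of_rel h' hmax.2).symm.trans a3, h'⟩
    have e2 : (word S m).2 = true := by
      rcases hmax.1.eq_or_lt with h' | h'
      · rw [← h']; exact a1
      · by_contra hs
        have e3 := a4 (m + 1) (by omega) (by omega)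
        have e4 : (word S m).1 = true := word_fst.2 ⟨i, h', hmax.2⟩
        have e5 : wordHeight (word S) (m + 1) = wordHeight (word S) m + 0 - 1 := by
          rw [wordHeight, if_neg hs, if_pos e4]
        have e6 := h.wordHeight_succ_of_rel h' hmax.2
        omega
    obtain ⟨l, hl, hml⟩ := word_snd.1 e2
    have hlj : j < l := by
      by_contra h'
      exact hgr l hl (by omega) ⟨by omega, S.trans' hmax.2 hml⟩
    obtain ⟨b, hb, hbj⟩ := word_fst.1 a2
    have hmjn : ¬ S m j := fun h' => hij (S.trans' hmax.2 h')
    have hmb : m < b := by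
      by_contra h'
      rcases (not_lt.1 h').eq_or_lt with rfl | h''
      · exact hmjn hbj
      · exact hmjn (S.trans' (S.symm' (h b m j l h'' hmj' hlj hbj hml)) hbj)
    -- The block of `m` goes on to `l > j`, so it and every block around it stay open until `j`. The
    -- block of `j` starts after `m` and is open in addition. Hence the path is strictly lower at `m
    -- + 1` than at `j`, against `a4`.
    have hsub : openBlocks S (m + 1) ⊂ openBlocks S j := by
      refine (Set.ssubset_iff_of_subset ?_).2 ⟨Quotient.mk S j, mk_mem_openBlocks.2 a2, ?_⟩
      · rintro q ⟨⟨a, ha, rfl⟩, c, hc, hac⟩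
        have hac' : S a c := S.symm' (Quotient.exact hac)
        by_cases ham : S a m
        · exact ⟨⟨a, by omega, rfl⟩, l, by omega, (Quotient.sound (S.trans' ham hml)).symm⟩
        · refine ⟨⟨a, by omega, rfl⟩, c, ?_, hac⟩
          by_contra hcj
          have ham' : a < m := by
            rcases Nat.lt_succ_iff_lt_or_eq.1 ha with h' | rfl
            · exact h'
            · exact (ham (S.refl' _)).elim
          exact ham (h a m c l ham' hc (by omega) hac' hml)
      · rintro ⟨⟨a, ha, haj⟩, -⟩
        have haj' : S a j := Quotient.exact haj
        rcases Nat.lt_succ_iff_lt_or_eq.1 ha with h' | rfl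
        · exact hmjn (S.trans' (S.symm' (h a m j l h' hmj' hlj haj' hml)) haj')
        · exact hmjn haj'
    have e7 := Set.ncard_lt_ncard hsub (finite_openBlocks S j)
    have e8 := a4 (m + 1) (by omega) (by omega)
    rw [wordHeight_word, wordHeight_word] at e8
    omega

/-- A noncrossing partition is determined by its word. -/
theorem word_injective {S' : Setoid ℕ} (h : Noncrossing S) (h' : Noncrossing S')
    (hw : word S = word S') : S = S' := by
  have key : ∀ i j, i < j → (S i j ↔ S' i j) := fun i j hij => by
    rw [h.rel_iff hij, h'.rel_iff hij, hw]
  ext i j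
  rcases lt_trichotomy i j with hij | rfl | hij
  · exact key i j hij
  · exact ⟨fun _ => S'.refl' _, fun _ => S.refl' _⟩
  · exact ⟨fun k => S'.symm' ((key j i hij).1 (S.symm' k)),
      fun k => S.symm' ((key j i hij).2 (S'.symm' k))⟩

/-- Whether the block of `i` reaches a position that is not before `n` can be read off from the
first `n` letters. -/
theorem reaches_iff (h : Noncrossing S) {i n : ℕ} (hi : i < n) :
    (∃ j ≥ n, S i j) ↔ (word S i).2 = true ∧
      ∀ t, i < t → t ≤ n → wordHeight (word S) (i + 1) ≤ wordHeight (word S) t := by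
  constructor
  · rintro ⟨j, hj, hij⟩
    refine ⟨word_snd.2 ⟨j, by omega, hij⟩, fun t h1 h2 => ?_⟩
    rw [h.wordHeight_succ_of_rel (by omega) hij]
    exact h.wordHeight_le hij h1 (by omega)
  · rintro ⟨h1, h2⟩
    by_contra hn
    push Not at hn
    classical
    obtain ⟨j, hj, hij⟩ := word_snd.1 h1
    let P : ℕ → Prop := fun c => i < c ∧ S i c
    have hjn : j ≤ n := by
      by_contra h'
      exact hn j (by omega) hij
    have hmax := Nat.findGreatest_spec (P := P) hjn ⟨hj, hij⟩
    have hgr : ∀ c, Nat.findGreatest P n < c → c ≤ n → ¬ P c := fun c g1 g2 g3 =>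
      absurd (Nat.le_findGreatest g2 g3) (by omega)
    set m := Nat.findGreatest P n
    have hmn : m < n := by
      by_contra h'
      exact hn m (by omega) hmax.2
    -- `m` is the last point of the block altogether; as it closes the block, the path falls below
    -- the level of the block right after it.
    have e1 : (word S m).2 = false := by
      by_contra h'
      obtain ⟨c, hc, hmc⟩ := word_snd.1 (by simpa using h')
      have g1 := S.trans' hmax.2 hmc
      by_cases hcn : c ≤ n
      · exact hgr c hc hcn ⟨hmax.1.trans hc, g1⟩
      · exact hn c (by omega) g1
    have e2 := h.wordHeight_succ_of_rel hmax.1 hmax.2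
    have e3 := h2 (m + 1) (by have := hmax.1; omega) (by omega)
    rw [e2, wordHeight, e1, if_pos (word_fst.2 ⟨i, hmax.1, hmax.2⟩)] at e3
    simp at e3

/-- A word of a partition of the first `N` natural numbers. -/
structure IsClosedWord (W : ℕ → Bool × Bool) (N : ℕ) : Prop where
  pos : ∀ t, (W t).1 = true → 1 ≤ wordHeight W t
  height_eq : wordHeight W N = 0
  eq : ∀ t ≥ N, W t = (false, false)

theorem wordHeight_nonneg {W : ℕ → Bool × Bool} {N : ℕ}
    (h : ∀ t < N, (W t).1 = true → 1 ≤ wordHeight W t) : ∀ t ≤ N, 0 ≤ wordHeight W t := by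
  intro t
  induction t with
  | zero => intro _; exact le_rfl
  | succ t ih =>
    intro ht
    have h1 := ih (by omega)
    have h2 := h t (by omega)
    rw [wordHeight]
    split_ifs with h3 h4 h4
    · omega
    · omega
    · have := h2 h4; omega
    · omega

/-- Partners are found by first and last passage. A continuing letter at `t` is joined to the last
earlier step that rises from below the height at `t`; an opening letter at `t` is joined to the
first later letter after which the path lies below its height at `t + 1`, which exists because the
path ends at `0`. -/
theorem word_ofWord {W : ℕ → Bool × Bool} {N : ℕ} (h : IsClosedWord W N) :
    word (ofWord W) = W := by
  have hnn : ∀ t, 0 ≤ wordHeight W t := fun t =>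
    wordHeight_nonneg (N := t) (fun t _ => h.pos t) t le_rfl
  have hstep : ∀ t, wordHeight W (t + 1) =
      wordHeight W t + (if (W t).2 then 1 else 0) - (if (W t).1 then 1 else 0) := fun _ => rfl
  have h1 : ∀ t, (word (ofWord W) t).1 = true ↔ (W t).1 = true := by
    intro t
    rw [word_fst]
    constructor
    · rintro ⟨i, hi, hit⟩
      exact ((ofWord_iff hi).1 hit).2.1
    · intro ht
      have e1 := h.pos t ht
      classical
      let P : ℕ → Prop := fun c => wordHeight W c < wordHeight W t
      have hP : P 0 := by change (0 : ℤ) < _; omega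
      have hmax := Nat.findGreatest_spec (P := P) (Nat.zero_le t) hP
      have hle : Nat.findGreatest P t ≤ t := Nat.findGreatest_le t
      have hgr : ∀ c, Nat.findGreatest P t < c → c ≤ t → wordHeight W t ≤ wordHeight W c :=
        fun c g1 g2 => not_lt.1 fun g3 => absurd (Nat.le_findGreatest (P := P) g2 g3) (by omega)
      set m := Nat.findGreatest P t
      have hm : wordHeight W m < wordHeight W t := hmax
      have hmt : m < t := by
        rcases hle.lt_or_eq with h' | h'
        · exact h'
        · rw [h'] at hm; omega
      have e2 := hgr (m + 1) (by omega) (by omega)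
      have e3 := hstep m
      have e4 : (W m).2 = true := by
        by_contra h'
        rw [if_neg h'] at e3
        split_ifs at e3 <;> omega
      rw [if_pos e4] at e3
      refine ⟨m, hmt, (ofWord_iff hmt).2 ⟨e4, ht, ?_, fun c g1 g2 => hgr c g1 g2⟩⟩
      split_ifs at e3 <;> omega
  have h2 : ∀ t, (word (ofWord W) t).2 = true ↔ (W t).2 = true := by
    intro t
    rw [word_snd]
    constructor
    · rintro ⟨i, hi, hit⟩
      exact ((ofWord_iff hi).1 hit).1
    · intro ht
      have htN : t < N := by
        by_contra h'
        rw [h.eq t (by omega)] at ht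
        cases ht
      have e1 : 1 ≤ wordHeight W (t + 1) := by
        have g1 := hstep t
        rw [if_pos ht] at g1
        have g2 := hnn t
        have g3 := h.pos t
        split_ifs at g1 with g4
        · have := g3 g4; omega
        · omega
      classical
      have hex : ∃ c, t ≤ c ∧ wordHeight W (c + 1) < wordHeight W (t + 1) := by
        refine ⟨N - 1, by omega, ?_⟩
        have : N - 1 + 1 = N := by omega
        rw [this, h.height_eq]
        omega
      have hspec := Nat.find_spec hex
      have hmin : ∀ c, t ≤ c → c < Nat.find hex → wordHeight W (t + 1) ≤ wordHeight W (c + 1) :=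
        fun c g1 g2 => not_lt.1 fun g3 => Nat.find_min hex g2 ⟨g1, g3⟩
      set m := Nat.find hex
      have htm : t < m := by
        rcases hspec.1.lt_or_eq with h' | h'
        · exact h'
        · rw [← h'] at hspec; omega
      have e2 := hmin (m - 1) (by omega) (by omega)
      have : m - 1 + 1 = m := by omega
      rw [this] at e2
      have e3 := hstep m
      have e4 := hspec.2
      have e5 : (W m).1 = true := by
        by_contra h'
        rw [if_neg h'] at e3
        split_ifs at e3 <;> omega
      rw [if_pos e5] at e3
      have e6 : wordHeight W (t + 1) = wordHeight W m := by split_ifs at e3 <;> omega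
      refine ⟨m, htm, (ofWord_iff htm).2 ⟨ht, e5, e6, fun c g1 g2 => ?_⟩⟩
      have g3 := hmin (c - 1) (by omega) (by omega)
      have : c - 1 + 1 = c := by omega
      rw [this] at g3
      omega
  funext t
  exact Prod.ext (Bool.eq_iff_iff.2 (h1 t)) (Bool.eq_iff_iff.2 (h2 t))

end Noncrossing

/-! ### Planar diagrams as words -/

namespace PartDiag

open Noncrossing

theorem pos_injective {n : ℕ} : Function.Injective (pos (n := n)) := by
  rintro (a | a) (b | b) h <;> simp only [pos, Sum.elim_inl, Sum.elim_inr] at h <;>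
    have h1 := a.2 <;> have h2 := b.2 <;>
    first | (exfalso; omega) | (have : a = b := Fin.ext (by omega)); subst this; rfl

theorem pos_lt {n : ℕ} (x : Fin n ⊕ Fin n) : pos x < 2 * n := by
  rcases x with x | x <;> simp only [pos, Sum.elim_inl, Sum.elim_inr] <;> omega

theorem pos_inl {n : ℕ} (i : Fin n) : pos (Sum.inl i : Fin n ⊕ Fin n) = i := rfl

theorem pos_inr_ge {n : ℕ} (i : Fin n) : n ≤ pos (Sum.inr i : Fin n ⊕ Fin n) := by
  simp only [pos, Sum.elim_inr]; omega

theorem exists_pos_eq {n t : ℕ} (h : t < 2 * n) : ∃ x : Fin n ⊕ Fin n, pos x = t := by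
  by_cases h1 : t < n
  · exact ⟨Sum.inl ⟨t, h1⟩, rfl⟩
  · refine ⟨Sum.inr ⟨2 * n - 1 - t, by omega⟩, ?_⟩
    simp only [pos, Sum.elim_inr]
    omega

theorem pos_swap {n : ℕ} (x : Fin n ⊕ Fin n) : pos x.swap = 2 * n - 1 - pos x := by
  rcases x with x | x
  · rfl
  · simp only [pos, Sum.elim_inl, Sum.elim_inr, Sum.swap_inr]
    omega

/-- A diagram as a partition of the natural numbers, with the points in their cyclic order. -/
def line {n : ℕ} (d : PartDiag n) : Setoid ℕ where
  r a b := a = b ∨ ∃ x y, pos x = a ∧ pos y = b ∧ d x y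
  iseqv :=
    { refl := fun _ => Or.inl rfl
      symm := by
        rintro a b (h | ⟨x, y, hx, hy, h⟩)
        · exact Or.inl h.symm
        · exact Or.inr ⟨y, x, hy, hx, d.symm' h⟩
      trans := by
        rintro a b c (rfl | ⟨x, y, hx, rfl, h⟩) (rfl | ⟨z, w, hz, hw, k⟩)
        · exact Or.inl rfl
        · exact Or.inr ⟨z, w, hz, hw, k⟩
        · exact Or.inr ⟨x, y, hx, rfl, h⟩
        · obtain rfl := pos_injective hz
          exact Or.inr ⟨x, w, hx, hw, d.trans' h k⟩ }

theorem line_pos {n : ℕ} {d : PartDiag n} {x y : Fin n ⊕ Fin n} :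
    line d (pos x) (pos y) ↔ d x y := by
  constructor
  · rintro (h | ⟨a, b, ha, hb, h⟩)
    · rw [pos_injective h]
    · rwa [← pos_injective ha, ← pos_injective hb]
  · exact fun h => Or.inr ⟨x, y, rfl, rfl, h⟩

theorem exists_of_line {n : ℕ} {d : PartDiag n} {a b : ℕ} (h : line d a b) (hab : a ≠ b) :
    ∃ x y, pos x = a ∧ pos y = b ∧ d x y := h.resolve_left hab

theorem planar_iff {n : ℕ} {d : PartDiag n} : Planar d ↔ Noncrossing (line d) := by
  constructor
  · intro h a b c e hab hbc hce hac hbe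
    obtain ⟨w, y, rfl, rfl, hwy⟩ := exists_of_line hac (by omega)
    obtain ⟨x, z, rfl, rfl, hxz⟩ := exists_of_line hbe (by omega)
    exact line_pos.2 (h w x y z hab hbc hce hwy hxz)
  · intro h w x y z hwx hxy hyz hwy hxz
    exact line_pos.1 (h _ _ _ _ hwx hxy hyz (line_pos.2 hwy) (line_pos.2 hxz))

/-- The word of a diagram. -/
noncomputable def letters {n : ℕ} (d : PartDiag n) : ℕ → Bool × Bool := word (line d)

theorem isClosedWord_letters {n : ℕ} (d : PartDiag n) : IsClosedWord (letters d) (2 * n) where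
  pos t ht := by
    rw [letters, wordHeight_word]
    have h1 := (Set.ncard_pos (finite_openBlocks (line d) t)).2 ⟨_, mk_mem_openBlocks.2 ht⟩
    exact_mod_cast h1
  height_eq := by
    have : openBlocks (line d) (2 * n) = ∅ := by
      refine Set.eq_empty_of_forall_notMem ?_
      rintro q ⟨⟨a, ha, rfl⟩, b, hb, hab⟩
      obtain ⟨x, -, rfl, -, -⟩ := exists_of_line (Quotient.exact hab) (by omega)
      have := pos_lt x
      omega
    rw [letters, wordHeight_word, this, Set.ncard_empty]; rfl
  eq t ht := by
    refine Prod.ext ?_ ?_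
    · refine Bool.eq_false_iff.2 fun h => ?_
      obtain ⟨i, hi, hit⟩ := word_fst.1 h
      obtain ⟨-, x, -, rfl, -⟩ := exists_of_line hit (by omega)
      have := pos_lt x
      omega
    · refine Bool.eq_false_iff.2 fun h => ?_
      obtain ⟨i, hi, hit⟩ := word_snd.1 h
      obtain ⟨x, -, rfl, -, -⟩ := exists_of_line hit (by omega)
      have := pos_lt x
      omega

/-- The diagram described by a word. -/
def ofLetters (n : ℕ) (W : ℕ → Bool × Bool) : PartDiag n := Setoid.comap pos (ofWord W)

theorem line_ofLetters {n : ℕ} {W : ℕ → Bool × Bool} (h : IsClosedWord W (2 * n)) :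
    line (ofLetters n W) = ofWord W := by
  have key : ∀ a b, a < b → (line (ofLetters n W) a b ↔ ofWord W a b) := by
    intro a b hab
    constructor
    · intro k
      obtain ⟨x, y, rfl, rfl, h'⟩ := exists_of_line k (by omega)
      exact h'
    · intro k
      have hb : b < 2 * n := by
        by_contra hb
        have h1 := ((ofWord_iff hab).1 k).2.1
        rw [h.eq b (by omega)] at h1
        cases h1
      obtain ⟨x, rfl⟩ := exists_pos_eq (hab.trans hb)
      obtain ⟨y, rfl⟩ := exists_pos_eq hb
      exact line_pos.2 k
  ext a b
  rcases lt_trichotomy a b with hab | rfl | hab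
  · exact key a b hab
  · exact ⟨fun _ => Setoid.refl' _ _, fun _ => Setoid.refl' _ _⟩
  · exact ⟨fun k => Setoid.symm' _ ((key b a hab).1 (Setoid.symm' _ k)),
      fun k => Setoid.symm' _ ((key b a hab).2 (Setoid.symm' _ k))⟩

theorem letters_ofLetters {n : ℕ} {W : ℕ → Bool × Bool} (h : IsClosedWord W (2 * n)) :
    letters (ofLetters n W) = W := by
  rw [letters, line_ofLetters h, word_ofWord h]

theorem planar_ofLetters {n : ℕ} {W : ℕ → Bool × Bool} (h : IsClosedWord W (2 * n)) :
    Planar (ofLetters n W) := by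
  rw [planar_iff, line_ofLetters h]
  exact noncrossing_ofWord W

theorem Planar.ext {n : ℕ} {d e : PartDiag n} (hd : Planar d) (he : Planar e)
    (h : letters d = letters e) : d = e := by
  have h1 := word_injective (planar_iff.1 hd) (planar_iff.1 he) h
  ext x y
  rw [← line_pos, h1, line_pos]

/-- The bottom points occupy the positions before `n` and the top points those from `n` on, so the
blocks open at time `n` are the through strands. -/
theorem through_eq_wordHeight {n : ℕ} (d : PartDiag n) :
    (through d : ℤ) = wordHeight (letters d) n := by
  rw [letters, wordHeight_word]
  norm_cast
  let φ : {q : Quotient d // (∃ i, Quotient.mk d (Sum.inl i) = q) ∧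
      ∃ i, Quotient.mk d (Sum.inr i) = q} → openBlocks (line d) n := fun q =>
    ⟨Quotient.lift (fun x => Quotient.mk (line d) (pos x))
      (fun x y h => Quotient.sound (line_pos.2 h)) q.1, by
      obtain ⟨q, ⟨i, rfl⟩, ⟨j, hj⟩⟩ := q
      refine ⟨⟨i, i.2, rfl⟩, pos (Sum.inr j), pos_inr_ge j, ?_⟩
      exact Quotient.sound (line_pos.2 (Quotient.exact hj))⟩
  refine Nat.card_congr (Equiv.ofBijective φ ⟨?_, ?_⟩)
  · rintro ⟨p, hp⟩ ⟨q, hq⟩ h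
    have h' := congrArg Subtype.val h
    induction p using Quotient.inductionOn
    induction q using Quotient.inductionOn
    exact Subtype.ext (Quotient.sound (line_pos.1 (Quotient.exact (s := line d) h')))
  · rintro ⟨q, ⟨a, ha, rfl⟩, b, hb, hab⟩
    obtain ⟨y, x, rfl, rfl, h⟩ := exists_of_line (Quotient.exact hab) (by omega)
    have hx : ∃ i, x = Sum.inl i := by
      rcases x with x | x
      · exact ⟨x, rfl⟩
      · have := pos_inr_ge x; omega
    have hy : ∃ i, y = Sum.inr i := by
      rcases y with y | y
      · rw [pos_inl] at hb; omega
      · exact ⟨y, rfl⟩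
    obtain ⟨i, rfl⟩ := hx
    obtain ⟨j, rfl⟩ := hy
    exact ⟨⟨Quotient.mk d (Sum.inl i), ⟨i, rfl⟩, ⟨j, Quotient.sound h⟩⟩, Subtype.ext rfl⟩

theorem mem_half_iff {n : ℕ} {d : PartDiag n} {i : Fin n} :
    i ∈ (half d).2 ↔ ∃ j ≥ n, line d i j := by
  constructor
  · rintro ⟨j, hj⟩
    exact ⟨pos (Sum.inr j), pos_inr_ge j, line_pos.2 hj⟩
  · rintro ⟨j, hj, hij⟩
    obtain ⟨x, y, hx, rfl, h⟩ := exists_of_line hij (by omega)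
    rw [← pos_inl i] at hx
    obtain rfl := pos_injective hx
    rcases y with y | y
    · rw [pos_inl] at hj; omega
    · exact ⟨y, h⟩

/-- By `rel_iff` a connection between two bottom points is seen in the letters up to the later one,
and by `reaches_iff` a connection to the top is seen in the first `n` letters. -/
theorem half_eq_of_letters {n : ℕ} {d e : PartDiag n} (hd : Planar d) (he : Planar e)
    (h : ∀ t < n, letters d t = letters e t) : half d = half e := by
  have hd' := planar_iff.1 hd
  have he' := planar_iff.1 he
  have key : ∀ i j : Fin n, i < j → (d (Sum.inl i) (Sum.inl j) ↔ e (Sum.inl i) (Sum.inl j)) := by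
    intro i j hij
    rw [← line_pos, ← line_pos, pos_inl, pos_inl, hd'.rel_iff hij, he'.rel_iff hij]
    exact WordRel.congr h hij j.2
  refine half_eq (fun i j => ?_) (fun i => ?_)
  · rcases lt_trichotomy i j with hij | rfl | hij
    · exact key i j hij
    · exact ⟨fun _ => e.refl' _, fun _ => d.refl' _⟩
    · exact ⟨fun k => e.symm' ((key j i hij).1 (d.symm' k)),
        fun k => d.symm' ((key j i hij).2 (e.symm' k))⟩
  · rw [← mem_half, ← mem_half, mem_half_iff, mem_half_iff, hd'.reaches_iff i.2,
      he'.reaches_iff i.2]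
    have h1 := wordHeight_congr h
    have h2 := h i i.2
    unfold letters at h1 h2
    rw [h2, h1 (i + 1) i.2]
    refine and_congr_right fun _ => forall_congr' fun t => imp_congr_right fun _ =>
      forall_congr' fun ht => ?_
    rw [h1 t ht]

theorem letters_eq_of_half {n : ℕ} {d e : PartDiag n} (h : half d = half e) {t : ℕ} (ht : t < n) :
    letters d t = letters e t := by
  have h1 : ∀ i j, i < n → j < n → (line d i j ↔ line e i j) := by
    intro i j hi hj
    have h2 : (half d).1 ⟨i, hi⟩ ⟨j, hj⟩ ↔ (half e).1 ⟨i, hi⟩ ⟨j, hj⟩ := by rw [h]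
    rw [half_fst, half_fst, ← line_pos, ← line_pos] at h2
    exact h2
  have h2 : (∃ j ≥ n, line d t j) ↔ ∃ j ≥ n, line e t j := by
    rw [← mem_half_iff (i := ⟨t, ht⟩), ← mem_half_iff (i := ⟨t, ht⟩), h]
  have h3 : ∀ f : PartDiag n, (∃ j > t, line f t j) ↔
      (∃ j > t, j < n ∧ line f t j) ∨ ∃ j ≥ n, line f t j := by
    intro f
    constructor
    · rintro ⟨j, hj, k⟩
      by_cases hjn : j < n
      · exact Or.inl ⟨j, hj, hjn, k⟩
      · exact Or.inr ⟨j, by omega, k⟩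
    · rintro (⟨j, hj, -, k⟩ | ⟨j, hj, k⟩)
      · exact ⟨j, hj, k⟩
      · exact ⟨j, by omega, k⟩
  refine Prod.ext (Bool.eq_iff_iff.2 ?_) (Bool.eq_iff_iff.2 ?_)
  · rw [letters, letters, word_fst, word_fst]
    refine exists_congr fun i => and_congr_right fun hi => h1 i t (by omega) ht
  · rw [letters, letters, word_snd, word_snd, h3, h3, h2]
    refine or_congr_left (exists_congr fun j => and_congr_right fun _ => and_congr_right fun hj =>
      h1 t j ht hj)

theorem letters_flip {n : ℕ} (d : PartDiag n) {t : ℕ} (ht : t < 2 * n) :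
    letters (flip d) t = (letters d (2 * n - 1 - t)).swap := by
  have key : ∀ a b, a < 2 * n → b < 2 * n →
      (line (flip d) a b ↔ line d (2 * n - 1 - a) (2 * n - 1 - b)) := by
    intro a b ha hb
    obtain ⟨x, rfl⟩ := exists_pos_eq ha
    obtain ⟨y, rfl⟩ := exists_pos_eq hb
    rw [← pos_swap, ← pos_swap, line_pos, line_pos, flip_apply]
  have hlt : ∀ (e : PartDiag n) {a b : ℕ}, a ≠ b → line e a b → a < 2 * n ∧ b < 2 * n := by
    intro e a b hab h
    obtain ⟨x, y, rfl, rfl, -⟩ := exists_of_line h hab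
    exact ⟨pos_lt x, pos_lt y⟩
  refine Prod.ext (Bool.eq_iff_iff.2 ?_) (Bool.eq_iff_iff.2 ?_)
  · rw [Prod.fst_swap, letters, letters, word_fst, word_snd]
    constructor
    · rintro ⟨i, hi, k⟩
      rw [key i t (by omega) ht] at k
      exact ⟨2 * n - 1 - i, by omega, Setoid.symm' _ k⟩
    · rintro ⟨j, hj, k⟩
      have h1 := hlt d (by omega) k
      refine ⟨2 * n - 1 - j, by omega, (key _ t (by omega) ht).2 ?_⟩
      rw [show 2 * n - 1 - (2 * n - 1 - j) = j by omega]
      exact Setoid.symm' _ k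
  · rw [Prod.snd_swap, letters, letters, word_fst, word_snd]
    constructor
    · rintro ⟨i, hi, k⟩
      have h1 := hlt (flip d) (by omega) k
      rw [key t i ht h1.2] at k
      exact ⟨2 * n - 1 - i, by omega, Setoid.symm' _ k⟩
    · rintro ⟨j, hj, k⟩
      refine ⟨2 * n - 1 - j, by omega, (key t _ ht (by omega)).2 ?_⟩
      rw [show 2 * n - 1 - (2 * n - 1 - j) = j by omega]
      exact Setoid.symm' _ k

theorem Planar.flip {n : ℕ} {d : PartDiag n} (h : Planar d) : Planar (flip d) := by
  intro w x y z hwx hxy hyz hwy hxz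
  rw [flip_apply] at *
  have h1 : ∀ {a b : Fin n ⊕ Fin n}, pos a < pos b → pos b.swap < pos a.swap := by
    intro a b hab
    rw [pos_swap, pos_swap]
    have := pos_lt b
    omega
  have h2 := h _ _ _ _ (h1 hyz) (h1 hxy) (h1 hwx) (d.symm' hxz) (d.symm' hwy)
  exact d.trans' hwy (d.trans' (d.symm' h2) (d.symm' hxz))

/-- The planar diagrams all of whose letters, read from the bottom for the bottom points and from
the top for the top points, are allowed by `Q`. -/
structure HasLetters {n : ℕ} (Q : Bool → Bool → Prop) (d : PartDiag n) : Prop where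
  planar : Planar d
  bottom : ∀ t < n, Q (letters d t).1 (letters d t).2
  top : ∀ t, n ≤ t → t < 2 * n → Q (letters d t).2 (letters d t).1

theorem HasLetters.flip {n : ℕ} {Q : Bool → Bool → Prop} {d : PartDiag n} (h : HasLetters Q d) :
    HasLetters Q (flip d) where
  planar := h.planar.flip
  bottom t ht := by
    rw [letters_flip d (by omega)]
    exact h.top _ (by omega) (by omega)
  top t ht ht' := by
    rw [letters_flip d (by omega)]
    exact h.bottom _ (by omega)

/-- The lower half gives the first `n` letters; by `letters_flip` the upper half gives the remaining
ones, in reverse order and with their bits exchanged. -/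
theorem Planar.ext_half {n : ℕ} {d e : PartDiag n} (hd : Planar d) (he : Planar e)
    (h : half d = half e) (h' : half (PartDiag.flip d) = half (PartDiag.flip e)) : d = e := by
  refine hd.ext he (funext fun t => ?_)
  by_cases h1 : t < n
  · exact letters_eq_of_half h h1
  by_cases h2 : t < 2 * n
  · have h3 := letters_eq_of_half h' (t := 2 * n - 1 - t) (by omega)
    rw [letters_flip d (by omega), letters_flip e (by omega),
      show 2 * n - 1 - (2 * n - 1 - t) = t by omega] at h3
    exact Prod.swap_injective h3
  · rw [(isClosedWord_letters d).eq t (by omega), (isClosedWord_letters e).eq t (by omega)]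

theorem wordHeight_eq_of_ge {W W' : ℕ → Bool × Bool} {n : ℕ}
    (h0 : wordHeight W n = wordHeight W' n) (h : ∀ t ≥ n, W t = W' t) :
    ∀ t ≥ n, wordHeight W t = wordHeight W' t := by
  intro t ht
  induction t, ht using Nat.le_induction with
  | base => exact h0
  | succ t ht ih => rw [wordHeight, wordHeight, ih, h t ht]

/-- Any two halves with the same number of through strands fit together. -/
theorem HasLetters.exists_splice {n : ℕ} {Q : Bool → Bool → Prop} {d e : PartDiag n}
    (hd : HasLetters Q d) (he : HasLetters Q e) (h : through d = through e) :
    ∃ f, HasLetters Q f ∧ half f = half d ∧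
      half (PartDiag.flip f) = half (PartDiag.flip e) := by
  have cd := isClosedWord_letters d
  have ce := isClosedWord_letters e
  -- The first half of the path of `d` is continued by the second half of the path of `e`; both are
  -- at height `through d = through e` at time `n`.
  let W : ℕ → Bool × Bool := fun t => if t < n then letters d t else letters e t
  have hW1 : ∀ t < n, W t = letters d t := fun t ht => if_pos ht
  have hW2 : ∀ t ≥ n, W t = letters e t := fun t ht => if_neg (by omega)
  have hh1 := wordHeight_congr hW1
  have hh2 := wordHeight_eq_of_ge (W := W) (W' := letters e) (n := n)
    (by rw [hh1 n le_rfl, ← through_eq_wordHeight, ← through_eq_wordHeight, h]) hW2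
  have cW : IsClosedWord W (2 * n) := by
    refine ⟨fun t ht => ?_, ?_, fun t ht => ?_⟩
    · by_cases htn : t < n
      · rw [hW1 t htn] at ht
        rw [hh1 t htn.le]
        exact cd.pos t ht
      · rw [hW2 t (by omega)] at ht
        rw [hh2 t (by omega)]
        exact ce.pos t ht
    · rw [hh2 _ (by omega), ce.height_eq]
    · rw [hW2 t (by omega), ce.eq t ht]
  have hl := letters_ofLetters cW
  have hp := planar_ofLetters cW
  refine ⟨ofLetters n W, ⟨hp, fun t ht => ?_, fun t ht ht' => ?_⟩, ?_, ?_⟩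
  · rw [hl, hW1 t ht]; exact hd.bottom t ht
  · rw [hl, hW2 t ht]; exact he.top t ht ht'
  · refine half_eq_of_letters hp hd.planar fun t ht => ?_
    rw [hl, hW1 t ht]
  · refine half_eq_of_letters hp.flip he.planar.flip fun t ht => ?_
    rw [letters_flip _ (by omega), letters_flip _ (by omega), hl, hW2 _ (by omega)]

/-! ### Counting half diagrams -/

/-- The words of length `n` in the letters allowed by `Q` that describe a half diagram with `k`
through strands. -/
def halfWords (Q : Bool → Bool → Prop) (n k : ℕ) : Set (ℕ → Bool × Bool) :=
  {W | (∀ t < n, Q (W t).1 (W t).2) ∧ (∀ t < n, (W t).1 = true → 1 ≤ wordHeight W t) ∧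
    wordHeight W n = k ∧ ∀ t ≥ n, W t = (false, false)}

/-- The first `n` letters of a word. -/
def truncate (n : ℕ) (W : ℕ → Bool × Bool) (t : ℕ) : Bool × Bool :=
  if t < n then W t else (false, false)

theorem truncate_of_lt {n t : ℕ} (W : ℕ → Bool × Bool) (h : t < n) : truncate n W t = W t :=
  if_pos h

/-- A half word is completed by its mirror image, read backwards with the two bits exchanged, so
that the path descends symmetrically to `0`. -/
theorem exists_of_mem_halfWords {Q : Bool → Bool → Prop} {n k : ℕ} {W : ℕ → Bool × Bool}
    (h : W ∈ halfWords Q n k) :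
    ∃ d : PartDiag n, HasLetters Q d ∧ through d = k ∧ truncate n (letters d) = W := by
  obtain ⟨h1, h2, h3, h4⟩ := h
  let V : ℕ → Bool × Bool := fun t =>
    if t < n then W t else if t < 2 * n then (W (2 * n - 1 - t)).swap else (false, false)
  have hV1 : ∀ t < n, V t = W t := fun t ht => if_pos ht
  have hV2 : ∀ t, n ≤ t → t < 2 * n → V t = (W (2 * n - 1 - t)).swap := fun t ht ht' => by
    simp only [V]
    rw [if_neg (by omega), if_pos ht']
  have hV3 : ∀ t ≥ 2 * n, V t = (false, false) := fun t ht => by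
    simp only [V]
    rw [if_neg (by omega), if_neg (by omega)]
  have hh1 := wordHeight_congr hV1
  have hstep : ∀ t, wordHeight W (t + 1) =
      wordHeight W t + (if (W t).2 then 1 else 0) - (if (W t).1 then 1 else 0) := fun _ => rfl
  have hh2 : ∀ j ≤ n, wordHeight V (n + j) = wordHeight W (n - j) := by
    intro j
    induction j with
    | zero => intro _; exact hh1 n le_rfl
    | succ j ih =>
      intro hj
      have e1 := hstep (n - (j + 1))
      rw [show n - (j + 1) + 1 = n - j by omega] at e1
      rw [← add_assoc, wordHeight, ih (by omega), hV2 _ (by omega) (by omega), e1,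
        show 2 * n - 1 - (n + j) = n - (j + 1) by omega, Prod.fst_swap, Prod.snd_swap]
      ring
  have cV : IsClosedWord V (2 * n) := by
    refine ⟨fun t ht => ?_, ?_, hV3⟩
    · by_cases htn : t < n
      · rw [hV1 t htn] at ht
        rw [hh1 t htn.le]
        exact h2 t htn ht
      by_cases htn' : t < 2 * n
      · rw [hV2 t (by omega) htn', Prod.fst_swap] at ht
        have e1 := hh2 (t - n) (by omega)
        have e2 := hstep (2 * n - 1 - t)
        have e3 := wordHeight_nonneg h2 (2 * n - 1 - t) (by omega)
        have e4 := h2 (2 * n - 1 - t) (by omega)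
        rw [show n + (t - n) = t by omega, show n - (t - n) = 2 * n - 1 - t + 1 by omega] at e1
        rw [e1, e2, if_pos ht]
        split_ifs with h'
        · have := e4 h'; omega
        · omega
      · rw [hV3 t (by omega)] at ht
        cases ht
    · have := hh2 n le_rfl
      rw [show n + n = 2 * n by ring, Nat.sub_self] at this
      exact this
  have hl := letters_ofLetters cV
  refine ⟨ofLetters n V, ⟨planar_ofLetters cV, fun t ht => ?_, fun t ht ht' => ?_⟩, ?_, ?_⟩
  · rw [hl, hV1 t ht]; exact h1 t ht
  · rw [hl, hV2 t ht ht']; exact h1 _ (by omega)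
  · have := through_eq_wordHeight (ofLetters n V)
    rw [hl, hh1 n le_rfl, h3] at this
    exact_mod_cast this
  · funext t
    rw [hl]
    by_cases ht : t < n
    · rw [truncate_of_lt _ ht, hV1 t ht]
    · rw [h4 t (by omega)]
      exact if_neg ht

theorem truncate_mem_halfWords {Q : Bool → Bool → Prop} {n k : ℕ} {d : PartDiag n}
    (h : HasLetters Q d) (hk : through d = k) : truncate n (letters d) ∈ halfWords Q n k := by
  have h0 : ∀ t < n, truncate n (letters d) t = letters d t := fun t => truncate_of_lt _
  have h1 := wordHeight_congr h0
  refine ⟨fun t ht => ?_, fun t ht k => ?_, ?_, fun t ht => if_neg (by omega)⟩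
  · rw [h0 t ht]; exact h.bottom t ht
  · rw [h0 t ht] at k
    rw [h1 t ht.le]
    exact (isClosedWord_letters d).pos t k
  · rw [h1 n le_rfl, ← through_eq_wordHeight, hk]

theorem ncard_image_eq_ncard_image {α β γ : Type*} {f : α → β} {g : α → γ} {D : Set α}
    (h : ∀ x ∈ D, ∀ y ∈ D, f x = f y ↔ g x = g y) : (f '' D).ncard = (g '' D).ncard := by
  rcases isEmpty_or_nonempty α with hα | hα
  · have : D = ∅ := Set.eq_empty_of_isEmpty D
    simp [this]
  have h1 : (fun z => g (Function.invFunOn f D z)) '' (f '' D) = g '' D := by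
    rw [Set.image_image]
    refine Set.image_congr fun x hx => ?_
    have hm : ∃ a ∈ D, f a = f x := ⟨x, hx, rfl⟩
    exact (h _ (Function.invFunOn_mem hm) _ hx).1 (Function.invFunOn_eq hm)
  symm
  rw [← h1]
  refine Set.InjOn.ncard_image ?_
  rintro _ ⟨x, hx, rfl⟩ _ ⟨y, hy, rfl⟩ hxy
  have hx' : ∃ a ∈ D, f a = f x := ⟨x, hx, rfl⟩
  have hy' : ∃ a ∈ D, f a = f y := ⟨y, hy, rfl⟩
  have h2 := (h _ (Function.invFunOn_mem hx') _ (Function.invFunOn_mem hy')).2 hxy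
  rwa [Function.invFunOn_eq hx', Function.invFunOn_eq hy'] at h2

theorem ncard_halves {n : ℕ} (Q : Bool → Bool → Prop) (k : ℕ) :
    (half '' {d : PartDiag n | HasLetters Q d ∧ through d = k}).ncard
      = (halfWords Q n k).ncard := by
  rw [ncard_image_eq_ncard_image (g := fun d => truncate n (letters d))]
  · congr 1
    ext W
    constructor
    · rintro ⟨d, ⟨h, hk⟩, rfl⟩
      exact truncate_mem_halfWords h hk
    · intro h
      obtain ⟨d, h1, h2, h3⟩ := exists_of_mem_halfWords h
      exact ⟨d, ⟨h1, h2⟩, h3⟩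
  · rintro d ⟨hd, -⟩ e ⟨he, -⟩
    constructor
    · intro h
      funext t
      by_cases ht : t < n
      · rw [truncate_of_lt _ ht, truncate_of_lt _ ht, letters_eq_of_half h ht]
      · exact (if_neg ht).trans (if_neg ht).symm
    · intro h
      refine half_eq_of_letters hd.planar he.planar fun t ht => ?_
      have := congrFun h t
      rwa [truncate_of_lt _ ht, truncate_of_lt _ ht] at this

/-- The number of half diagrams, by recursion on the number of points. -/
def countHalves (Q : Bool → Bool → Prop) [∀ p s, Decidable (Q p s)] : ℕ → ℕ → ℕ
  | 0, k => if k = 0 then 1 else 0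
  | n + 1, k => (if Q false false then countHalves Q n k else 0) +
      (if Q true true ∧ 1 ≤ k then countHalves Q n k else 0) +
      (if Q false true ∧ 1 ≤ k then countHalves Q n (k - 1) else 0) +
      (if Q true false then countHalves Q n (k + 1) else 0)

/-- Words are sorted by their last letter; `k'` is the height before it. With `encard` the four
cases can be added by disjointness alone, and finiteness follows from the result. -/
theorem encard_halfWords_succ (Q : Bool → Bool → Prop) (n k k' : ℕ) (p s : Bool) (hQ : Q p s)
    (hk : (k : ℤ) = k' + (if s then 1 else 0) - (if p then 1 else 0))
    (hp : p = true → 1 ≤ k') :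
    (halfWords Q (n + 1) k ∩ {W | W n = (p, s)}).encard = (halfWords Q n k').encard := by
  have himg : halfWords Q (n + 1) k ∩ {W | W n = (p, s)} =
      (fun W => Function.update W n (p, s)) '' halfWords Q n k' := by
    ext W
    constructor
    · rintro ⟨⟨h1, h2, h3, h4⟩, h5⟩
      have h5' : W n = (p, s) := h5
      have e0 : ∀ t < n, Function.update W n (false, false) t = W t := fun t ht =>
        Function.update_of_ne (by omega) _ _
      have e1 := wordHeight_congr e0
      refine ⟨Function.update W n (false, false), ⟨fun t ht => ?_, fun t ht => ?_, ?_,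
        fun t ht => ?_⟩, ?_⟩
      · rw [e0 t ht]; exact h1 t (by omega)
      · rw [e0 t ht, e1 t ht.le]; exact h2 t (by omega)
      · rw [e1 n le_rfl]
        rw [wordHeight, h5'] at h3
        simp only at h3
        omega
      · by_cases htn : t = n
        · subst htn; exact Function.update_self _ _ _
        · rw [Function.update_of_ne htn]; exact h4 t (by omega)
      · simp only [Function.update_idem]
        rw [← h5', Function.update_eq_self]
    · rintro ⟨V, ⟨h1, h2, h3, h4⟩, rfl⟩
      have e0 : ∀ t < n, Function.update V n (p, s) t = V t := fun t ht =>
        Function.update_of_ne (by omega) _ _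
      have e1 := wordHeight_congr e0
      have e2 : Function.update V n (p, s) n = (p, s) := Function.update_self _ _ _
      change Function.update V n (p, s) ∈ _
      refine ⟨⟨fun t ht => ?_, fun t ht => ?_, ?_, fun t ht => ?_⟩, e2⟩
      · rcases Nat.lt_succ_iff_lt_or_eq.1 ht with h | rfl
        · rw [e0 t h]; exact h1 t h
        · rw [e2]; exact hQ
      · rcases Nat.lt_succ_iff_lt_or_eq.1 ht with h | rfl
        · rw [e0 t h, e1 t h.le]; exact h2 t h
        · rw [e2, e1 t le_rfl, h3]
          intro h
          exact_mod_cast hp h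
      · rw [wordHeight, e2, e1 n le_rfl, h3, hk]
      · rw [Function.update_of_ne (by omega)]; exact h4 t (by omega)
  rw [himg, Set.InjOn.encard_image]
  rintro V ⟨-, -, -, hV⟩ V' ⟨-, -, -, hV'⟩ h
  funext t
  by_cases ht : t = n
  · subst ht; rw [hV t le_rfl, hV' t le_rfl]
  · have := congrFun h t
    simp only at this
    rwa [Function.update_of_ne ht, Function.update_of_ne ht] at this

theorem halfWords_inter_eq_empty (Q : Bool → Bool → Prop) (n k : ℕ) (p s : Bool)
    (h : ∀ k' : ℕ, Q p s → (k : ℤ) = k' + (if s then 1 else 0) - (if p then 1 else 0) →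
      ¬ (p = true → 1 ≤ k')) :
    (halfWords Q (n + 1) k ∩ {W | W n = (p, s)}).encard = 0 := by
  rw [Set.encard_eq_zero]
  refine Set.eq_empty_of_forall_notMem ?_
  rintro W ⟨⟨h1, h2, h3, h4⟩, h5⟩
  have h5' : W n = (p, s) := h5
  have h6 := wordHeight_nonneg h2 n (by omega)
  have h7 := h1 n (by omega)
  have h8 := h2 n (by omega)
  rw [wordHeight, h5'] at h3
  rw [h5'] at h7 h8
  refine h (wordHeight W n).toNat h7 ?_ ?_
  · rw [Int.toNat_of_nonneg h6]; exact h3.symm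
  · intro hp
    have := h8 hp
    omega

theorem encard_halfWords (Q : Bool → Bool → Prop) [∀ p s, Decidable (Q p s)] (n k : ℕ) :
    (halfWords Q n k).encard = countHalves Q n k := by
  induction n generalizing k with
  | zero =>
    by_cases hk : k = 0
    · subst hk
      have : halfWords Q 0 0 = {fun _ => (false, false)} := by
        ext W
        constructor
        · rintro ⟨-, -, -, h⟩
          exact funext fun t => h t (Nat.zero_le t)
        · rintro rfl
          exact ⟨fun t ht => by omega, fun t ht => by omega, rfl, fun _ _ => rfl⟩
      rw [this, Set.encard_singleton]; rfl
    · have : halfWords Q 0 k = ∅ := by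
        refine Set.eq_empty_of_forall_notMem ?_
        rintro W ⟨-, -, h, -⟩
        have h' : (0 : ℤ) = k := h
        omega
      rw [this, Set.encard_empty]
      simp [countHalves, hk]
  | succ n ih =>
    let A : Bool → Bool → Set (ℕ → Bool × Bool) := fun p s =>
      halfWords Q (n + 1) k ∩ {W | W n = (p, s)}
    have hA : halfWords Q (n + 1) k =
        ((A false false ∪ A true true) ∪ A false true) ∪ A true false := by
      ext W
      constructor
      · intro h
        rcases hp : (W n).1 with _ | _ <;> rcases hs : (W n).2 with _ | _
        · exact Or.inl (Or.inl (Or.inl ⟨h, Prod.ext hp hs⟩))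
        · exact Or.inl (Or.inr ⟨h, Prod.ext hp hs⟩)
        · exact Or.inr ⟨h, Prod.ext hp hs⟩
        · exact Or.inl (Or.inl (Or.inr ⟨h, Prod.ext hp hs⟩))
      · rintro (((h | h) | h) | h) <;> exact h.1
    have hdis : ∀ p s p' s', (p, s) ≠ (p', s') → Disjoint (A p s) (A p' s') := by
      intro p s p' s' hne
      rw [Set.disjoint_left]
      rintro W ⟨-, h⟩ ⟨-, h'⟩
      exact hne (Eq.trans (Eq.symm h) h')
    rw [hA, Set.encard_union_eq, Set.encard_union_eq, Set.encard_union_eq]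
    · have e1 : (A false false).encard = (if Q false false then countHalves Q n k else 0 : ℕ) := by
        split_ifs with h
        · rw [← ih]
          exact encard_halfWords_succ Q n k k _ _ h (by simp) (by simp)
        · exact halfWords_inter_eq_empty Q n k _ _ fun k' h' => (h h').elim
      have e2 : (A true true).encard =
          (if Q true true ∧ 1 ≤ k then countHalves Q n k else 0 : ℕ) := by
        split_ifs with h
        · rw [← ih]
          exact encard_halfWords_succ Q n k k _ _ h.1 (by simp) (fun _ => h.2)
        · refine halfWords_inter_eq_empty Q n k _ _ fun k' h' h'' hp => h ⟨h', ?_⟩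
          have := hp rfl
          simp at h''
          omega
      have e3 : (A false true).encard =
          (if Q false true ∧ 1 ≤ k then countHalves Q n (k - 1) else 0 : ℕ) := by
        split_ifs with h
        · rw [← ih]
          exact encard_halfWords_succ Q n k (k - 1) _ _ h.1 (by simp; omega) (by simp)
        · refine halfWords_inter_eq_empty Q n k _ _ fun k' h' h'' hp => h ⟨h', ?_⟩
          simp at h''
          omega
      have e4 : (A true false).encard =
          (if Q true false then countHalves Q n (k + 1) else 0 : ℕ) := by
        split_ifs with h
        · rw [← ih]
          exact encard_halfWords_succ Q n k (k + 1) _ _ h (by simp) (by omega)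
        · exact halfWords_inter_eq_empty Q n k _ _ fun k' h' => (h h').elim
      rw [e1, e2, e3, e4, countHalves]
      push_cast
      rfl
    · exact hdis _ _ _ _ (by decide)
    · exact Set.disjoint_union_left.2 ⟨hdis _ _ _ _ (by decide), hdis _ _ _ _ (by decide)⟩
    · refine Set.disjoint_union_left.2 ⟨Set.disjoint_union_left.2
        ⟨hdis _ _ _ _ (by decide), hdis _ _ _ _ (by decide)⟩, hdis _ _ _ _ (by decide)⟩

theorem ncard_halves_eq_count {n : ℕ} (Q : Bool → Bool → Prop) [∀ p s, Decidable (Q p s)] (k : ℕ) :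
    (half '' {d : PartDiag n | HasLetters Q d ∧ through d = k}).ncard = countHalves Q n k := by
  rw [ncard_halves, Set.ncard, encard_halfWords]
  rfl

end PartDiag

/-! ### The four classes in terms of letters -/

namespace PartDiag

open Noncrossing

theorem letters_fst {n : ℕ} {d : PartDiag n} {x : Fin n ⊕ Fin n} :
    (letters d (pos x)).1 = true ↔ ∃ y, pos y < pos x ∧ d y x := by
  rw [letters, word_fst]
  constructor
  · rintro ⟨i, hi, h⟩
    obtain ⟨y, z, rfl, hz, k⟩ := exists_of_line h (by omega)
    exact ⟨y, hi, line_pos.1 h⟩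
  · rintro ⟨y, hy, h⟩
    exact ⟨pos y, hy, line_pos.2 h⟩

theorem letters_snd {n : ℕ} {d : PartDiag n} {x : Fin n ⊕ Fin n} :
    (letters d (pos x)).2 = true ↔ ∃ y, pos x < pos y ∧ d x y := by
  rw [letters, word_snd]
  constructor
  · rintro ⟨i, hi, h⟩
    obtain ⟨z, y, hz, rfl, k⟩ := exists_of_line h (by omega)
    exact ⟨y, hi, line_pos.1 h⟩
  · rintro ⟨y, hy, h⟩
    exact ⟨pos y, hy, line_pos.2 h⟩

/-- Of three points of a block the middle one has both an earlier and a later partner. -/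
theorem small_iff {n : ℕ} {d : PartDiag n} : Small d ↔
    ∀ t < 2 * n, ¬ ((letters d t).1 = true ∧ (letters d t).2 = true) := by
  have hne : ∀ {x y : Fin n ⊕ Fin n}, pos x < pos y → x ≠ y := fun h k => by
    rw [k] at h; exact h.false
  constructor
  · rintro h t ht ⟨h1, h2⟩
    obtain ⟨x, rfl⟩ := exists_pos_eq ht
    obtain ⟨y, hy, hyx⟩ := letters_fst.1 h1
    obtain ⟨z, hz, hxz⟩ := letters_snd.1 h2
    exact h x y z (hne hy).symm (hne hz) (hne (hy.trans hz)) (d.symm' hyx) hxz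
  · intro h
    have key : ∀ x y z, pos x < pos y → pos y < pos z → d x y → d y z → False :=
      fun x y z hxy hyz k l =>
        h _ (pos_lt y) ⟨letters_fst.2 ⟨x, hxy, k⟩, letters_snd.2 ⟨z, hyz, l⟩⟩
    intro a b c hab hac hbc kab kac
    have kbc := d.trans' (d.symm' kab) kac
    have hab' := pos_injective.ne hab
    have hac' := pos_injective.ne hac
    have hbc' := pos_injective.ne hbc
    rcases hab'.lt_or_gt with g1 | g1 <;> rcases hac'.lt_or_gt with g2 | g2 <;>
      rcases hbc'.lt_or_gt with g3 | g3
    · exact key a b c g1 g3 kab kbc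
    · exact key a c b g2 g3 kac (d.symm' kbc)
    · omega
    · exact key c a b g2 g1 (d.symm' kac) kab
    · exact key b a c g1 g2 (d.symm' kab) kac
    · omega
    · exact key b c a g3 g2 kbc (d.symm' kac)
    · exact key c b a g3 g1 (d.symm' kbc) (d.symm' kab)

theorem paired_iff {n : ℕ} {d : PartDiag n} : Paired d ↔
    ∀ t < 2 * n, (letters d t).1 = true ∨ (letters d t).2 = true := by
  constructor
  · intro h t ht
    obtain ⟨x, rfl⟩ := exists_pos_eq ht
    obtain ⟨y, hy, hxy⟩ := h x
    rcases (pos_injective.ne hy).lt_or_gt with g | g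
    · exact Or.inl (letters_fst.2 ⟨y, g, d.symm' hxy⟩)
    · exact Or.inr (letters_snd.2 ⟨y, g, hxy⟩)
  · intro h x
    rcases h _ (pos_lt x) with g | g
    · obtain ⟨y, hy, hyx⟩ := letters_fst.1 g
      exact ⟨y, fun k => by rw [k] at hy; exact hy.false, d.symm' hyx⟩
    · obtain ⟨y, hy, hyx⟩ := letters_snd.1 g
      exact ⟨y, fun k => by rw [k] at hy; exact hy.false, hyx⟩

theorem rook_iff {n : ℕ} {d : PartDiag n} : Rook d ↔
    (∀ i j, d (Sum.inl i) (Sum.inl j) → i = j) ∧ ∀ i j, d (Sum.inr i) (Sum.inr j) → i = j := by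
  constructor
  · intro h
    exact ⟨fun i j k => Sum.inl_injective (h _ _ rfl k),
      fun i j k => Sum.inr_injective (h _ _ rfl k)⟩
  · rintro ⟨h1, h2⟩ (a | a) (b | b) hab k
    · rw [h1 a b k]
    · cases hab
    · cases hab
    · rw [h2 a b k]

theorem isPRo_iff_rook {n : ℕ} {d : PartDiag n} : IsPRo d ↔ Planar d ∧ Rook d := by
  rw [rook_iff]; rfl

theorem isMo_iff_small {n : ℕ} {d : PartDiag n} : IsMo d ↔ Planar d ∧ Small d := by
  refine and_congr_right fun _ => ?_
  constructor
  · intro h a b c hab hac hbc kab kac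
    refine (h a).not_gt ((Set.two_lt_ncard_iff (Set.toFinite _)).2 ⟨a, b, c, ?_⟩)
    exact ⟨d.refl' a, kab, kac, hab, hac, hbc⟩
  · intro h x
    by_contra hx
    obtain ⟨a, b, c, ha, hb, hc, hab, hac, hbc⟩ :=
      (Set.two_lt_ncard_iff (Set.toFinite _)).1 (not_le.1 hx)
    exact h a b c hab hac hbc (d.trans' (d.symm' ha) hb) (d.trans' (d.symm' ha) hc)

theorem isTL_iff_small {n : ℕ} {d : PartDiag n} :
    IsTL d ↔ Planar d ∧ Small d ∧ Paired d := by
  constructor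
  · rintro ⟨h1, h2⟩
    refine ⟨h1, (isMo_iff_small.1 ⟨h1, fun x => (h2 x).le⟩).2, fun a => ?_⟩
    obtain ⟨b, hb, hba⟩ := Set.exists_ne_of_one_lt_ncard (by rw [h2 a]; norm_num) a
    exact ⟨b, hba, hb⟩
  · rintro ⟨h1, h2, h3⟩
    refine ⟨h1, fun x => le_antisymm ((isMo_iff_small.2 ⟨h1, h2⟩).2 x) ?_⟩
    obtain ⟨b, hb, hxb⟩ := h3 x
    exact (Set.one_lt_ncard_iff (Set.toFinite _)).2 ⟨x, b, d.refl' x, hxb, hb.symm⟩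

theorem isPPa_iff_hasLetters {n : ℕ} {d : PartDiag n} :
    IsPPa d ↔ HasLetters (fun _ _ => True) d :=
  ⟨fun h => ⟨h, fun _ _ => trivial, fun _ _ _ => trivial⟩, fun h => h.planar⟩

theorem isMo_iff_hasLetters {n : ℕ} {d : PartDiag n} :
    IsMo d ↔ HasLetters (fun p s => ¬ (p = true ∧ s = true)) d := by
  rw [isMo_iff_small, small_iff]
  constructor
  · rintro ⟨h1, h2⟩
    exact ⟨h1, fun t ht => h2 t (by omega), fun t _ ht k => h2 t ht k.symm⟩
  · rintro ⟨h1, h2, h3⟩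
    refine ⟨h1, fun t ht => ?_⟩
    by_cases h : t < n
    · exact h2 t h
    · exact fun k => h3 t (by omega) ht k.symm

theorem isTL_iff_hasLetters {n : ℕ} {d : PartDiag n} :
    IsTL d ↔ HasLetters (fun p s => p ≠ s) d := by
  have hb : ∀ p s : Bool, p ≠ s ↔ ¬ (p = true ∧ s = true) ∧ (p = true ∨ s = true) := by decide
  rw [isTL_iff_small, small_iff, paired_iff]
  constructor
  · rintro ⟨h1, h2, h3⟩
    exact ⟨h1, fun t ht => (hb _ _).2 ⟨h2 t (by omega), h3 t (by omega)⟩,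
      fun t _ ht => ((hb _ _).2 ⟨h2 t ht, h3 t ht⟩).symm⟩
  · rintro ⟨h1, h2, h3⟩
    have h4 : ∀ t < 2 * n, (letters d t).1 ≠ (letters d t).2 := by
      intro t ht
      by_cases h : t < n
      · exact h2 t h
      · exact (h3 t (by omega) ht).symm
    exact ⟨h1, fun t ht => ((hb _ _).1 (h4 t ht)).1, fun t ht => ((hb _ _).1 (h4 t ht)).2⟩

/-- Positions before a bottom point belong to bottom points, positions after a top point to top
points. So the bit forbidden by `Q` is the one that records a second point of the block on the same
side. -/
theorem isPRo_iff_hasLetters {n : ℕ} {d : PartDiag n} :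
    IsPRo d ↔ HasLetters (fun p _ => p = false) d := by
  have hr : ∀ x : Fin n ⊕ Fin n, n ≤ pos x → ∃ i, x = Sum.inr i := by
    rintro (x | x) h
    · rw [pos_inl] at h; omega
    · exact ⟨x, rfl⟩
  have hl : ∀ x : Fin n ⊕ Fin n, pos x < n → ∃ i, x = Sum.inl i := by
    rintro (x | x) h
    · exact ⟨x, rfl⟩
    · have := pos_inr_ge x; omega
  constructor
  · rintro ⟨h1, h2, h3⟩
    refine ⟨h1, fun t ht => ?_, fun t ht ht' => ?_⟩
    · obtain ⟨x, rfl⟩ := exists_pos_eq (n := n) (t := t) (by omega)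
      refine Bool.eq_false_iff.2 fun k => ?_
      obtain ⟨y, hy, hyx⟩ := letters_fst.1 k
      obtain ⟨i, rfl⟩ := hl x ht
      obtain ⟨j, rfl⟩ := hl y (hy.trans ht)
      rw [h2 j i hyx] at hy
      exact hy.false
    · obtain ⟨x, rfl⟩ := exists_pos_eq ht'
      refine Bool.eq_false_iff.2 fun k => ?_
      obtain ⟨y, hy, hyx⟩ := letters_snd.1 k
      obtain ⟨i, rfl⟩ := hr x ht
      obtain ⟨j, rfl⟩ := hr y (ht.trans hy.le)
      rw [h3 i j hyx] at hy
      exact hy.false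
  · rintro ⟨h1, h2, h3⟩
    refine ⟨h1, ?_, ?_⟩
    · have key : ∀ i j : Fin n, i < j → ¬ d (Sum.inl i) (Sum.inl j) := by
        intro i j hij k
        have h4 : (letters d (pos (Sum.inl j : Fin n ⊕ Fin n))).1 = true :=
          letters_fst.2 ⟨Sum.inl i, hij, k⟩
        have h5 := h2 (pos (Sum.inl j : Fin n ⊕ Fin n)) j.2
        rw [h4] at h5
        cases h5
      intro i j k
      by_contra hij
      rcases lt_or_gt_of_ne hij with g | g
      · exact key i j g k
      · exact key j i g (d.symm' k)
    · have key : ∀ i j : Fin n, i < j → ¬ d (Sum.inr j) (Sum.inr i) := by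
        intro i j hij k
        have h4 : (letters d (pos (Sum.inr j : Fin n ⊕ Fin n))).2 = true := by
          refine letters_snd.2 ⟨Sum.inr i, ?_, k⟩
          simp only [pos, Sum.elim_inr]
          omega
        have h5 := h3 (pos (Sum.inr j : Fin n ⊕ Fin n)) (pos_inr_ge j) (pos_lt _)
        rw [h4] at h5
        cases h5
      intro i j k
      by_contra hij
      rcases lt_or_gt_of_ne hij with g | g
      · exact key i j g (d.symm' k)
      · exact key j i g k

/-- A class of diagrams that is closed under composition and reflection, and whose diagrams are
pairs of halves with equally many through strands. -/
structure IsHalved {n : ℕ} (F : PartDiag n → Prop) : Prop where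
  one : F (one n)
  comp : ∀ {d e}, F d → F e → F (comp d e)
  flip : ∀ {d}, F d → F (flip d)
  ext : ∀ {d e}, F d → F e → half d = half e → half (PartDiag.flip d) = half (PartDiag.flip e) →
    d = e
  splice : ∀ {d e}, F d → F e → through d = through e → ∃ f, F f ∧ half f = half d ∧
    half (PartDiag.flip f) = half (PartDiag.flip e)

theorem isHalved_of_hasLetters {n : ℕ} {F : PartDiag n → Prop} {Q : Bool → Bool → Prop}
    (h : ∀ d, F d ↔ HasLetters Q d) (h1 : F (one n))
    (hc : ∀ {d e}, F d → F e → F (comp d e)) : IsHalved F where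
  one := h1
  comp := hc
  flip hd := (h _).2 ((h _).1 hd).flip
  ext hd he := ((h _).1 hd).planar.ext_half ((h _).1 he).planar
  splice hd he k := by
    obtain ⟨f, hf, h2, h3⟩ := ((h _).1 hd).exists_splice ((h _).1 he) k
    exact ⟨f, (h _).2 hf, h2, h3⟩

theorem one_apply {n : ℕ} {x y : Fin n ⊕ Fin n} (h : one n x y) : x = y ∨ x = y.swap := by
  have h1 : (Sum.elim id id x : Fin n) = Sum.elim id id y := h
  rcases x with x | x <;> rcases y with y | y <;> simp_all

theorem planar_one (n : ℕ) : Planar (one n) := by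
  intro w x y z hwx hxy hyz hwy hxz
  have h1 : w = y.swap := (one_apply hwy).resolve_left fun h => by subst h; omega
  have h2 : x = z.swap := (one_apply hxz).resolve_left fun h => by subst h; omega
  subst h1 h2
  rw [pos_swap, pos_swap] at *
  have := pos_lt y
  have := pos_lt z
  omega

theorem small_one (n : ℕ) : Small (one n) := by
  intro a b c hab hac hbc kab kac
  have h1 := (one_apply kab).resolve_left hab
  have h2 := (one_apply kac).resolve_left hac
  rw [h1] at h2
  exact hbc ((Function.LeftInverse.injective (f := Sum.swap) (g := Sum.swap) Sum.swap_swap) h2)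

theorem paired_one (n : ℕ) : Paired (one n) := by
  rintro (a | a)
  · exact ⟨Sum.inr a, by simp, rfl⟩
  · exact ⟨Sum.inl a, by simp, rfl⟩

theorem rook_one (n : ℕ) : Rook (one n) := by
  intro a b hab k
  rcases one_apply k with h | h
  · exact h
  · rcases a with a | a <;> rcases b with b | b <;> simp_all

theorem isHalved_isPPa (n : ℕ) : IsHalved (IsPPa (n := n)) :=
  isHalved_of_hasLetters (fun _ => isPPa_iff_hasLetters) (planar_one n) Planar.comp

theorem isHalved_isMo (n : ℕ) : IsHalved (IsMo (n := n)) := by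
  refine isHalved_of_hasLetters (fun _ => isMo_iff_hasLetters)
    (isMo_iff_small.2 ⟨planar_one n, small_one n⟩) ?_
  intro d e hd he
  rw [isMo_iff_small] at *
  exact ⟨hd.1.comp he.1, hd.2.comp he.2⟩

theorem isHalved_isTL (n : ℕ) : IsHalved (IsTL (n := n)) := by
  refine isHalved_of_hasLetters (fun _ => isTL_iff_hasLetters)
    (isTL_iff_small.2 ⟨planar_one n, small_one n, paired_one n⟩) ?_
  intro d e hd he
  rw [isTL_iff_small] at *
  exact ⟨hd.1.comp he.1, hd.2.1.comp he.2.1, Paired.comp hd.2.1 he.2.1 hd.2.2 he.2.2⟩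

theorem isHalved_isPRo (n : ℕ) : IsHalved (IsPRo (n := n)) := by
  refine isHalved_of_hasLetters (fun _ => isPRo_iff_hasLetters)
    (isPRo_iff_rook.2 ⟨planar_one n, rook_one n⟩) ?_
  intro d e hd he
  rw [isPRo_iff_rook] at *
  exact ⟨hd.1.comp he.1, hd.2.comp he.2⟩

end PartDiag

/-! ### Simple modules over semisimple diagram algebras -/

namespace DiagAlg

open PartDiag

theorem finite_partDiag (n : ℕ) : Finite (PartDiag n) :=
  Finite.of_injective (fun (d : PartDiag n) x y => d x y) fun _ _ h =>
    Setoid.ext fun x y => iff_of_eq (congrFun (congrFun h x) y)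

variable {K : Type*} [Field K] (a₀ u : K) {n : ℕ} {F : PartDiag n → Prop}

theorem of_mul_of (hF : IsHalved F) {d e : PartDiag n} (hd : F d) (he : F e) :
    DiagAlg.of a₀ u d hd * DiagAlg.of a₀ u e he =
      coeff a₀ u d e • DiagAlg.of a₀ u (comp d e) (hF.comp hd he) :=
  Subtype.ext (PaAlg.of_mul_of a₀ u d e)

/-- The span of the diagrams that satisfy a further condition. -/
noncomputable def spanOf (F : PartDiag n → Prop) (G : PartDiag n → Prop) : Submodule K (DiagAlg K a₀ u F) :=
  Submodule.span K {x | ∃ (d : PartDiag n) (hd : F d), G d ∧ x = DiagAlg.of a₀ u d hd}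

variable {a₀ u}

theorem of_mem_spanOf {G : PartDiag n → Prop} {d : PartDiag n} (hd : F d) (h : G d) :
    DiagAlg.of a₀ u d hd ∈ spanOf a₀ u F G :=
  Submodule.subset_span ⟨d, hd, h, rfl⟩

theorem mul_mem_spanOf (hF : IsHalved F) {G G' G'' : PartDiag n → Prop}
    (h : ∀ d e, G d → G' e → G'' (comp d e)) {x y : DiagAlg K a₀ u F}
    (hx : x ∈ spanOf a₀ u F G) (hy : y ∈ spanOf a₀ u F G') : x * y ∈ spanOf a₀ u F G'' := by
  have h1 := Submodule.mul_mem_mul hx hy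
  rw [spanOf, spanOf, Submodule.span_mul_span] at h1
  refine (Submodule.span_le.2 ?_) h1
  rintro _ ⟨_, ⟨d, hd, hGd, rfl⟩, _, ⟨e, he, hGe, rfl⟩, rfl⟩
  change DiagAlg.of a₀ u d hd * DiagAlg.of a₀ u e he ∈ _
  rw [of_mul_of a₀ u hF]
  exact Submodule.smul_mem _ _ (of_mem_spanOf _ (h d e hGd hGe))

/-- The span of the diagrams contains the identity and is closed under products, so it exhausts the
subalgebra generated by them. -/
theorem spanOf_true (hF : IsHalved F) (x : DiagAlg K a₀ u F) :
    x ∈ spanOf a₀ u F fun _ => True := by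
  let S : Subalgebra K (DiagAlg K a₀ u F) := Submodule.toSubalgebra (spanOf a₀ u F fun _ => True)
    (of_mem_spanOf hF.one trivial) fun x y hx hy => mul_mem_spanOf hF (fun _ _ _ _ => trivial) hx hy
  have h1 : DiagAlg K a₀ u F ≤ S.map (DiagAlg K a₀ u F).val := by
    refine Algebra.adjoin_le ?_
    rintro _ ⟨d, hd, rfl⟩
    exact ⟨DiagAlg.of a₀ u d hd, of_mem_spanOf hd trivial, rfl⟩
  obtain ⟨y, hy, hyx⟩ := h1 x.2
  rw [← Subtype.ext hyx]
  exact hy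

/-- The coefficient of a diagram. -/
noncomputable def coord (d : PartDiag n) : DiagAlg K a₀ u F →ₗ[K] K :=
  (show PaAlg K a₀ u n →ₗ[K] K from Finsupp.lapply d) ∘ₗ (DiagAlg K a₀ u F).val.toLinearMap

theorem coord_of_self {d : PartDiag n} (hd : F d) : coord d (DiagAlg.of a₀ u d hd) = 1 :=
  Finsupp.single_eq_same

theorem coord_of_ne {d e : PartDiag n} (he : F e) (h : e ≠ d) :
    coord d (DiagAlg.of a₀ u e he) = 0 :=
  Finsupp.single_eq_of_ne h.symm

theorem coord_eq_zero {G : PartDiag n → Prop} {d : PartDiag n} (h : ¬ G d)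
    {x : DiagAlg K a₀ u F} (hx : x ∈ spanOf a₀ u F G) : coord d x = 0 := by
  have hle : spanOf a₀ u F G ≤ LinearMap.ker (coord d) := by
    refine Submodule.span_le.2 ?_
    rintro _ ⟨e, he, hG, rfl⟩
    exact coord_of_ne he fun k => h (k ▸ hG)
  exact hle hx

/-- The ideal spanned by the diagrams with fewer than `k` through strands. -/
noncomputable def throughIdeal (a₀ u : K) (hF : IsHalved F) (k : ℕ) :
    Submodule (DiagAlg K a₀ u F) (DiagAlg K a₀ u F) where
  carrier := spanOf a₀ u F fun d => through d < k
  add_mem' := Submodule.add_mem _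
  zero_mem' := Submodule.zero_mem _
  smul_mem' := fun x _ hy => mul_mem_spanOf hF
    (fun d e _ he => (through_comp_le_right d e).trans_lt he) (spanOf_true hF x) hy

theorem mem_throughIdeal (hF : IsHalved F) {k : ℕ} {x : DiagAlg K a₀ u F} :
    x ∈ throughIdeal a₀ u hF k ↔ x ∈ spanOf a₀ u F fun d => through d < k := Iff.rfl

theorem throughIdeal_mul_mem (hF : IsHalved F) {k : ℕ} {x : DiagAlg K a₀ u F}
    (hx : x ∈ throughIdeal a₀ u hF k) (y : DiagAlg K a₀ u F) :
    x * y ∈ throughIdeal a₀ u hF k :=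
  mul_mem_spanOf hF (fun d e hd _ => (through_comp_le_left d e).trans_lt hd) hx
    (spanOf_true hF y)

theorem throughIdeal_mono (hF : IsHalved F) {k l : ℕ} (h : k ≤ l) :
    throughIdeal a₀ u hF k ≤ throughIdeal a₀ u hF l := by
  intro x hx
  refine Submodule.span_mono ?_ hx
  rintro _ ⟨d, hd, hk, rfl⟩
  exact ⟨d, hd, lt_of_lt_of_le hk h, rfl⟩

theorem smul_eq_zero_of_mem_spanOf {L : Type*} [AddCommGroup L] [Module K L]
    [Module (DiagAlg K a₀ u F) L] [IsScalarTower K (DiagAlg K a₀ u F) L] {G : PartDiag n → Prop}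
    {v : L} (h : ∀ d (hd : F d), G d → DiagAlg.of a₀ u d hd • v = 0) {x : DiagAlg K a₀ u F}
    (hx : x ∈ spanOf a₀ u F G) : x • v = 0 := by
  induction hx using Submodule.span_induction with
  | mem x hx =>
    obtain ⟨d, hd, hG, rfl⟩ := hx
    exact h d hd hG
  | zero => exact zero_smul _ _
  | add x y _ _ h1 h2 => rw [add_smul, h1, h2, add_zero]
  | smul c x _ h1 => rw [smul_assoc, h1, smul_zero]

/-- Let `Q` be a complement of the ideal of diagrams with fewer than `k` strands. Its intersection
with the next ideal is nonzero because `d₀` lies in that ideal but not in the smaller one. A minimal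
left ideal `L` in the intersection is mapped by diagrams with fewer strands into both `Q` and the
smaller ideal, hence to zero. -/
theorem exists_simple_of_apex (hF : IsHalved F) [IsSemisimpleRing (DiagAlg K a₀ u F)]
    {d₀ : PartDiag n} (hd₀ : F d₀) :
    ∃ L : Submodule (DiagAlg K a₀ u F) (DiagAlg K a₀ u F),
      IsSimpleModule (DiagAlg K a₀ u F) L ∧ HasApex a₀ u F L (through d₀) := by
  set k := through d₀ with hk
  obtain ⟨Q, hQ⟩ := exists_isCompl (throughIdeal a₀ u hF k)
  have hmono := throughIdeal_mono (a₀ := a₀) (u := u) hF k.le_succ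
  have hne : throughIdeal a₀ u hF (k + 1) ⊓ Q ≠ ⊥ := by
    intro h
    have h1 : throughIdeal a₀ u hF (k + 1) = throughIdeal a₀ u hF k := by
      have h2 := sup_inf_assoc_of_le Q hmono
      rw [hQ.sup_eq_top, top_inf_eq, inf_comm, h, sup_bot_eq] at h2
      exact h2
    have h2 : DiagAlg.of a₀ u d₀ hd₀ ∈ throughIdeal a₀ u hF (k + 1) :=
      of_mem_spanOf hd₀ (Nat.lt_succ_self _)
    rw [h1, mem_throughIdeal] at h2
    have h3 := coord_eq_zero (d := d₀) (by omega) h2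
    rw [coord_of_self] at h3
    exact one_ne_zero h3
  obtain ⟨L, hL, hLe⟩ := (eq_bot_or_exists_atom_le _).resolve_left hne
  have hLI : L ≤ throughIdeal a₀ u hF (k + 1) := hLe.trans inf_le_left
  have hkill : ∀ (d : PartDiag n) (hd : F d), through d < k → ∀ v : L,
      DiagAlg.of a₀ u d hd • v = 0 := by
    rintro d hd hdk ⟨v, hv⟩
    refine Subtype.ext ?_
    have h1 : DiagAlg.of a₀ u d hd * v ∈ throughIdeal a₀ u hF k :=
      throughIdeal_mul_mem hF (of_mem_spanOf hd hdk) v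
    have h2 : DiagAlg.of a₀ u d hd * v ∈ Q := (hLe.trans inf_le_right) (L.smul_mem _ hv)
    exact (Submodule.disjoint_def.1 hQ.disjoint) _ h1 h2
  refine ⟨L, isSimpleModule_iff_isAtom.2 hL, hkill, ?_⟩
  by_contra hno
  push Not at hno
  obtain ⟨e, he, hLe'⟩ := IsSemisimpleRing.ideal_eq_span_idempotent L
  have heL : e ∈ L := by rw [hLe']; exact Ideal.mem_span_singleton_self e
  -- If the diagrams with `k` strands killed `L` too, then so would the ideal that contains `L`, and
  -- its idempotent generator would square to zero.
  have h1 : e * e = 0 := by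
    refine smul_eq_zero_of_mem_spanOf (fun d hd hdk => ?_) (hLI heL)
    rcases Nat.lt_succ_iff_lt_or_eq.1 hdk with h | h
    · exact congrArg Subtype.val (hkill d hd h ⟨e, heL⟩)
    · exact congrArg Subtype.val (hno d hd h ⟨e, heL⟩)
  have h2 : e = 0 := he.eq.symm.trans h1
  refine hL.1 ?_
  rw [hLe', h2]
  simp

/-- Elements of an ideal of a semisimple ring that are multiplied by the ideal into a smaller ideal
lie in the smaller ideal. -/
theorem mem_of_forall_mul_mem {A : Type*} [Ring A] [IsSemisimpleRing A] {I I' : Submodule A A}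
    (hI : ∀ x ∈ I, ∀ y, x * y ∈ I) {w : A} (hw : w ∈ I)
    (h : ∀ z ∈ I, z * w ∈ I') : w ∈ I' := by
  -- `M` is a left ideal thanks to `hI`. Its idempotent generator `e` lies in `I` and is multiplied
  -- by itself into `I'`, so `e = e * e` lies in `I'`.
  let M : Submodule A A :=
    { carrier := {w | w ∈ I ∧ ∀ z ∈ I, z * w ∈ I'}
      add_mem' := fun {a b} ha hb => ⟨I.add_mem ha.1 hb.1, fun z hz => by
        rw [mul_add]; exact I'.add_mem (ha.2 z hz) (hb.2 z hz)⟩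
      zero_mem' := ⟨I.zero_mem, fun z _ => by rw [mul_zero]; exact I'.zero_mem⟩
      smul_mem' := fun c x hx => ⟨I.smul_mem c hx.1, fun z hz => by
        rw [smul_eq_mul, ← mul_assoc]; exact hx.2 _ (hI z hz c)⟩ }
  obtain ⟨e, he, hM⟩ := IsSemisimpleRing.ideal_eq_span_idempotent M
  have heM : e ∈ M := by rw [hM]; exact Ideal.mem_span_singleton_self e
  have heI' : e ∈ I' := by
    rw [← he.eq]
    exact heM.2 e heM.1
  have hMI' : M ≤ I' := by
    rw [hM]
    exact (Ideal.span_singleton_le_iff_mem I').2 heI'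
  exact hMI' ⟨hw, h⟩

theorem ncard_flip (hF : IsHalved F) (k : ℕ) :
    ((fun d => half (flip d)) '' {d | F d ∧ through d = k}).ncard =
      (half '' {d | F d ∧ through d = k}).ncard := by
  congr 1
  ext t
  constructor
  · rintro ⟨d, ⟨hd, hk⟩, rfl⟩
    exact ⟨flip d, ⟨hF.flip hd, by rw [through_flip, hk]⟩, rfl⟩
  · rintro ⟨d, ⟨hd, hk⟩, rfl⟩
    exact ⟨flip d, ⟨hF.flip hd, by rw [through_flip, hk]⟩, by simp only [PartDiag.flip_flip]⟩

open Classical in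
/-- The product of two diagrams with `k` through strands modulo diagrams with fewer. -/
theorem of_mul_of_sub_mem (hF : IsHalved F) {k : ℕ} {y d z : PartDiag n} (hy : F y) (hd : F d)
    (hz : F z) (hyk : through y = k) (hdk : through d = k) (h : half z = half d)
    (h' : half (flip z) = half (flip y)) :
    DiagAlg.of a₀ u y hy * DiagAlg.of a₀ u d hd -
      (if through (comp y d) = k then coeff a₀ u y d else 0) • DiagAlg.of a₀ u z hz ∈
      throughIdeal a₀ u hF k := by
  rw [of_mul_of a₀ u hF]
  split_ifs with hk
  · have h1 : comp y d = z := hF.ext (hF.comp hy hd) hz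
      ((half_comp (hk.trans hdk.symm)).trans h.symm)
      ((half_flip_comp (hk.trans hyk.symm)).trans h'.symm)
    subst h1
    rw [sub_self]
    exact Submodule.zero_mem _
  · rw [zero_smul, sub_zero]
    have h1 := through_comp_le_right y d
    exact Submodule.smul_mem (spanOf a₀ u F fun d => through d < k) _
      (of_mem_spanOf _ (by omega))

/-- A simple module of apex `k` over a semisimple diagram algebra has a basis indexed by the upper
halves of diagrams with `k` through strands. -/
theorem finrank_of_apex (hF : IsHalved F) [IsSemisimpleRing (DiagAlg K a₀ u F)] {k : ℕ}
    (L : Type*) [AddCommGroup L] [Module K L] [Module (DiagAlg K a₀ u F) L]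
    [IsScalarTower K (DiagAlg K a₀ u F) L] [IsSimpleModule (DiagAlg K a₀ u F) L]
    (hL : HasApex a₀ u F L k) :
    Module.finrank K L = (half '' {d | F d ∧ through d = k}).ncard := by
  classical
  have := finite_partDiag n
  obtain ⟨hkill, d₀, hd₀, hk₀, l, hl⟩ := hL
  have hkill' : ∀ x ∈ throughIdeal a₀ u hF k, ∀ v : L, x • v = 0 := fun x hx v =>
    smul_eq_zero_of_mem_spanOf (fun d hd hdk => hkill d hd hdk v) hx
  let T := (fun d => half (flip d)) '' {d | F d ∧ through d = k}
  have hfin : T.Finite := (Set.toFinite _).image _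
  have : Fintype T := hfin.fintype
  have hex : ∀ t : T, ∃ d, F d ∧ through d = k ∧ half d = half d₀ ∧ half (flip d) = t := by
    rintro ⟨_, d, ⟨hd, hdk⟩, rfl⟩
    obtain ⟨f, hf, h1, h2⟩ := hF.splice hd₀ hd (hk₀.trans hdk.symm)
    exact ⟨f, hf, (through_eq_of_half_eq h1).trans hk₀, h1, h2⟩
  -- `D t` has the lower half of `d₀` and the upper half `t`; the vectors `D t • l` will be the
  -- basis.
  choose D hDF hDk hDb hDt using hex
  let top : ∀ y, F y → through y = k → T := fun y hy hyk => ⟨half (flip y), y, ⟨hy, hyk⟩, rfl⟩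
  have hDtop : ∀ y (hy : F y) (hyk : through y = k), half y = half d₀ →
      D (top y hy hyk) = y := fun y hy hyk h =>
    hF.ext (hDF _) hy ((hDb _).trans h.symm) (hDt _)
  let v : T → L := fun t => DiagAlg.of a₀ u (D t) (hDF t) • l
  have hind : LinearIndependent K v := by
    rw [Fintype.linearIndependent_iff]
    intro g hg
    let ξ : DiagAlg K a₀ u F := ∑ t, g t • DiagAlg.of a₀ u (D t) (hDF t)
    have hξl : ξ • l = 0 := by
      rw [Finset.sum_smul, ← hg]
      exact Finset.sum_congr rfl fun t _ => smul_assoc _ _ _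
    -- The pairing of `y` with the coefficients of `ξ`: modulo fewer strands, `y * ξ` is `lam y`
    -- times the diagram with the upper half of `y` and the lower half of `d₀`.
    let lam : PartDiag n → K := fun y =>
      ∑ t, g t * (if through (comp y (D t)) = k then coeff a₀ u y (D t) else 0)
    have hmul : ∀ y (hy : F y) (hyk : through y = k),
        DiagAlg.of a₀ u y hy * ξ - lam y • DiagAlg.of a₀ u (D (top y hy hyk)) (hDF _) ∈
          throughIdeal a₀ u hF k := by
      intro y hy hyk
      rw [Finset.mul_sum, Finset.sum_smul, ← Finset.sum_sub_distrib]
      refine Submodule.sum_mem _ fun t _ => ?_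
      rw [mul_smul_comm, mul_smul, ← smul_sub]
      exact Submodule.smul_mem (spanOf a₀ u F fun d => through d < k) _
        (of_mul_of_sub_mem hF hy (hDF t) (hDF _) hyk (hDk t)
          ((hDb _).trans (hDb t).symm) (hDt _))
    -- Giving `y` the upper half of `d₀` does not change `lam`, which depends on the lower half of
    -- `y` only. Then `y' * ξ` is `lam y • d₀` modulo elements that kill `L`, and applying it to `l`
    -- gives `lam y • d₀ • l = 0`.
    have hlam : ∀ y, F y → through y = k → lam y = 0 := by
      intro y hy hyk
      obtain ⟨y', hy', h1, h2⟩ := hF.splice hy hd₀ (hyk.trans hk₀.symm)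
      have hyk' : through y' = k := (through_eq_of_half_eq h1).trans hyk
      have h3 : lam y' = lam y := by
        refine Finset.sum_congr rfl fun t _ => ?_
        have h4 := through_eq_of_half_eq (half_comp_congr (d := D t) h1)
        rw [h4]
        split_ifs with h5
        · rw [coeff_congr a₀ u h1 (by omega)]
        · rfl
      have h6 := hkill' _ (hmul y' hy' hyk') l
      have h7 : D (top y' hy' hyk') = d₀ := by
        refine hF.ext (hDF _) hd₀ (hDb _) ((hDt _).trans h2)
      rw [sub_smul, mul_smul, hξl, smul_zero, zero_sub, neg_eq_zero, smul_assoc, h3] at h6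
      have h8 : DiagAlg.of a₀ u (D (top y' hy' hyk')) (hDF _) = DiagAlg.of a₀ u d₀ hd₀ :=
        Subtype.ext (congrArg (PaAlg.of a₀ u) h7)
      rw [h8] at h6
      exact (smul_eq_zero.1 h6).resolve_right hl
    -- Semisimplicity is used here: it excludes a radical of the pairing, so vanishing of all `lam
    -- y` forces `ξ` into the smaller ideal.
    have hξ : ξ ∈ throughIdeal a₀ u hF k := by
      refine mem_of_forall_mul_mem (I := throughIdeal a₀ u hF (k + 1))
        (fun x hx y => throughIdeal_mul_mem hF hx y) ?_ ?_
      · exact Submodule.sum_mem (spanOf a₀ u F fun d => through d < k + 1) fun t _ =>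
          Submodule.smul_mem _ _ (of_mem_spanOf _ (by rw [hDk t]; exact k.lt_succ_self))
      · intro z hz
        rw [mem_throughIdeal] at hz
        induction hz using Submodule.span_induction with
        | mem x hx =>
          obtain ⟨y, hy, hyk, rfl⟩ := hx
          rcases Nat.lt_succ_iff_lt_or_eq.1 hyk with h | h
          · exact throughIdeal_mul_mem hF (of_mem_spanOf hy h) ξ
          · have h1 := hmul y hy h
            rwa [hlam y hy h, zero_smul, sub_zero] at h1
        | zero => rw [zero_mul]; exact Submodule.zero_mem _
        | add x y _ _ h1 h2 => rw [add_mul]; exact Submodule.add_mem _ h1 h2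
        | smul c x _ h1 =>
          rw [smul_mul_assoc]
          exact Submodule.smul_mem (spanOf a₀ u F fun d => through d < k) _ h1
    intro t
    have h1 := coord_eq_zero (d := D t) (by rw [hDk t]; exact lt_irrefl k) hξ
    rw [map_sum, Finset.sum_eq_single t] at h1
    · rwa [map_smul, coord_of_self, smul_eq_mul, mul_one] at h1
    · intro t' _ ht'
      rw [map_smul, coord_of_ne, smul_zero]
      intro h
      refine ht' (Subtype.ext ?_)
      rw [← hDt t', ← hDt t, h]
    · exact fun h => (h (Finset.mem_univ t)).elim
  -- A diagram sends `D t • l` either to zero, when a strand is lost, or to a multiple of another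
  -- vector of the family, since the lower half of `d₀` is kept. The span is thus a submodule,
  -- nonzero because it contains `d₀ • l`.
  have hspan : ⊤ ≤ Submodule.span K (Set.range v) := by
    let N : Submodule (DiagAlg K a₀ u F) L :=
      { carrier := Submodule.span K (Set.range v)
        add_mem' := Submodule.add_mem _
        zero_mem' := Submodule.zero_mem _
        smul_mem' := by
          intro x w hw
          have hx := spanOf_true hF x
          change x • w ∈ Submodule.span K (Set.range v)
          induction hx using Submodule.span_induction with
          | zero => rw [zero_smul]; exact Submodule.zero_mem _
          | add x y _ _ h1 h2 => rw [add_smul]; exact Submodule.add_mem _ h1 h2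
          | smul c x _ h1 => rw [smul_assoc]; exact Submodule.smul_mem _ _ h1
          | mem x hx =>
            obtain ⟨y, hy, -, rfl⟩ := hx
            have hcomm : ∀ (c : K) (w : L), DiagAlg.of a₀ u y hy • c • w =
                c • DiagAlg.of a₀ u y hy • w := by
              intro c w
              rw [← algebraMap_smul (DiagAlg K a₀ u F) c w,
                ← algebraMap_smul (DiagAlg K a₀ u F) c (DiagAlg.of a₀ u y hy • w), smul_smul,
                smul_smul, Algebra.commutes]
            induction hw using Submodule.span_induction with
            | zero => rw [smul_zero]; exact Submodule.zero_mem _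
            | add x y _ _ h1 h2 => rw [smul_add]; exact Submodule.add_mem _ h1 h2
            | smul c x _ h1 => rw [hcomm]; exact Submodule.smul_mem _ _ h1
            | mem x hx =>
              obtain ⟨t, rfl⟩ := hx
              have h1 := through_comp_le_right y (D t)
              rw [hDk t] at h1
              have h2 : DiagAlg.of a₀ u y hy • v t = coeff a₀ u y (D t) •
                  DiagAlg.of a₀ u (comp y (D t)) (hF.comp hy (hDF t)) • l := by
                rw [← smul_assoc (coeff a₀ u y (D t)), ← of_mul_of a₀ u hF hy (hDF t), mul_smul]
              rw [h2]
              refine Submodule.smul_mem _ _ ?_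
              rcases h1.lt_or_eq with h | h
              · rw [hkill _ _ h]
                exact Submodule.zero_mem _
              · refine Submodule.subset_span ⟨top _ (hF.comp hy (hDF t)) h, ?_⟩
                have h3 := hDtop _ (hF.comp hy (hDF t)) h
                  ((half_comp (h.trans (hDk t).symm)).trans (hDb t))
                change DiagAlg.of a₀ u (D _) (hDF _) • l = _
                congr 1
                exact Subtype.ext (congrArg (PaAlg.of a₀ u) h3) }
    have hN : N ≠ ⊥ := by
      intro h
      have h1 : v (top d₀ hd₀ hk₀) ∈ N := Submodule.subset_span ⟨_, rfl⟩
      rw [h, Submodule.mem_bot] at h1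
      have h2 : DiagAlg.of a₀ u (D (top d₀ hd₀ hk₀)) (hDF _) = DiagAlg.of a₀ u d₀ hd₀ :=
        Subtype.ext (congrArg (PaAlg.of a₀ u) (hDtop d₀ hd₀ hk₀ rfl))
      exact hl (by rw [← h2]; exact h1)
    have hN' : N = ⊤ := (eq_bot_or_eq_top N).resolve_left hN
    intro x _
    have : x ∈ N := by rw [hN']; trivial
    exact this
  rw [Module.finrank_eq_nat_card_basis (Module.Basis.mk hind hspan), ← ncard_flip hF]
  rfl

end DiagAlg

/-- The count does not involve the field or the parameters. Its positivity supplies a diagram with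
`k` through strands, from which a simple module of apex `k` is obtained. -/
theorem simpleDim_of_count {n k : ℕ} {F : PartDiag n → Prop} (hF : PartDiag.IsHalved F)
    {Q : Bool → Bool → Prop} [∀ p s, Decidable (Q p s)]
    (hQ : ∀ d, F d ↔ PartDiag.HasLetters Q d) {P : ℕ → Prop}
    (hpos : 0 < PartDiag.countHalves Q n k) (hP : P (PartDiag.countHalves Q n k)) :
    SimpleDim.{v, w} F k P := by
  have hcard : (PartDiag.half '' {d : PartDiag n | F d ∧ PartDiag.through d = k}).ncard =
      PartDiag.countHalves Q n k := by
    rw [← PartDiag.ncard_halves_eq_count]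
    simp only [hQ]
  intro K _ a₀ u hss
  have := DiagAlg.finite_partDiag n
  constructor
  · rw [← hcard] at hpos
    obtain ⟨_, d, ⟨hd, rfl⟩, rfl⟩ := (Set.ncard_pos ((Set.toFinite _).image _)).1 hpos
    exact DiagAlg.exists_simple_of_apex hF hd
  · intro L _ _ _ _ hsimple hL
    rw [DiagAlg.finrank_of_apex hF L hL, hcard]
    exact hP

/-! ### Walks, the ballot formula and the numbers of halves -/

/-- The number of walks of a given length from `0` to a given integer with steps `1`, `-1` and with
`c` different steps `0`. -/
def walk (c : ℤ) : ℕ → ℤ → ℤ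
  | 0, k => if k = 0 then 1 else 0
  | n + 1, k => walk c n (k - 1) + c * walk c n k + walk c n (k + 1)

theorem walk_succ (c : ℤ) (n : ℕ) (k : ℤ) :
    walk c (n + 1) k = walk c n (k - 1) + c * walk c n k + walk c n (k + 1) := rfl

theorem walk_neg (c : ℤ) (n : ℕ) (k : ℤ) : walk c n (-k) = walk c n k := by
  induction n generalizing k with
  | zero => simp [walk]
  | succ n ih =>
    rw [walk_succ, walk_succ, ih, show -k - 1 = -(k + 1) by ring, ih,
      show -k + 1 = -(k - 1) by ring, ih]
    ring

/-- The walk numbers are the coefficients of `(x + c + x⁻¹) ^ n`. Applying `x d/dx` to the power `n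
+ 1` gives `(n + 1) (x - x⁻¹) (x + c + x⁻¹) ^ n`, and this compares coefficients of `x ^ k`. -/
theorem mul_walk_succ (c : ℤ) (n : ℕ) (k : ℤ) :
    k * walk c (n + 1) k = (n + 1) * (walk c n (k - 1) - walk c n (k + 1)) := by
  induction n generalizing k with
  | zero =>
    simp only [walk]
    have h1 : k - 1 = 0 ↔ k = 1 := by omega
    have h2 : k + 1 = 0 ↔ k = -1 := by omega
    simp only [h1, h2]
    by_cases h3 : k = 0
    · subst h3; simp
    by_cases h4 : k = 1
    · subst h4; simp
    by_cases h5 : k = -1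
    · subst h5; simp
    simp [h3, h4, h5]
  | succ n ih =>
    have e1 := ih (k - 1)
    have e2 := ih k
    have e3 := ih (k + 1)
    have s1 := walk_succ c n (k - 1)
    have s2 := walk_succ c n (k + 1)
    rw [walk_succ c (n + 1)]
    push_cast
    ring_nf at e1 e2 e3 s1 s2 ⊢
    linear_combination e1 + c * e2 + e3 - ((n : ℤ) + 1) * s1 + ((n : ℤ) + 1) * s2

/-- The ballot formula. -/
theorem ballot (c : ℤ) (n k : ℕ) : ((k : ℤ) + 1) * walk c (n + 1) (k + 1) =
    (n + 1) * (walk c n k - walk c n (k + 2)) := by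
  rw [mul_walk_succ, show (k : ℤ) + 1 - 1 = k by ring, show (k : ℤ) + 1 + 1 = k + 2 by ring]

namespace PartDiag

/-- Reflection principle: the right-hand side satisfies the recursion of free walks, and by
`walk_neg` it vanishes at `k = -1`, which is the boundary condition for paths that stay nonnegative.
The same argument with `c = 1` handles Motzkin halves. -/
theorem countHalves_TL (n k : ℕ) :
    (countHalves (fun p s => p ≠ s) n k : ℤ) = walk 0 n k - walk 0 n (k + 2) := by
  induction n generalizing k with
  | zero =>
    simp only [countHalves, walk]
    rcases k with - | k
    · simp
    · rw [if_neg (by omega), if_neg (by omega), if_neg (by omega)]; simp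
  | succ n ih =>
    have h1 := ih (k + 1)
    push_cast at h1
    rw [walk_succ, walk_succ]
    rcases k with - | k
    · simp only [countHalves]
      have h2 := walk_neg 0 n 1
      simp at h1 h2 ⊢
      rw [h1, h2]
      ring_nf
    · have h2 := ih k
      simp only [countHalves]
      simp at h1 h2 ⊢
      rw [h1, h2]
      ring_nf

theorem countHalves_Mo (n k : ℕ) :
    (countHalves (fun p s => ¬ (p = true ∧ s = true)) n k : ℤ) =
      walk 1 n k - walk 1 n (k + 2) := by
  induction n generalizing k with
  | zero =>
    simp only [countHalves, walk]
    rcases k with - | k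
    · simp
    · rw [if_neg (by omega), if_neg (by omega), if_neg (by omega)]; simp
  | succ n ih =>
    have h1 := ih (k + 1)
    have h3 := ih k
    push_cast at h1 h3
    rw [walk_succ, walk_succ]
    rcases k with - | k
    · simp only [countHalves]
      have h2 := walk_neg 1 n 1
      simp at h1 h2 h3 ⊢
      rw [h1, h2, h3]
      ring_nf
    · have h2 := ih k
      simp only [countHalves]
      simp at h1 h2 h3 ⊢
      rw [h1, h2, h3]
      ring_nf

/-- Each letter stands for two steps `±1` of a path of doubled height. The level letters are up-down
and down-up, and the latter, which continues a block and leaves it open, needs positive height. So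
these halves are counted as Temperley-Lieb halves on `2 n` points. -/
theorem countHalves_PPa (n k : ℕ) :
    (countHalves (fun _ _ => True) n k : ℤ) =
      walk 0 (2 * n) (2 * k) - walk 0 (2 * n) (2 * k + 2) := by
  induction n generalizing k with
  | zero =>
    simp only [countHalves, walk]
    rcases k with - | k
    · simp
    · rw [if_neg (by omega), if_neg (by omega), if_neg (by omega)]; simp
  | succ n ih =>
    have h1 := ih (k + 1)
    have h3 := ih k
    push_cast at h1 h3
    rw [show 2 * (n + 1) = 2 * n + 1 + 1 by ring]
    simp only [walk_succ]
    rcases k with - | k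
    · simp only [countHalves]
      have h2 := walk_neg 0 (2 * n) 2
      simp at h1 h2 h3 ⊢
      rw [h1, h3]
      norm_num
      rw [h2]
      ring_nf
    · have h2 := ih k
      simp only [countHalves]
      simp at h1 h2 h3 ⊢
      rw [h1, h2, h3]
      ring_nf

/-- A letter either raises the height or keeps it, without any constraint, so this is the binomial
coefficient `n` over `k`, recentred to a walk with steps `±1`. The auxiliary `hlt` is needed for `k
= 0`, where there is no term `k - 1`. -/
theorem countHalves_PRo (n k : ℕ) :
    (countHalves (fun p _ => p = false) n k : ℤ) = walk 0 n (2 * k - n) := by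
  have hlt : ∀ n : ℕ, ∀ j : ℤ, j < -n → walk 0 n j = 0 := by
    intro n
    induction n with
    | zero => intro j hj; simp only [walk]; rw [if_neg (by push_cast at hj; omega)]
    | succ n ih =>
      intro j hj
      push_cast at hj
      rw [walk_succ, ih _ (by omega), ih _ (by omega), ih _ (by omega)]
      simp
  induction n generalizing k with
  | zero =>
    simp only [countHalves, walk]
    rcases k with - | k
    · simp
    · rw [if_neg (by omega), if_neg (by push_cast; omega)]; simp
  | succ n ih =>
    have h3 := ih k
    rw [walk_succ]
    rcases k with - | k
    · simp only [countHalves]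
      have h4 := hlt n (2 * (0 : ℕ) - ((n + 1 : ℕ) : ℤ) - 1) (by push_cast; omega)
      rw [h4]
      simp at h3 ⊢
      rw [h3]
    · have h2 := ih k
      simp only [countHalves]
      simp at h2 h3 ⊢
      rw [h2, h3]
      ring_nf

theorem countHalves_TL_pos {n k : ℕ} (hk : k ≤ n) (h : Even (n - k)) :
    0 < countHalves (fun p s => p ≠ s) n k := by
  induction n generalizing k with
  | zero => obtain rfl : k = 0 := by omega
            simp [countHalves]
  | succ n ih =>
    obtain ⟨m, hm⟩ := h
    rcases k with - | k
    · have := ih (k := 1) (by omega) ⟨m - 1, by omega⟩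
      simp only [countHalves]
      simp at this ⊢
      omega
    · have := ih (k := k) (by omega) ⟨m, by omega⟩
      simp only [countHalves]
      simp at this ⊢
      omega

theorem countHalves_Mo_pos {n k : ℕ} (hk : k ≤ n) :
    0 < countHalves (fun p s => ¬ (p = true ∧ s = true)) n k := by
  induction n generalizing k with
  | zero => obtain rfl : k = 0 := by omega
            simp [countHalves]
  | succ n ih =>
    rcases k with - | k
    · have := ih (k := 0) (by omega)
      simp only [countHalves]
      simp at this ⊢
      omega
    · have := ih (k := k) (by omega)
      simp only [countHalves]
      simp at this ⊢
      omega

theorem countHalves_PPa_pos {n k : ℕ} (hk : k ≤ n) :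
    0 < countHalves (fun _ _ => True) n k := by
  induction n generalizing k with
  | zero => obtain rfl : k = 0 := by omega
            simp [countHalves]
  | succ n ih =>
    rcases k with - | k
    · have := ih (k := 0) (by omega)
      simp only [countHalves]
      simp at this ⊢
      omega
    · have := ih (k := k) (by omega)
      simp only [countHalves]
      simp at this ⊢
      omega

theorem countHalves_PRo_pos {n k : ℕ} (hk : k ≤ n) :
    0 < countHalves (fun p _ => p = false) n k := by
  induction n generalizing k with
  | zero => obtain rfl : k = 0 := by omega
            simp [countHalves]
  | succ n ih =>
    rcases k with - | k
    · have := ih (k := 0) (by omega)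
      simp only [countHalves]
      simp at this ⊢
      omega
    · have := ih (k := k) (by omega)
      simp only [countHalves]
      simp at this ⊢
      omega

end PartDiag

/-! ### Fourier analysis and the local limit theorems -/

open MeasureTheory in
theorem integral_exp_neg_mul_sq_mul_cos {b : ℝ} (hb : 0 < b) (x : ℝ) :
    ∫ θ : ℝ, Real.exp (-b * θ ^ 2) * Real.cos (x * θ) =
      √(Real.pi / b) * Real.exp (-(x ^ 2 / (4 * b))) := by
  have h := fourierIntegral_gaussian (b := (b : ℂ)) (by simpa using hb) (x : ℂ)
  have h1 : ∀ θ : ℝ, Complex.exp (Complex.I * x * θ) * Complex.exp (-b * θ ^ 2) =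
      ((Real.exp (-b * θ ^ 2) * Real.cos (x * θ) : ℝ) : ℂ) +
        ((Real.exp (-b * θ ^ 2) * Real.sin (x * θ) : ℝ) : ℂ) * Complex.I := by
    intro θ
    rw [show Complex.I * x * θ = ((x * θ : ℝ) : ℂ) * Complex.I by push_cast; ring,
      Complex.exp_mul_I]
    push_cast
    ring
  have hexp := integrable_exp_neg_mul_sq hb
  have hcos : Integrable fun θ : ℝ => Real.exp (-b * θ ^ 2) * Real.cos (x * θ) := by
    refine hexp.mul_bdd (c := 1) (by fun_prop) ?_
    filter_upwards with θ
    exact Real.abs_cos_le_one _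
  have hsin : Integrable fun θ : ℝ => Real.exp (-b * θ ^ 2) * Real.sin (x * θ) := by
    refine hexp.mul_bdd (c := 1) (by fun_prop) ?_
    filter_upwards with θ
    exact Real.abs_sin_le_one _
  simp_rw [h1] at h
  rw [integral_add hcos.ofReal (hsin.ofReal.mul_const _), integral_mul_const,
    integral_complex_ofReal, integral_complex_ofReal] at h
  have h2 : ((Real.pi : ℂ) / b) ^ (1 / 2 : ℂ) * Complex.exp (-(x : ℂ) ^ 2 / (4 * b)) =
      ((√(Real.pi / b) * Real.exp (-(x ^ 2 / (4 * b))) : ℝ) : ℂ) := by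
    rw [Real.sqrt_eq_rpow]
    push_cast
    rw [Complex.ofReal_cpow (by positivity)]
    push_cast
    congr 2
    ring
  rw [h2] at h
  have h3 := congrArg Complex.re h
  rwa [Complex.add_re, Complex.ofReal_re, Complex.re_ofReal_mul, Complex.I_re, mul_zero, add_zero,
    Complex.ofReal_re] at h3

theorem integrable_pow_four_mul_exp {b : ℝ} (hb : 0 < b) :
    MeasureTheory.Integrable fun θ : ℝ => θ ^ 4 * Real.exp (-b * θ ^ 2) := by
  have h := integrable_rpow_mul_exp_neg_mul_sq hb (s := (4 : ℕ)) (by norm_num)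
  simpa only [Real.rpow_natCast] using h

theorem integral_pow_four_mul_exp {b : ℝ} (hb : 0 < b) :
    ∫ θ : ℝ, θ ^ 4 * Real.exp (-b * θ ^ 2) =
      (b ^ 2 * √b)⁻¹ * ∫ θ : ℝ, θ ^ 4 * Real.exp (-1 * θ ^ 2) := by
  have h := MeasureTheory.Measure.integral_comp_mul_left
    (fun θ : ℝ => θ ^ 4 * Real.exp (-1 * θ ^ 2)) (√b)
  have hs : 0 < √b := Real.sqrt_pos.2 hb
  have hs2 : √b ^ 2 = b := Real.sq_sqrt hb.le
  have h1 : ∀ θ : ℝ, (√b * θ) ^ 4 * Real.exp (-1 * (√b * θ) ^ 2) =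
      b ^ 2 * (θ ^ 4 * Real.exp (-b * θ ^ 2)) := by
    intro θ
    rw [show (√b * θ) ^ 4 = (√b ^ 2) ^ 2 * θ ^ 4 by ring,
      show -1 * (√b * θ) ^ 2 = -(√b ^ 2) * θ ^ 2 by ring, hs2]
    ring
  simp_rw [h1] at h
  rw [MeasureTheory.integral_const_mul, abs_of_pos (inv_pos.2 hs), smul_eq_mul] at h
  rw [mul_inv, mul_assoc, ← h, inv_mul_cancel_left₀ (by positivity)]

open MeasureTheory in
/-- A local limit theorem: powers of a function close to a Gaussian function have Fourier
coefficients close to those of the powers of the Gaussian function. -/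
theorem exists_fourier_bound {φ : ℝ → ℝ} (hφ : Continuous φ) {a c A : ℝ} (hc : 0 < c)
    (hca : c ≤ a) (h1 : ∀ θ, |θ| ≤ Real.pi → |φ θ| ≤ Real.exp (-c * θ ^ 2))
    (h2 : ∀ θ, |φ θ - Real.exp (-a * θ ^ 2)| ≤ A * θ ^ 4) :
    ∃ B, ∀ n : ℕ, 1 ≤ n → ∀ x : ℝ,
      |(∫ θ in -Real.pi..Real.pi, φ θ ^ n * Real.cos (x * θ)) -
        √(Real.pi / (a * n)) * Real.exp (-(x ^ 2 / (4 * (a * n))))| ≤ B * (n * √n)⁻¹ := by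
  have ha : 0 < a := hc.trans_le hca
  have hA : 0 ≤ A := by
    have := (abs_nonneg _).trans (h2 1)
    simpa using this
  set A' := A * Real.exp (c * Real.pi ^ 2) + 1 with hA'
  have hA'0 : 0 ≤ A' := by positivity
  set J := ∫ θ : ℝ, θ ^ 4 * Real.exp (-1 * θ ^ 2)
  refine ⟨A' * (c ^ 2 * √c)⁻¹ * J, fun n hn x => ?_⟩
  have hn0 : (0 : ℝ) < n := by exact_mod_cast hn
  have hn1 : (1 : ℝ) ≤ n := by exact_mod_cast hn
  let ψ : ℝ → ℝ := (Set.Ioc (-Real.pi) Real.pi).indicator fun θ => φ θ ^ n * Real.cos (x * θ)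
  have hψ : Integrable ψ := by
    refine (IntegrableOn.integrable_indicator ?_ measurableSet_Ioc)
    exact (Continuous.integrableOn_Icc (by fun_prop)).mono_set Set.Ioc_subset_Icc_self
  have hψi : ∫ θ in -Real.pi..Real.pi, φ θ ^ n * Real.cos (x * θ) = ∫ θ, ψ θ := by
    rw [intervalIntegral.integral_of_le (by linarith [Real.pi_pos]),
      integral_indicator measurableSet_Ioc]
  have han : 0 < a * n := by positivity
  have hcn : 0 < c * n := by positivity
  have hg : Integrable fun θ : ℝ => Real.exp (-(a * n) * θ ^ 2) * Real.cos (x * θ) := by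
    refine (integrable_exp_neg_mul_sq han).mul_bdd (c := 1) (by fun_prop) ?_
    filter_upwards with θ
    exact Real.abs_cos_le_one _
  have hexp : ∀ θ : ℝ, Real.exp (-(a * n) * θ ^ 2) = Real.exp (-a * θ ^ 2) ^ n := by
    intro θ
    rw [← Real.exp_nat_mul]
    congr 1
    ring
  have hle : ∀ θ : ℝ, Real.exp (-a * θ ^ 2) ≤ Real.exp (-c * θ ^ 2) := by
    intro θ
    refine Real.exp_le_exp.2 ?_
    nlinarith [sq_nonneg θ]
  have hbound : ∀ θ : ℝ, |ψ θ - Real.exp (-(a * n) * θ ^ 2) * Real.cos (x * θ)| ≤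
      n * A' * (θ ^ 4 * Real.exp (-(c * n) * θ ^ 2)) := by
    intro θ
    by_cases hθ : θ ∈ Set.Ioc (-Real.pi) Real.pi
    · have hθ' : |θ| ≤ Real.pi := abs_le.2 ⟨hθ.1.le, hθ.2⟩
      have e1 : ψ θ = φ θ ^ n * Real.cos (x * θ) := Set.indicator_of_mem hθ _
      rw [e1, ← sub_mul, abs_mul, hexp]
      have e2 := abs_pow_sub_pow_le (φ θ) (Real.exp (-a * θ ^ 2)) n
      have e3 : max |φ θ| |Real.exp (-a * θ ^ 2)| ≤ Real.exp (-c * θ ^ 2) :=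
        max_le (h1 θ hθ') (by rw [abs_of_pos (Real.exp_pos _)]; exact hle θ)
      -- The difference of the `n`-th powers is at most `n` times the difference of the bases times
      -- a power `n - 1`; the missing factor costs at most `exp (c π²)` on the interval.
      have e4 : Real.exp (-c * θ ^ 2) ^ (n - 1) ≤
          Real.exp (c * Real.pi ^ 2) * Real.exp (-(c * n) * θ ^ 2) := by
        rw [← Real.exp_nat_mul, ← Real.exp_add, Real.exp_le_exp]
        have e5 : θ ^ 2 ≤ Real.pi ^ 2 := sq_le_sq' hθ.1.le hθ.2
        rw [Nat.cast_sub hn]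
        push_cast
        nlinarith
      calc |φ θ ^ n - Real.exp (-a * θ ^ 2) ^ n| * |Real.cos (x * θ)|
          ≤ |φ θ ^ n - Real.exp (-a * θ ^ 2) ^ n| * 1 := by
            gcongr; exact Real.abs_cos_le_one _
        _ ≤ (A * θ ^ 4) * n * Real.exp (-c * θ ^ 2) ^ (n - 1) := by
            rw [mul_one]
            refine e2.trans ?_
            gcongr
            · exact h2 θ
        _ ≤ (A * θ ^ 4) * n * (Real.exp (c * Real.pi ^ 2) * Real.exp (-(c * n) * θ ^ 2)) := by
            gcongr
        _ = n * (A * Real.exp (c * Real.pi ^ 2)) * (θ ^ 4 * Real.exp (-(c * n) * θ ^ 2)) := by ring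
        _ ≤ n * A' * (θ ^ 4 * Real.exp (-(c * n) * θ ^ 2)) := by
            gcongr
            rw [hA']
            linarith
    · have e1 : ψ θ = 0 := Set.indicator_of_notMem hθ _
      -- Outside the interval only the Gaussian is left, and it is absorbed because `θ ^ 4 ≥ 1`
      -- there.
      have e2 : 1 ≤ θ ^ 4 := by
        have e3 : Real.pi ≤ |θ| := by
          by_contra h
          exact hθ ⟨(abs_lt.1 (not_le.1 h)).1, (abs_lt.1 (not_le.1 h)).2.le⟩
        have e4 : (1 : ℝ) ≤ |θ| := by linarith [Real.pi_gt_three]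
        rw [← Even.pow_abs (by decide : Even 4)]
        exact one_le_pow₀ e4
      rw [e1, zero_sub, abs_neg, abs_mul, abs_of_pos (Real.exp_pos _)]
      have e5 : Real.exp (-(a * n) * θ ^ 2) ≤ Real.exp (-(c * n) * θ ^ 2) := by
        refine Real.exp_le_exp.2 ?_
        have : c * n ≤ a * n := by gcongr
        nlinarith [sq_nonneg θ]
      have e6 : 1 ≤ n * A' := by
        have : 1 ≤ A' := by rw [hA']; have : 0 ≤ A * Real.exp (c * Real.pi ^ 2) := by positivity
                            linarith
        nlinarith
      calc Real.exp (-(a * n) * θ ^ 2) * |Real.cos (x * θ)|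
          ≤ Real.exp (-(c * n) * θ ^ 2) * 1 := by
            gcongr
            exact Real.abs_cos_le_one _
        _ ≤ (n * A' * θ ^ 4) * Real.exp (-(c * n) * θ ^ 2) := by
            rw [mul_comm]
            gcongr
            nlinarith
        _ = _ := by ring
  rw [hψi, ← integral_exp_neg_mul_sq_mul_cos han, ← integral_sub hψ hg]
  have hint := (integrable_pow_four_mul_exp hcn).const_mul (n * A')
  have hfin := norm_integral_le_of_norm_le
    (f := fun θ => ψ θ - Real.exp (-(a * n) * θ ^ 2) * Real.cos (x * θ)) hint (ae_of_all _ hbound)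
  rw [Real.norm_eq_abs, integral_const_mul, integral_pow_four_mul_exp hcn] at hfin
  change _ ≤ (n : ℝ) * A' * (((c * n) ^ 2 * √(c * n))⁻¹ * J) at hfin
  clear_value J
  -- The fourth moment scales like `n ^ (-5/2)`; with the factor `n` this gives the error `n ^
  -- (-3/2)`.
  refine hfin.trans (le_of_eq ?_)
  rw [Real.sqrt_mul hc.le]
  have hsn : 0 < √(n : ℝ) := Real.sqrt_pos.2 hn0
  have hsc : 0 < √c := Real.sqrt_pos.2 hc
  field_simp

theorem abs_cos_sub_le (y : ℝ) : |Real.cos y - (1 - y ^ 2 / 2)| ≤ 3 * y ^ 4 := by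
  have hy : |y| ^ 4 = y ^ 4 := Even.pow_abs (by decide) y
  by_cases h : |y| ≤ 1
  · have h1 := Real.cos_bound h
    rw [hy] at h1
    have : 0 ≤ y ^ 4 := by positivity
    linarith
  · have h2 : 1 ≤ y ^ 2 := by rw [← sq_abs]; nlinarith [not_le.1 h]
    have h3 := Real.abs_cos_le_one y
    rw [abs_le] at h3 ⊢
    have h4 : y ^ 4 = y ^ 2 * y ^ 2 := by ring
    constructor <;> nlinarith

theorem abs_exp_neg_sub_le {t : ℝ} (ht : 0 ≤ t) : |Real.exp (-t) - (1 - t)| ≤ t ^ 2 := by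
  by_cases h : t ≤ 1
  · have h1 := Real.abs_exp_sub_one_sub_id_le (x := -t) (by rw [abs_neg, abs_of_nonneg ht]; exact h)
    rw [show Real.exp (-t) - 1 - -t = Real.exp (-t) - (1 - t) by ring] at h1
    simpa using h1
  · have h1 := Real.add_one_le_exp (-t)
    have h2 : Real.exp (-t) ≤ 1 := Real.exp_le_one_iff.2 (by linarith)
    rw [abs_of_nonneg (by linarith)]
    nlinarith

theorem abs_cos_half_le {θ : ℝ} (h : |θ| ≤ Real.pi) :
    |Real.cos (θ / 2)| ≤ Real.exp (-(1 / (2 * Real.pi ^ 2)) * θ ^ 2) := by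
  have hp := Real.pi_pos
  have h' := abs_le.1 h
  have h1 : 0 ≤ Real.cos (θ / 2) := Real.cos_nonneg_of_mem_Icc ⟨by linarith, by linarith⟩
  have h2 : Real.cos (θ / 2) ≤ 1 - 2 / Real.pi ^ 2 * (θ / 2) ^ 2 :=
    Real.cos_le_one_sub_mul_cos_sq (abs_le.2 ⟨by linarith, by linarith⟩)
  rw [abs_of_nonneg h1]
  have h3 := Real.add_one_le_exp (-(1 / (2 * Real.pi ^ 2)) * θ ^ 2)
  have h4 : 2 / Real.pi ^ 2 * (θ / 2) ^ 2 = 1 / (2 * Real.pi ^ 2) * θ ^ 2 := by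
    field_simp
  linarith

theorem abs_cos_half_sub_le (θ : ℝ) :
    |Real.cos (θ / 2) - Real.exp (-(1 / 8) * θ ^ 2)| ≤ 1 * θ ^ 4 := by
  have h1 := abs_le.1 (abs_cos_sub_le (θ / 2))
  have h2 := abs_le.1 (abs_exp_neg_sub_le (t := 1 / 8 * θ ^ 2) (by positivity))
  rw [← neg_mul] at h2
  have h3 : 0 ≤ θ ^ 4 := by positivity
  rw [abs_le]
  ring_nf at h1 h2 ⊢
  constructor <;> linarith

theorem abs_one_add_two_cos_le {θ : ℝ} (h : |θ| ≤ Real.pi) :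
    |(1 + 2 * Real.cos θ) / 3| ≤ Real.exp (-(1 / Real.pi ^ 2) * θ ^ 2) := by
  have hp := Real.pi_pos
  have h' := abs_le.1 h
  have h2 : Real.cos θ ≤ 1 - 2 / Real.pi ^ 2 * θ ^ 2 := Real.cos_le_one_sub_mul_cos_sq h
  have h3 := Real.add_one_le_exp (-(1 / Real.pi ^ 2) * θ ^ 2)
  have h4 : 0 ≤ 1 / Real.pi ^ 2 * θ ^ 2 := by positivity
  have h5 : 2 / Real.pi ^ 2 * θ ^ 2 = 2 * (1 / Real.pi ^ 2 * θ ^ 2) := by ring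
  have h6 : 1 / Real.pi ^ 2 * θ ^ 2 ≤ 1 := by
    rw [one_div, inv_mul_le_one₀ (by positivity)]
    exact sq_le_sq' h'.1 h'.2
  have h7 : Real.exp (-1) ≤ Real.exp (-(1 / Real.pi ^ 2) * θ ^ 2) :=
    Real.exp_le_exp.2 (by linarith)
  -- Needed for negative values: `(1 + 2 cos θ) / 3` is at least `-1/3`, while the Gaussian is at
  -- least `exp (-1)` on the interval.
  have h8 : 1 / 3 ≤ Real.exp (-1) := by
    rw [Real.exp_neg, one_div]
    gcongr
    linarith [Real.exp_one_lt_d9]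
  have h9 := Real.neg_one_le_cos θ
  rw [abs_le]
  constructor <;> linarith

theorem abs_one_add_two_cos_sub_le (θ : ℝ) :
    |(1 + 2 * Real.cos θ) / 3 - Real.exp (-(1 / 3) * θ ^ 2)| ≤ 3 * θ ^ 4 := by
  have h1 := abs_le.1 (abs_cos_sub_le θ)
  have h2 := abs_le.1 (abs_exp_neg_sub_le (t := 1 / 3 * θ ^ 2) (by positivity))
  rw [← neg_mul] at h2
  have h3 : 0 ≤ θ ^ 4 := by positivity
  rw [abs_le]
  ring_nf at h1 h2 ⊢
  constructor <;> linarith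

theorem integral_cos_int_mul (k : ℤ) :
    ∫ θ in -Real.pi..Real.pi, Real.cos (k * θ) = if k = 0 then 2 * Real.pi else 0 := by
  split_ifs with h
  · subst h
    simp
    ring
  · have hk : (k : ℝ) ≠ 0 := by exact_mod_cast h
    rw [intervalIntegral.integral_comp_mul_left _ hk, integral_cos, mul_neg, Real.sin_neg,
      Real.sin_int_mul_pi]
    simp

/-- Walks with `c` steps `0`, as Fourier coefficients. -/
theorem walk_eq_integral (c : ℤ) (n : ℕ) (k : ℤ) :
    2 * Real.pi * (walk c n k : ℝ) =
      ∫ θ in -Real.pi..Real.pi, (c + 2 * Real.cos θ) ^ n * Real.cos (k * θ) := by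
  induction n generalizing k with
  | zero =>
    simp only [pow_zero, one_mul, integral_cos_int_mul, walk]
    split_ifs <;> simp
  | succ n ih =>
    have h1 : ∀ θ : ℝ, ((c : ℝ) + 2 * Real.cos θ) ^ (n + 1) * Real.cos (k * θ) =
        (c + 2 * Real.cos θ) ^ n * Real.cos ((k - 1 : ℤ) * θ) +
        c * ((c + 2 * Real.cos θ) ^ n * Real.cos (k * θ)) +
        (c + 2 * Real.cos θ) ^ n * Real.cos ((k + 1 : ℤ) * θ) := by
      intro θ
      have e1 : ((k - 1 : ℤ) : ℝ) * θ = k * θ - θ := by push_cast; ring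
      have e2 : ((k + 1 : ℤ) : ℝ) * θ = k * θ + θ := by push_cast; ring
      rw [e1, e2, Real.cos_sub, Real.cos_add]
      ring
    simp_rw [h1]
    rw [intervalIntegral.integral_add, intervalIntegral.integral_add,
      intervalIntegral.integral_const_mul, ← ih, ← ih, ← ih, walk_succ]
    · push_cast; ring
    all_goals exact Continuous.intervalIntegrable (by fun_prop) _ _

/-- Walks without steps `0`, as Fourier coefficients. -/
theorem walk_zero_eq_integral (n : ℕ) (k : ℤ) (h : Even (n + k)) :
    2 * Real.pi * (walk 0 n k : ℝ) =
      ∫ θ in -Real.pi..Real.pi, (2 * Real.cos (θ / 2)) ^ n * Real.cos (k / 2 * θ) := by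
  induction n generalizing k with
  | zero =>
    obtain ⟨m, hm⟩ := h
    have hm' : k = m + m := by simpa using hm
    subst hm'
    have h1 : (((m + m : ℤ) : ℝ)) / 2 = m := by push_cast; ring
    simp only [pow_zero, one_mul, h1, integral_cos_int_mul, walk]
    have h2 : m + m = 0 ↔ m = 0 := by omega
    simp only [h2]
    split_ifs <;> simp
  | succ n ih =>
    have h1 : ∀ θ : ℝ, (2 * Real.cos (θ / 2)) ^ (n + 1) * Real.cos (k / 2 * θ) =
        (2 * Real.cos (θ / 2)) ^ n * Real.cos ((k - 1 : ℤ) / 2 * θ) +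
        (2 * Real.cos (θ / 2)) ^ n * Real.cos ((k + 1 : ℤ) / 2 * θ) := by
      intro θ
      have e1 : ((k - 1 : ℤ) : ℝ) / 2 * θ = k / 2 * θ - θ / 2 := by push_cast; ring
      have e2 : ((k + 1 : ℤ) : ℝ) / 2 * θ = k / 2 * θ + θ / 2 := by push_cast; ring
      rw [e1, e2, Real.cos_sub, Real.cos_add]
      ring
    obtain ⟨m, hm⟩ := h
    push_cast at hm
    simp_rw [h1]
    rw [intervalIntegral.integral_add, ← ih _ ⟨m - 1, by omega⟩, ← ih _ ⟨m, by omega⟩, walk_succ]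
    · push_cast; ring
    all_goals exact Continuous.intervalIntegrable (by fun_prop) _ _

/-- The local limit theorem for walks without steps `0`. -/
theorem exists_walk_zero_bound : ∃ C > 0, ∃ B, ∀ n : ℕ, 1 ≤ n → ∀ k : ℤ, Even (n + k) →
    |(walk 0 n k : ℝ) / 2 ^ n - C * (√(n : ℝ))⁻¹ * Real.exp (-((k : ℝ) ^ 2 / (2 * n)))| ≤
      B * (n * √(n : ℝ))⁻¹ := by
  have hp := Real.pi_pos
  -- Powers of `cos θ` would peak at `±π` as well as at `0`. For `n + k` even the half angle is
  -- available, with a single peak, where `cos (θ / 2)` agrees with `exp (-θ² / 8)` to second order.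
  obtain ⟨B, hB⟩ := exists_fourier_bound (φ := fun θ => Real.cos (θ / 2)) (by fun_prop)
    (a := 1 / 8) (c := 1 / (2 * Real.pi ^ 2)) (A := 1) (by positivity)
    (by gcongr; nlinarith [Real.pi_gt_three]) (fun θ h => abs_cos_half_le h)
    abs_cos_half_sub_le
  refine ⟨(2 * Real.pi)⁻¹ * √(8 * Real.pi), by positivity, (2 * Real.pi)⁻¹ * B,
    fun n hn k hk => ?_⟩
  have hn0 : (0 : ℝ) < n := by exact_mod_cast hn
  have h := hB n hn (k / 2)
  have h1 : ∫ θ in -Real.pi..Real.pi, Real.cos (θ / 2) ^ n * Real.cos (k / 2 * θ) =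
      2 * Real.pi * ((walk 0 n k : ℝ) / 2 ^ n) := by
    rw [← mul_div_assoc, walk_zero_eq_integral n k hk, eq_div_iff (by positivity),
      ← intervalIntegral.integral_mul_const]
    congr 1
    funext θ
    ring
  have h2 : √(Real.pi / (1 / 8 * n)) = √(8 * Real.pi) * (√(n : ℝ))⁻¹ := by
    rw [← Real.sqrt_inv, ← Real.sqrt_mul (by positivity)]
    congr 1
    field_simp
  have h3 : ((k : ℝ) / 2) ^ 2 / (4 * (1 / 8 * n)) = (k : ℝ) ^ 2 / (2 * n) := by
    field_simp
    ring
  rw [h1, h2, h3] at h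
  have h4 : (walk 0 n k : ℝ) / 2 ^ n - (2 * Real.pi)⁻¹ * √(8 * Real.pi) * (√(n : ℝ))⁻¹ *
      Real.exp (-((k : ℝ) ^ 2 / (2 * n))) = (2 * Real.pi)⁻¹ *
      (2 * Real.pi * ((walk 0 n k : ℝ) / 2 ^ n) - √(8 * Real.pi) * (√(n : ℝ))⁻¹ *
      Real.exp (-((k : ℝ) ^ 2 / (2 * n)))) := by
    field_simp
  rw [h4, abs_mul, abs_of_pos (a := (2 * Real.pi)⁻¹) (by positivity), mul_assoc _ B]
  exact mul_le_mul_of_nonneg_left h (by positivity)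

/-- The local limit theorem for walks with one kind of step `0`. -/
theorem exists_walk_one_bound : ∃ C > 0, ∃ B, ∀ n : ℕ, 1 ≤ n → ∀ k : ℤ,
    |(walk 1 n k : ℝ) / 3 ^ n - C * (√(n : ℝ))⁻¹ * Real.exp (-(3 * (k : ℝ) ^ 2 / (4 * n)))| ≤
      B * (n * √(n : ℝ))⁻¹ := by
  have hp := Real.pi_pos
  -- The steps `0` remove the parity problem, and `(1 + 2 cos θ) / 3` is `1 - θ² / 3` to second
  -- order.
  obtain ⟨B, hB⟩ := exists_fourier_bound (φ := fun θ => (1 + 2 * Real.cos θ) / 3) (by fun_prop)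
    (a := 1 / 3) (c := 1 / Real.pi ^ 2) (A := 3) (by positivity)
    (by gcongr; nlinarith [Real.pi_gt_three]) (fun θ h => abs_one_add_two_cos_le h)
    abs_one_add_two_cos_sub_le
  refine ⟨(2 * Real.pi)⁻¹ * √(3 * Real.pi), by positivity, (2 * Real.pi)⁻¹ * B,
    fun n hn k => ?_⟩
  have hn0 : (0 : ℝ) < n := by exact_mod_cast hn
  have h := hB n hn k
  have h1 : ∫ θ in -Real.pi..Real.pi, ((1 + 2 * Real.cos θ) / 3) ^ n * Real.cos (k * θ) =
      2 * Real.pi * ((walk 1 n k : ℝ) / 3 ^ n) := by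
    rw [← mul_div_assoc, walk_eq_integral 1 n k, eq_div_iff (by positivity),
      ← intervalIntegral.integral_mul_const]
    congr 1
    funext θ
    rw [div_pow]
    push_cast
    field_simp
  have h2 : √(Real.pi / (1 / 3 * n)) = √(3 * Real.pi) * (√(n : ℝ))⁻¹ := by
    rw [← Real.sqrt_inv, ← Real.sqrt_mul (by positivity)]
    congr 1
    field_simp
  have h3 : (k : ℝ) ^ 2 / (4 * (1 / 3 * n)) = 3 * (k : ℝ) ^ 2 / (4 * n) := by
    field_simp
  rw [h1, h2, h3] at h
  have h4 : (walk 1 n k : ℝ) / 3 ^ n - (2 * Real.pi)⁻¹ * √(3 * Real.pi) * (√(n : ℝ))⁻¹ *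
      Real.exp (-(3 * (k : ℝ) ^ 2 / (4 * n))) = (2 * Real.pi)⁻¹ *
      (2 * Real.pi * ((walk 1 n k : ℝ) / 3 ^ n) - √(3 * Real.pi) * (√(n : ℝ))⁻¹ *
      Real.exp (-(3 * (k : ℝ) ^ 2 / (4 * n)))) := by
    field_simp
  rw [h4, abs_mul, abs_of_pos (a := (2 * Real.pi)⁻¹) (by positivity), mul_assoc _ B]
  exact mul_le_mul_of_nonneg_left h (by positivity)

/-! ### Asymptotics of the counts and the theorem -/

theorem rpow_neg_half (n : ℕ) : (n : ℝ) ^ (-(1 / 2) : ℝ) = (√(n : ℝ))⁻¹ := by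
  rw [Real.rpow_neg (Nat.cast_nonneg n), Real.sqrt_eq_rpow]

theorem rpow_neg_three_half (n : ℕ) : (n : ℝ) ^ (-(3 / 2) : ℝ) = ((n : ℝ) * √(n : ℝ))⁻¹ := by
  rw [Real.rpow_neg (Nat.cast_nonneg n), Real.sqrt_eq_rpow, show (3 / 2 : ℝ) = 1 + 1 / 2 by norm_num,
    Real.rpow_add_of_nonneg (Nat.cast_nonneg n) (by norm_num) (by norm_num), Real.rpow_one]

/-- Applied with `t = (√n)⁻¹`: the main term at `(n + 1, k + 1)` differs from that at `(n, k)` by a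
ratio `q` of powers and a change `δ` of the exponent. -/
theorem abs_mul_exp_sub_one_le {q t δ D : ℝ} (hq0 : 0 ≤ q) (hq1 : q ≤ 1) (hq : 1 - q ≤ 2 * t)
    (ht0 : 0 ≤ t) (ht1 : t ≤ 1) (hD : 0 ≤ D) (hδ : |δ| ≤ D * t) :
    |q * Real.exp δ - 1| ≤ (D * Real.exp D + 2) * t := by
  have h1 : |Real.exp δ - 1| ≤ D * t * Real.exp D := by
    have hδD : |δ| ≤ D := hδ.trans (mul_le_of_le_one_right hD ht1)
    have h2 : |Real.exp δ - 1| ≤ |δ| * Real.exp |δ| := by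
      rcases le_total 0 δ with h | h
      · have h3 : 0 ≤ Real.exp δ - 1 := by linarith [Real.add_one_le_exp δ]
        rw [abs_of_nonneg h, abs_of_nonneg h3]
        have h4 := Real.add_one_le_exp (-δ)
        have h5 : Real.exp (-δ) * Real.exp δ = 1 := by rw [← Real.exp_add]; simp
        nlinarith [Real.exp_pos δ]
      · have h3 : Real.exp δ - 1 ≤ 0 := by linarith [Real.exp_le_one_iff.2 h]
        rw [abs_of_nonpos h, abs_of_nonpos h3]
        have h4 := Real.add_one_le_exp δ
        have h5 : 1 ≤ Real.exp (-δ) := Real.one_le_exp (by linarith)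
        nlinarith
    refine h2.trans ?_
    gcongr
  have h2 : q * Real.exp δ - 1 = q * (Real.exp δ - 1) - (1 - q) := by ring
  rw [h2]
  refine (abs_sub _ _).trans ?_
  rw [abs_mul, abs_of_nonneg hq0, abs_of_nonneg (sub_nonneg.2 hq1)]
  have h3 : q * |Real.exp δ - 1| ≤ 1 * (D * t * Real.exp D) := by gcongr
  linarith

/-- From a local limit theorem to the asymptotics of ballot numbers. -/
theorem ballot_asymptotics (C B₀ β R : ℝ) (hβ : 0 ≤ β) (hR : 0 ≤ R) :
    ∃ B, ∀ n k : ℕ, 1 ≤ n → (k : ℝ) ≤ R * √(n : ℝ) → ∀ w : ℝ,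
      |w - C * (√((n + 1 : ℕ) : ℝ))⁻¹ *
        Real.exp (-(β * ((k : ℝ) + 1) ^ 2 / ((n + 1 : ℕ) : ℝ)))| ≤
        B₀ * (((n + 1 : ℕ) : ℝ) * √((n + 1 : ℕ) : ℝ))⁻¹ →
      ∃ r, |r| ≤ B * (√(n : ℝ))⁻¹ ∧ ((k : ℝ) + 1) / ((n : ℝ) + 1) * w =
        (C + r) * ((n : ℝ) * √(n : ℝ))⁻¹ * ((k : ℝ) + 1) * Real.exp (-(β * (k : ℝ) ^ 2 / n)) := by
  set D := β * (R + 1) ^ 2 with hDdef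
  -- The first summand bounds the change of the main term. The second bounds the error of the local
  -- limit theorem after division by the Gaussian, which is at least `exp (-β R²)` for `k ≤ R √n`.
  refine ⟨|C| * (D * Real.exp D + 2) + |B₀| * Real.exp (β * R ^ 2), fun n k hn hk w hw => ?_⟩
  have hn1 : (1 : ℝ) ≤ n := by exact_mod_cast hn
  have hk0 : (0 : ℝ) ≤ k := Nat.cast_nonneg k
  push_cast at hw
  have hs2 : √(n : ℝ) ^ 2 = n := Real.sq_sqrt (by linarith)
  have hS2 : √((n : ℝ) + 1) ^ 2 = n + 1 := Real.sq_sqrt (by linarith)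
  have hs1 : 1 ≤ √(n : ℝ) := Real.one_le_sqrt.2 hn1
  have hsS : √(n : ℝ) ≤ √((n : ℝ) + 1) := Real.sqrt_le_sqrt (by linarith)
  generalize (n : ℝ) = x at *
  generalize (k : ℝ) = y at *
  set s := √x
  set S := √(x + 1)
  clear_value s S
  have hs0 : 0 < s := by linarith
  have hS0 : 0 < S := by linarith
  have hx : x = s ^ 2 := hs2.symm
  have ht0 : 0 ≤ s⁻¹ := by positivity
  have ht1 : s⁻¹ ≤ 1 := inv_le_one_of_one_le₀ hs1
  have hD : 0 ≤ D := by positivity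
  set q := (s / S) ^ 3 with hq
  have hp0 : 0 ≤ s / S := by positivity
  have hp1 : s / S ≤ 1 := (div_le_one hS0).2 hsS
  have hq0 : 0 ≤ q := by positivity
  have hq1 : q ≤ 1 := pow_le_one₀ hp0 hp1
  have hp2 : (s / S) ^ 2 = 1 - (S ^ 2)⁻¹ := by
    rw [div_pow, show s ^ 2 = S ^ 2 - 1 by linarith]
    field_simp
  have hSinv : (S ^ 2)⁻¹ ≤ s⁻¹ := by
    gcongr
    nlinarith
  have hq2 : 1 - q ≤ 2 * s⁻¹ := by
    have h1 : (s / S) ^ 4 ≤ q := pow_le_pow_of_le_one hp0 hp1 (by norm_num)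
    have h2 : (s / S) ^ 4 = (1 - (S ^ 2)⁻¹) ^ 2 := by rw [← hp2]; ring
    nlinarith [sq_nonneg (S ^ 2)⁻¹]
  set δ := β * y ^ 2 / x - β * (y + 1) ^ 2 / (x + 1) with hδdef
  -- The term `2 x y` dominates the numerator; with `y ≤ R √x` it is of order `x ^ (3/2)` against
  -- the denominator `x (x + 1)`, whence the order `x ^ (-1/2)`.
  have hδ : |δ| ≤ D * s⁻¹ := by
    have h1 : δ = β * ((y ^ 2 - 2 * x * y - x) / (x * (x + 1))) := by
      rw [hδdef]
      field_simp
      ring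
    have h2 : |y ^ 2 - 2 * x * y - x| ≤ (R + 1) ^ 2 * s ^ 3 := by
      have e1 : y ^ 2 ≤ (R * s) ^ 2 := pow_le_pow_left₀ hk0 hk 2
      have e2 : x * y ≤ s ^ 2 * (R * s) := by rw [hx]; gcongr
      have e3 : (R * s) ^ 2 ≤ R ^ 2 * s ^ 3 := by
        have : s ^ 2 ≤ s ^ 3 := pow_le_pow_right₀ hs1 (by norm_num)
        nlinarith [sq_nonneg R]
      have e4 : x ≤ s ^ 3 := by
        rw [hx]; exact pow_le_pow_right₀ hs1 (by norm_num)
      have e5 : 0 ≤ x * y := by positivity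
      have e6 : 0 ≤ R * s ^ 3 := by positivity
      rw [abs_le]
      constructor <;> nlinarith [sq_nonneg y, sq_nonneg R]
    rw [h1, abs_mul, abs_of_nonneg hβ, abs_div, abs_of_pos (a := x * (x + 1)) (by positivity), hDdef,
      mul_assoc β ((R + 1) ^ 2)]
    refine mul_le_mul_of_nonneg_left ?_ hβ
    rw [div_le_iff₀ (by positivity)]
    refine h2.trans ?_
    have h3 : (R + 1) ^ 2 * s⁻¹ * (x * (x + 1)) = (R + 1) ^ 2 * s ^ 3 + (R + 1) ^ 2 * s := by
      rw [hx]; field_simp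
    rw [h3]
    have : 0 ≤ (R + 1) ^ 2 * s := by positivity
    linarith
  have hmain := abs_mul_exp_sub_one_le hq0 hq1 hq2 ht0 ht1 hD hδ
  set err := w - C * S⁻¹ * Real.exp (-(β * (y + 1) ^ 2 / (x + 1))) with herr
  refine ⟨C * (q * Real.exp δ - 1) + err * (s ^ 3 / S ^ 2) * Real.exp (β * y ^ 2 / x), ?_, ?_⟩
  · refine (abs_add_le _ _).trans ?_
    rw [add_mul]
    refine add_le_add ?_ ?_
    · rw [abs_mul, mul_assoc]
      gcongr
    · rw [abs_mul, abs_mul, abs_of_pos (Real.exp_pos _),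
        abs_of_pos (a := s ^ 3 / S ^ 2) (by positivity)]
      have h1 : Real.exp (β * y ^ 2 / x) ≤ Real.exp (β * R ^ 2) := by
        refine Real.exp_le_exp.2 ?_
        rw [div_le_iff₀ (by positivity), mul_assoc]
        gcongr
        have := pow_le_pow_left₀ hk0 hk 2
        rw [hx]
        linarith [mul_pow R s 2]
      have h2 : |err| * (s ^ 3 / S ^ 2) ≤ |B₀| * s⁻¹ := by
        have h3 : |err| ≤ |B₀| * (S ^ 2 * S)⁻¹ := by
          rw [hS2]
          exact hw.trans (by gcongr; exact le_abs_self _)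
        calc |err| * (s ^ 3 / S ^ 2) ≤ |B₀| * (S ^ 2 * S)⁻¹ * (s ^ 3 / S ^ 2) := by gcongr
          _ = |B₀| * (q * (S ^ 2)⁻¹) := by rw [hq]; field_simp
          _ ≤ |B₀| * (1 * s⁻¹) := by gcongr
          _ = _ := by ring
      calc |err| * (s ^ 3 / S ^ 2) * Real.exp (β * y ^ 2 / x)
          ≤ |B₀| * s⁻¹ * Real.exp (β * R ^ 2) := by gcongr
        _ = _ := by ring
  · have h1 : Real.exp δ = Real.exp (β * y ^ 2 / x) *
        Real.exp (-(β * (y + 1) ^ 2 / (x + 1))) := by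
      rw [← Real.exp_add, hδdef, sub_eq_add_neg]
    have h2 : w = err + C * S⁻¹ * Real.exp (-(β * (y + 1) ^ 2 / (x + 1))) := by
      rw [herr]; ring
    have h3 : Real.exp (-(β * y ^ 2 / x)) = (Real.exp (β * y ^ 2 / x))⁻¹ := Real.exp_neg _
    have h4 : x + 1 = S ^ 2 := hS2.symm
    rw [h1, h3, hq, show C + (C * ((s / S) ^ 3 * (Real.exp (β * y ^ 2 / x) *
        Real.exp (-(β * (y + 1) ^ 2 / (x + 1)))) - 1) + err * (s ^ 3 / S ^ 2) *
        Real.exp (β * y ^ 2 / x)) = s ^ 3 / S ^ 2 * Real.exp (β * y ^ 2 / x) *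
        (err + C * S⁻¹ * Real.exp (-(β * (y + 1) ^ 2 / (x + 1)))) by field_simp; ring, ← h2, h4]
    generalize Real.exp (β * y ^ 2 / x) = E at *
    have hE : E ≠ 0 := by
      intro h
      rw [h] at h3
      simp at h3
    rw [hx]
    field_simp

theorem exists_TL_asymptotics : ∃ C > 0, ∀ R : ℝ, 0 < R → ∃ B : ℝ, ∀ n k : ℕ, 1 ≤ n →
    Even (n + k) → (k : ℝ) ≤ R * √(n : ℝ) → ∃ r : ℝ, |r| ≤ B * (√(n : ℝ))⁻¹ ∧
      ((walk 0 n k - walk 0 n (k + 2) : ℤ) : ℝ) =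
        (C + r) * ((n : ℝ) * √(n : ℝ))⁻¹ * 2 ^ n * ((k : ℝ) + 1) *
          Real.exp (-((k : ℝ) ^ 2 / (2 * n))) := by
  obtain ⟨C, hC, B₀, hB⟩ := exists_walk_zero_bound
  -- The ballot formula leads to walks of length `n + 1`, normalised by `2 ^ (n + 1)`; this is the
  -- factor `2`, and likewise `3` in the Motzkin case.
  refine ⟨2 * C, by positivity, fun R hR => ?_⟩
  obtain ⟨B, h⟩ := ballot_asymptotics C B₀ (1 / 2) R (by norm_num) hR.le
  refine ⟨2 * B, fun n k hn hnk hk => ?_⟩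
  have hn0 : (0 : ℝ) < n := by exact_mod_cast hn
  have e1 := hB (n + 1) (by omega) (k + 1)
    (by obtain ⟨m, hm⟩ := hnk; exact ⟨m + 1, by push_cast; omega⟩)
  have e2 : (((k + 1 : ℤ) : ℝ)) ^ 2 / (2 * ((n + 1 : ℕ) : ℝ)) =
      1 / 2 * ((k : ℝ) + 1) ^ 2 / ((n + 1 : ℕ) : ℝ) := by
    push_cast; field_simp
  rw [e2] at e1
  obtain ⟨r, hr, hw⟩ := h n k hn hk _ e1
  refine ⟨2 * r, ?_, ?_⟩
  · rw [abs_mul, abs_two, mul_assoc]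
    gcongr
  · have e3 : (k : ℝ) ^ 2 / (2 * n) = 1 / 2 * (k : ℝ) ^ 2 / n := by field_simp
    have e4 : ((k : ℝ) + 1) * (walk 0 (n + 1) (k + 1) : ℝ) =
        ((n : ℝ) + 1) * ((walk 0 n k - walk 0 n (k + 2) : ℤ) : ℝ) := by
      exact_mod_cast ballot 0 n k
    have e5 : ((walk 0 n k - walk 0 n (k + 2) : ℤ) : ℝ) = 2 ^ (n + 1) *
        (((k : ℝ) + 1) / ((n : ℝ) + 1) * ((walk 0 (n + 1) (k + 1) : ℝ) / 2 ^ (n + 1))) := by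
      rw [← mul_div_assoc, div_mul_eq_mul_div, e4]
      field_simp
    rw [e5, hw, e3]
    ring

theorem exists_Mo_asymptotics : ∃ C > 0, ∀ R : ℝ, 0 < R → ∃ B : ℝ, ∀ n k : ℕ, 1 ≤ n →
    (k : ℝ) ≤ R * √(n : ℝ) → ∃ r : ℝ, |r| ≤ B * (√(n : ℝ))⁻¹ ∧
      ((walk 1 n k - walk 1 n (k + 2) : ℤ) : ℝ) =
        (C + r) * ((n : ℝ) * √(n : ℝ))⁻¹ * 3 ^ n * ((k : ℝ) + 1) *
          Real.exp (-(3 * (k : ℝ) ^ 2 / (4 * n))) := by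
  obtain ⟨C, hC, B₀, hB⟩ := exists_walk_one_bound
  refine ⟨3 * C, by positivity, fun R hR => ?_⟩
  obtain ⟨B, h⟩ := ballot_asymptotics C B₀ (3 / 4) R (by norm_num) hR.le
  refine ⟨3 * B, fun n k hn hk => ?_⟩
  have hn0 : (0 : ℝ) < n := by exact_mod_cast hn
  have e1 := hB (n + 1) (by omega) (k + 1)
  have e2 : 3 * (((k + 1 : ℤ) : ℝ)) ^ 2 / (4 * ((n + 1 : ℕ) : ℝ)) =
      3 / 4 * ((k : ℝ) + 1) ^ 2 / ((n + 1 : ℕ) : ℝ) := by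
    push_cast; field_simp
  rw [e2] at e1
  obtain ⟨r, hr, hw⟩ := h n k hn hk _ e1
  refine ⟨3 * r, ?_, ?_⟩
  · rw [abs_mul, abs_of_pos (by norm_num : (0 : ℝ) < 3), mul_assoc]
    gcongr
  · have e3 : 3 * (k : ℝ) ^ 2 / (4 * n) = 3 / 4 * (k : ℝ) ^ 2 / n := by field_simp
    have e4 : ((k : ℝ) + 1) * (walk 1 (n + 1) (k + 1) : ℝ) =
        ((n : ℝ) + 1) * ((walk 1 n k - walk 1 n (k + 2) : ℤ) : ℝ) := by
      exact_mod_cast ballot 1 n k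
    have e5 : ((walk 1 n k - walk 1 n (k + 2) : ℤ) : ℝ) = 3 ^ (n + 1) *
        (((k : ℝ) + 1) / ((n : ℝ) + 1) * ((walk 1 (n + 1) (k + 1) : ℝ) / 3 ^ (n + 1))) := by
      rw [← mul_div_assoc, div_mul_eq_mul_div, e4]
      field_simp
    rw [e5, hw, e3]
    ring

/-- No difference is involved, so the local limit theorem applies directly at the position `2 k -
n`, which has the parity of `n`. On the range considered the relative error is `O(n⁻¹)`, hence
eventually below `ε`. -/
theorem exists_PRo_asymptotics : ∃ C > 0, ∀ R : ℝ, 0 < R → ∀ ε : ℝ, 0 < ε → ∃ N : ℕ,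
    ∀ n k : ℕ, 1 ≤ n → N ≤ n → |(k : ℝ) - n / 2| ≤ R * √(n : ℝ) → ∃ r : ℝ, |r| ≤ ε ∧
      (walk 0 n (2 * k - n) : ℝ) = (C + r) * (√(n : ℝ))⁻¹ * 2 ^ n *
        Real.exp (-(2 * ((k : ℝ) - n / 2) ^ 2 / n)) := by
  obtain ⟨C, hC, B, hB⟩ := exists_walk_zero_bound
  refine ⟨C, hC, fun R hR ε hε => ?_⟩
  obtain ⟨N, hN⟩ := exists_nat_ge (|B| * Real.exp (2 * R ^ 2) / ε)
  refine ⟨N, fun n k hn hNn hk => ?_⟩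
  have hn0 : (0 : ℝ) < n := by exact_mod_cast hn
  have hs0 : 0 < √(n : ℝ) := Real.sqrt_pos.2 hn0
  have e1 := hB n hn (2 * k - n) ⟨k, by ring⟩
  have e2 : (((2 * k - n : ℤ) : ℝ)) ^ 2 / (2 * n) = 2 * ((k : ℝ) - n / 2) ^ 2 / n := by
    push_cast
    field_simp
  rw [e2] at e1
  have e3 : 2 * ((k : ℝ) - n / 2) ^ 2 / n ≤ 2 * R ^ 2 := by
    rw [div_le_iff₀ hn0, ← sq_abs]
    have h1 := pow_le_pow_left₀ (abs_nonneg _) hk 2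
    rw [mul_pow, Real.sq_sqrt hn0.le] at h1
    linarith
  generalize 2 * ((k : ℝ) - n / 2) ^ 2 / n = E at *
  set err := (walk 0 n (2 * k - n) : ℝ) / 2 ^ n - C * (√(n : ℝ))⁻¹ * Real.exp (-E) with herr
  refine ⟨err * √(n : ℝ) * Real.exp E, ?_, ?_⟩
  · rw [abs_mul, abs_mul, abs_of_pos hs0, abs_of_pos (Real.exp_pos _)]
    calc |err| * √(n : ℝ) * Real.exp E
        ≤ |B| * (n * √(n : ℝ))⁻¹ * √(n : ℝ) * Real.exp (2 * R ^ 2) := by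
          gcongr
          exact e1.trans (by gcongr; exact le_abs_self _)
      _ = |B| * Real.exp (2 * R ^ 2) / n := by field_simp
      _ ≤ ε := by
          rw [div_le_iff₀ hn0]
          have h1 : |B| * Real.exp (2 * R ^ 2) / ε ≤ n := hN.trans (by exact_mod_cast hNn)
          rw [div_le_iff₀ hε] at h1
          linarith
  · have h1 : (walk 0 n (2 * k - n) : ℝ) = 2 ^ n * (err + C * (√(n : ℝ))⁻¹ * Real.exp (-E)) := by
      rw [herr]
      field_simp
      ring
    rw [h1, Real.exp_neg]
    field_simp
    ring

theorem theoremT :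
    ∃ C_pRo C_TL C_Mo C_pPa : ℝ, 0 < C_pRo ∧ 0 < C_TL ∧ 0 < C_Mo ∧ 0 < C_pPa ∧
      (∀ R : ℝ, 0 < R → ∀ ε : ℝ, 0 < ε → ∃ N : ℕ, ∀ n k : ℕ, 1 ≤ n → N ≤ n → k ≤ n →
        |(k : ℝ) - n / 2| ≤ R * √(n : ℝ) →
        SimpleDim.{v, w} (PartDiag.IsPRo (n := n)) k (fun D => ∃ r : ℝ, |r| ≤ ε ∧
          (D : ℝ) = (C_pRo + r) * (n : ℝ) ^ (-(1 / 2) : ℝ) * 2 ^ n *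
            Real.exp (-(2 * ((k : ℝ) - n / 2) ^ 2 / n)))) ∧
      (∀ R : ℝ, 0 < R → ∃ B : ℝ, ∀ n k : ℕ, 1 ≤ n → k ≤ n → Even (n - k) →
        (k : ℝ) ≤ R * √(n : ℝ) →
        SimpleDim.{v, w} (PartDiag.IsTL (n := n)) k (fun D => ∃ r : ℝ,
          |r| ≤ B * (n : ℝ) ^ (-(1 / 2) : ℝ) ∧
          (D : ℝ) = (C_TL + r) * (n : ℝ) ^ (-(3 / 2) : ℝ) * 2 ^ n * ((k : ℝ) + 1) *
            Real.exp (-((k : ℝ) ^ 2 / (2 * n))))) ∧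
      (∀ R : ℝ, 0 < R → ∃ B : ℝ, ∀ n k : ℕ, 1 ≤ n → k ≤ n →
        (k : ℝ) ≤ R * √(n : ℝ) →
        SimpleDim.{v, w} (PartDiag.IsMo (n := n)) k (fun D => ∃ r : ℝ,
          |r| ≤ B * (n : ℝ) ^ (-(1 / 2) : ℝ) ∧
          (D : ℝ) = (C_Mo + r) * (n : ℝ) ^ (-(3 / 2) : ℝ) * 3 ^ n * ((k : ℝ) + 1) *
            Real.exp (-(3 * (k : ℝ) ^ 2 / (4 * n))))) ∧
      (∀ R : ℝ, 0 < R → ∃ B : ℝ, ∀ n k s : ℕ, 1 ≤ n → s ≤ n → k = 2 * s →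
        (k : ℝ) ≤ R * √(n : ℝ) →
        SimpleDim.{v, w} (PartDiag.IsPPa (n := n)) s (fun D => ∃ r : ℝ,
          |r| ≤ B * (n : ℝ) ^ (-(1 / 2) : ℝ) ∧
          (D : ℝ) = (C_pPa + r) * (n : ℝ) ^ (-(3 / 2) : ℝ) * 4 ^ n * ((k : ℝ) + 1) *
            Real.exp (-((k : ℝ) ^ 2 / (4 * n))))) := by
  obtain ⟨C₁, hC₁, h₁⟩ := exists_PRo_asymptotics
  obtain ⟨C₂, hC₂, h₂⟩ := exists_TL_asymptotics
  obtain ⟨C₃, hC₃, h₃⟩ := exists_Mo_asymptotics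
  have h2 : (0 : ℝ) < √2 := Real.sqrt_pos.2 (by norm_num)
  -- The planar partition case is the Temperley-Lieb estimate at `2 n`, and `(2 n) ^ (-3/2)`
  -- contributes the factor `(2 √2)⁻¹`.
  refine ⟨C₁, C₂, C₃, C₂ * (2 * √2)⁻¹, hC₁, hC₂, hC₃, by positivity, ?_, ?_, ?_, ?_⟩
  · intro R hR ε hε
    obtain ⟨N, hN⟩ := h₁ R hR ε hε
    refine ⟨N, fun n k hn hNn hkn hk => ?_⟩
    refine simpleDim_of_count (PartDiag.isHalved_isPRo n)
      (fun _ => PartDiag.isPRo_iff_hasLetters) (PartDiag.countHalves_PRo_pos hkn) ?_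
    obtain ⟨r, hr, h⟩ := hN n k hn hNn hk
    refine ⟨r, hr, ?_⟩
    rw [rpow_neg_half, ← h]
    exact_mod_cast PartDiag.countHalves_PRo n k
  · intro R hR
    obtain ⟨B, hB⟩ := h₂ R hR
    refine ⟨B, fun n k hn hkn hnk hk => ?_⟩
    refine simpleDim_of_count (PartDiag.isHalved_isTL n)
      (fun _ => PartDiag.isTL_iff_hasLetters) (PartDiag.countHalves_TL_pos hkn hnk) ?_
    obtain ⟨r, hr, h⟩ := hB n k hn
      (by obtain ⟨m, hm⟩ := hnk; exact ⟨m + k, by omega⟩) hk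
    refine ⟨r, by rwa [rpow_neg_half], ?_⟩
    rw [rpow_neg_three_half, ← h]
    exact_mod_cast PartDiag.countHalves_TL n k
  · intro R hR
    obtain ⟨B, hB⟩ := h₃ R hR
    refine ⟨B, fun n k hn hkn hk => ?_⟩
    refine simpleDim_of_count (PartDiag.isHalved_isMo n)
      (fun _ => PartDiag.isMo_iff_hasLetters) (PartDiag.countHalves_Mo_pos hkn) ?_
    obtain ⟨r, hr, h⟩ := hB n k hn hk
    refine ⟨r, by rwa [rpow_neg_half], ?_⟩
    rw [rpow_neg_three_half, ← h]
    exact_mod_cast PartDiag.countHalves_Mo n k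
  · intro R hR
    obtain ⟨B, hB⟩ := h₂ R hR
    refine ⟨(2 * √2)⁻¹ * (B * (√2)⁻¹), fun n k s hn hsn hks hk => ?_⟩
    subst hks
    refine simpleDim_of_count (PartDiag.isHalved_isPPa n)
      (fun _ => PartDiag.isPPa_iff_hasLetters) (PartDiag.countHalves_PPa_pos hsn) ?_
    have hn0 : (0 : ℝ) < n := by exact_mod_cast hn
    have hsq : √((2 * n : ℕ) : ℝ) = √2 * √(n : ℝ) := by
      push_cast
      exact Real.sqrt_mul (by norm_num) _
    have hle : √(n : ℝ) ≤ √((2 * n : ℕ) : ℝ) := Real.sqrt_le_sqrt (by push_cast; linarith)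
    -- The label `k = 2 s` is the Temperley-Lieb label at `2 n`, so the exponent becomes `k² / (4
    -- n)`; the bound `k ≤ R √n` implies the one with `√(2 n)`.
    obtain ⟨r, hr, h⟩ := hB (2 * n) (2 * s) (by omega) ⟨n + s, by ring⟩
      (hk.trans (by gcongr))
    refine ⟨(2 * √2)⁻¹ * r, ?_, ?_⟩
    · rw [rpow_neg_half, abs_mul, abs_of_pos (a := (2 * √2)⁻¹) (by positivity),
        mul_assoc _ _ (√(n : ℝ))⁻¹]
      gcongr
      refine hr.trans (le_of_eq ?_)
      rw [hsq, mul_inv, mul_assoc]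
    · have e1 := PartDiag.countHalves_PPa n s
      have e2 : ((PartDiag.countHalves (fun _ _ => True) n s : ℕ) : ℝ) =
          ((walk 0 (2 * n) (2 * s : ℕ) - walk 0 (2 * n) ((2 * s : ℕ) + 2) : ℤ) : ℝ) := by
        exact_mod_cast e1
      rw [e2, h, rpow_neg_three_half, hsq, pow_mul]
      push_cast
      rw [show (2 : ℝ) * (2 * n) = 4 * n by ring, show (2 : ℝ) ^ 2 = 4 by norm_num]
      have hs : 0 < √(n : ℝ) := Real.sqrt_pos.2 hn0
      field_simp
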